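/- Let $\mathbb{U}$ be the upper half plane, let $\Gamma\subset \mathrm{PSL}(2,\mathbb{R})$ be a discrete subgroup of finite hyperbolic coarea, let $X=\Gamma\backslash\mathbb{U}$, and let $F\subset\mathbb{U}$ be a fundamental domain for $\Gamma$. For $z=x+iy\in\mathbb{U}$ write $d^2z=dx\,dy$ and $dA(z)=y^{-2}d^2z$; $\int_X$ denotes the integral over $F$. Let $\Omega_{-1,1}(X)$ be the space of harmonic Beltrami differentials on $X$, i.e. functions $\mu(z)=y^2\overline{\phi(z)}$ with $\phi:\mathbb{U}\to\mathbb{C}$ holomorphic, $\phi(\gamma z)\gamma'(z)^2=\phi(z)$ for all $\gamma\in\Gamma$, and $\int_X|\phi(z)|^2y^2d^2z<\infty$. Let $\kappa_j\in\Gamma$ be a parabolic generator, that is, a parabolic element whose stabilizer $\Gamma_{\kappa_j}=\{\alpha\in\Gamma : \alpha\kappa_j\alpha^{-1}=\kappa_j\}$ is generated by $\kappa_j$. Let $\sigma_j\in\mathrm{PSL}(2,\mathbb{R})$ be such that $\sigma_j^{-1}\kappa_j\sigma_j=\begin{pmatrix}1&\pm1\\0&1\end{pmatrix}$, let $$E_j(z,s)=\sum_{\gamma\in\Gamma_{\kappa_j}\backslash\Gamma}\left[\mathrm{Im}\,(\sigma_j^{-1}\gamma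 z)\right]^s,\qquad \mathrm{Re}\,s>1,$$ be the Eisenstein series of the corresponding cusp, and let $$\langle\mu,\nu\rangle^{\mathrm{cusp}}_{\mathrm{TZ},j}=\int_X\mu(z)\overline{\nu(z)}E_j(z,2)\,dA(z)$$ be the parabolic Takhtajan--Zograf metric of that cusp. Then for all $\mu,\nu\in\Omega_{-1,1}(X)$ $$\langle\mu,\nu\rangle^{\mathrm{cusp}}_{\mathrm{TZ},j}=-\frac{9}{\pi^3}\sum_{\gamma\in\widetilde\Gamma[\kappa_j]}\int_X\int_{\mathbb{U}}\frac{\mu(z)\overline{\nu(w)}}{(z-\bar w)^2(\gamma z-\bar w)^2}\,\gamma'(z)\,d^2w\,d^2z,$$ where $\widetilde\Gamma[\kappa_j]=\{\alpha\kappa_j^{\ell}\alpha^{-1} : \alpha\in\Gamma,\ \ell\in\mathbb{Z},\ \ell\neq0\}$ is the set of all conjugates of nonzero powers of $\kappa_j$. All the integrals in these two formulas, the series $E_j(z,2)$ for every $z\in\mathbb{U}$, and the sum over $\widetilde\Gamma[\kappa_j]$ converge absolutely. -/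

import Mathlib

open MeasureTheory UpperHalfPlane
open scoped MatrixGroups Manifold ComplexConjugate

noncomputable section

namespace TZ

/-! ### The action of `PSL(2, ℝ)` on the upper half plane -/

theorem center_smul (A : SL(2, ℝ)) (hA : A ∈ Subgroup.center SL(2, ℝ)) (z : ℍ) : A • z = z := by
  obtain ⟨r, hr, hA⟩ := Matrix.SpecialLinearGroup.mem_center_iff.mp hA
  have hr0 : r ≠ 0 := by
    rintro rfl
    simp at hr
  have e : ∀ i j, A i j = Matrix.scalar (Fin 2) r i j := fun i j => by rw [hA]
  have hrc : (r : ℂ) ≠ 0 := by exact_mod_cast hr0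
  ext
  rw [UpperHalfPlane.coe_specialLinearGroup_apply]
  simp [e, hrc]

/-- The homomorphism `PSL(2, ℝ) → Perm ℍ` induced by the action of `SL(2, ℝ)` on `ℍ` by
fractional linear transformations. -/
def pslToPerm : PSL(2, ℝ) →* Equiv.Perm ℍ :=
  QuotientGroup.lift (Subgroup.center SL(2, ℝ)) (MulAction.toPermHom SL(2, ℝ) ℍ)
    (fun A hA => Equiv.ext fun z => center_smul A hA z)

instance pslAction : MulAction PSL(2, ℝ) ℍ := MulAction.compHom ℍ pslToPerm

theorem mk_smul (A : SL(2, ℝ)) (z : ℍ) : (QuotientGroup.mk A : PSL(2, ℝ)) • z = A • z := rfl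

/-- The complex derivative `γ'(z)` of the Möbius transformation `γ` at `z ∈ ℍ`. -/
def mobDeriv (γ : PSL(2, ℝ)) (z : ℍ) : ℂ :=
  deriv (fun w : ℂ => ((γ • ofComplex w : ℍ) : ℂ)) z

/-- The Euclidean area `d²z = dx dy` on `ℍ`. (The canonical `volume` on `ℍ` is the hyperbolic
area `dA(z) = y⁻² dx dy`.) -/
def euclideanArea : Measure ℍ := (volume : Measure ℂ).comap UpperHalfPlane.coe

/-- The translation matrix with rows `(1, t)` and `(0, 1)`. -/
def translationMatrix (t : ℝ) : SL(2, ℝ) :=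
  ⟨!![1, t; 0, 1], by simp [Matrix.det_fin_two]⟩

/-- The class of the translation matrix in `PSL(2, ℝ)`, which acts on `ℍ` by `z ↦ z + t`. -/
def translation (t : ℝ) : PSL(2, ℝ) := QuotientGroup.mk (translationMatrix t)

/-- An element of `PSL(2, ℝ)` is parabolic if it is represented by a parabolic matrix. -/
def IsParabolic (γ : PSL(2, ℝ)) : Prop :=
  ∃ A : SL(2, ℝ), QuotientGroup.mk A = γ ∧ (A : Matrix (Fin 2) (Fin 2) ℝ).IsParabolic

/-! ### Holomorphic quadratic differentials and harmonic Beltrami differentials -/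

/-- `φ : ℍ → ℂ` is a holomorphic quadratic differential of finite norm on `X = Γ \ ℍ`
with fundamental domain `F`: it is holomorphic, `φ(γz) γ'(z)² = φ(z)` for `γ ∈ Γ`, and
`∫_F |φ(z)|² ρ(z)⁻¹ d²z < ∞`, where `ρ(z) = y⁻²`. -/
structure IsQuadraticDifferential (Γ : Subgroup PSL(2, ℝ)) (F : Set ℍ) (φ : ℍ → ℂ) : Prop where
  holomorphic : MDifferentiable 𝓘(ℂ) 𝓘(ℂ) φ
  automorphic : ∀ γ ∈ Γ, ∀ z : ℍ, φ (γ • z) * mobDeriv γ z ^ 2 = φ z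
  finite_norm : IntegrableOn (fun z : ℍ => ‖φ z‖ ^ 2 * z.im ^ 2) F euclideanArea

/-- The space `Ω_{-1,1}(X)` of harmonic Beltrami differentials on `X = Γ \ ℍ`: the functions
`μ(z) = y² conj(φ(z))` with `φ` a holomorphic quadratic differential on `X`. -/
def IsHarmonicBeltrami (Γ : Subgroup PSL(2, ℝ)) (F : Set ℍ) (μ : ℍ → ℂ) : Prop :=
  ∃ φ : ℍ → ℂ, IsQuadraticDifferential Γ F φ ∧ ∀ z : ℍ, μ z = (z.im : ℂ) ^ 2 * conj (φ z)

/-! ### Cusps -/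

section Cusp

variable {Γ : Subgroup PSL(2, ℝ)}

/-- `Γ_κ`, the stabilizer of `κ ∈ Γ`: all `α ∈ Γ` with `α κ α⁻¹ = κ`. -/
def stab (κ : Γ) : Subgroup Γ := Subgroup.centralizer {κ}

/-- `κ` is a parabolic generator of `Γ` (the generator attached to a cusp): it is parabolic, and
its stabilizer `Γ_κ` is the infinite cyclic group generated by `κ`. -/
structure IsParabolicGenerator (κ : Γ) : Prop where
  parabolic : IsParabolic (κ : PSL(2, ℝ))
  stab_eq : stab κ = Subgroup.zpowers κ

/-- `σ ∈ PSL(2, ℝ)` is a scaling element for `κ`: `σ⁻¹ κ σ` is the translation by `1` or `-1`. -/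
def IsScaling (κ : Γ) (σ : PSL(2, ℝ)) : Prop :=
  σ⁻¹ * (κ : PSL(2, ℝ)) * σ = translation 1 ∨ σ⁻¹ * (κ : PSL(2, ℝ)) * σ = translation (-1)

/-- The set `Γ_κ \ Γ` of right cosets `Γ_κ γ`. -/
abbrev Cosets (κ : Γ) : Type := Quotient (QuotientGroup.rightRel (stab κ))

/-- The summand `Im(σ⁻¹ γ z) ^ s` of the Eisenstein series for the coset `c = Γ_κ γ`. When `σ` is
a scaling element of a parabolic generator, it does not depend on the representative `γ`. -/
def eisensteinTerm (κ : Γ) (σ : PSL(2, ℝ)) (s : ℂ) (z : ℍ) (c : Cosets κ) : ℂ :=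
  (((σ⁻¹ * (c.out : PSL(2, ℝ))) • z : ℍ).im : ℂ) ^ s

/-- The Eisenstein series `E(z, s) = ∑_{γ ∈ Γ_κ \ Γ} Im(σ⁻¹ γ z) ^ s`, `Re s > 1`, of the cusp
attached to `κ`. -/
def eisenstein (κ : Γ) (σ : PSL(2, ℝ)) (z : ℍ) (s : ℂ) : ℂ :=
  ∑' c : Cosets κ, eisensteinTerm κ σ s z c

/-- The parabolic Takhtajan-Zograf metric of the cusp attached to `κ`:
`∫_X μ(z) conj(ν(z)) E(z, 2) dA(z)`. -/
def cuspMetric (κ : Γ) (σ : PSL(2, ℝ)) (F : Set ℍ) (μ ν : ℍ → ℂ) : ℂ :=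
  ∫ z in F, μ z * conj (ν z) * eisenstein κ σ z 2

/-- The set of all conjugates in `Γ` of nonzero powers of `κ`. -/
def conjPowers (κ : Γ) : Set Γ :=
  {γ | ∃ (α : Γ) (l : ℤ), l ≠ 0 ∧ γ = α * κ ^ l * α⁻¹}

end Cusp

/-- The integrand `μ(z) conj(ν(w)) γ'(z) / ((z - conj w)² (γz - conj w)²)`. -/
def kernel (μ ν : ℍ → ℂ) (γ : PSL(2, ℝ)) (z w : ℍ) : ℂ :=
  μ z * conj (ν w) /
    (((z : ℂ) - conj (w : ℂ)) ^ 2 * (((γ • z : ℍ) : ℂ) - conj (w : ℂ)) ^ 2) * mobDeriv γ z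

end TZ

end

/-!
Both sides of the identity are unfolded to integrals over the strip `0 < Re z ≤ 1` in the coordinate
of the cusp, and compared there through Fourier expansions.

Write `μ = y² conj φ` and `ν = y² conj ψ`, and let `φ_σ = ∑ aₙ e^{2πinz}`, `ψ_σ = ∑ bₙ e^{2πinz}` be the
pull-backs of `φ`, `ψ` by `σ`. They are invariant under integral translations, and the finiteness of
their norm leaves only the terms with `n ≥ 1` (`IsCuspidal.hasExpansion`).

*Left side.* As `y⁴ conj(φ) ψ` is `Γ`-invariant, unfolding the Eisenstein series gives
`∫ y⁴ conj(φ_σ) ψ_σ d²z` over the strip, that is `∑ conj(aₙ) bₙ 24 / (4πn)⁵`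
(`integrableOn_and_cuspMetric_eq`).

*Right side.* The conjugates of the nonzero powers of `κ` are the elements `δ⁻¹ κˡ δ`, indexed without
repetition by the cosets `Γ_κ δ` and the exponents `l ≠ 0` (`bijective_conjPowers`). The kernel is
covariant (`kernel_smul_smul`), so that each inner integral reduces to the one for the translation by
`± l`. On a horizontal line the latter is computed by periodizing `1 / (τ² (τ + l)²)`, which the Lipschitz
formula evaluates as `-(8π² / l²) ∑ n e^{2πinτ}` (`tsum_kernel`); integrating over the height, one obtains
`-1 / (4πl²) · ∑ bₙ n⁻² e^{2πinz}` (`IsCuspidal.integral_innerKernel`). Unfolding the sum over the cosets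
and summing `∑_{l ≠ 0} l⁻² = π² / 3`, one is left with a multiple of the same series
`∑ conj(aₙ) bₙ n⁻⁵` (`integrable_and_hasSum_conjPowers`, `IsCuspidal.setIntegral_mul_eq`).

*Convergence.* All of it rests on `∑ |aₙ|² n⁻⁵ < ∞`, that is on `∫ y⁴ |φ_σ|² d²z < ∞` over the strip. This
follows from the finiteness of the norm once the part of the Eisenstein series `E(z, 2)` formed by the
terms with `Im (σ⁻¹ γ z) ≤ 1` is known to be bounded on the whole upper half plane (`tsum_im_sq_le`). By
Shimizu's lemma (`one_le_abs_apply_one_zero`) the horoballs `Im (σ⁻¹ γ w) > 1` belonging to different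
cosets are disjoint. The point-pair invariant `(Im z · Im w)² / |z - conj w|⁴` has an integral over `w`
independent of `z`, and the horoball of a coset carries at least `Im (σ⁻¹ γ z)² / 100` of it; hence
the sum of these terms is bounded.
-/

noncomputable section

namespace TZ

/-! ### Möbius transformations -/

theorem coe_mk_smul (A : SL(2, ℝ)) (z : ℍ) :
    (((QuotientGroup.mk A : PSL(2, ℝ)) • z : ℍ) : ℂ) =
      ((A 0 0 : ℂ) * z + A 0 1) / ((A 1 0 : ℂ) * z + A 1 1) := by
  rw [mk_smul, UpperHalfPlane.coe_specialLinearGroup_apply]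
  simp

theorem det_eq (A : SL(2, ℝ)) : A 0 0 * A 1 1 - A 0 1 * A 1 0 = 1 := by
  have := A.det_coe
  rwa [Matrix.det_fin_two] at this

theorem denominator_ne_zero (A : SL(2, ℝ)) {z : ℂ} (hz : 0 < z.im) :
    (A 1 0 : ℂ) * z + A 1 1 ≠ 0 := by
  intro h
  have him := congrArg Complex.im h
  have hre := congrArg Complex.re h
  simp at him hre
  have hd := det_eq A
  rcases him with h0 | h0
  · rw [h0] at hre hd
    simp at hre
    rw [hre] at hd
    simp at hd
  · exact hz.ne' h0

theorem mobDeriv_mk (A : SL(2, ℝ)) (z : ℍ) :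
    mobDeriv (QuotientGroup.mk A) z = 1 / ((A 1 0 : ℂ) * z + A 1 1) ^ 2 := by
  have hz := denominator_ne_zero A z.im_pos
  have hev : (fun w : ℂ => (((QuotientGroup.mk A : PSL(2, ℝ)) • ofComplex w : ℍ) : ℂ)) =ᶠ[nhds (z : ℂ)]
      fun w => ((A 0 0 : ℂ) * w + A 0 1) / ((A 1 0 : ℂ) * w + A 1 1) := by
    filter_upwards [(isOpen_lt continuous_const Complex.continuous_im).mem_nhds z.im_pos] with w hw
    rw [coe_mk_smul, ofComplex_apply_of_im_pos hw]
  rw [mobDeriv, hev.deriv_eq]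
  have h1 : HasDerivAt (fun w : ℂ => (A 0 0 : ℂ) * w + A 0 1) (A 0 0 : ℂ) z := by
    simpa using ((hasDerivAt_id (z : ℂ)).const_mul (A 0 0 : ℂ)).add_const (A 0 1 : ℂ)
  have h2 : HasDerivAt (fun w : ℂ => (A 1 0 : ℂ) * w + A 1 1) (A 1 0 : ℂ) z := by
    simpa using ((hasDerivAt_id (z : ℂ)).const_mul (A 1 0 : ℂ)).add_const (A 1 1 : ℂ)
  refine (h1.div h2 hz).deriv.trans ?_
  congr 1
  have hd : (A 0 0 : ℂ) * A 1 1 - A 0 1 * A 1 0 = 1 := by exact_mod_cast det_eq A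
  linear_combination hd

theorem mobDeriv_ne_zero (γ : PSL(2, ℝ)) (z : ℍ) : mobDeriv γ z ≠ 0 := by
  obtain ⟨A, rfl⟩ := QuotientGroup.mk_surjective γ
  rw [mobDeriv_mk]
  exact one_div_ne_zero (pow_ne_zero _ (denominator_ne_zero A z.im_pos))

theorem mobDeriv_mul (γ δ : PSL(2, ℝ)) (z : ℍ) :
    mobDeriv (γ * δ) z = mobDeriv γ (δ • z) * mobDeriv δ z := by
  obtain ⟨A, rfl⟩ := QuotientGroup.mk_surjective γ
  obtain ⟨B, rfl⟩ := QuotientGroup.mk_surjective δ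
  have h1 := denominator_ne_zero B z.im_pos
  have h2 := denominator_ne_zero A ((QuotientGroup.mk B : PSL(2, ℝ)) • z).im_pos
  rw [← QuotientGroup.mk_mul, mobDeriv_mk, mobDeriv_mk, mobDeriv_mk]
  rw [coe_mk_smul] at h2 ⊢
  rw [one_div_mul_one_div, ← mul_pow]
  congr 2
  simp only [Matrix.SpecialLinearGroup.coe_mul, Matrix.mul_apply, Fin.sum_univ_two]
  push_cast
  field_simp
  ring

theorem sub_conj_ne_zero (z w : ℍ) : (z : ℂ) - conj (w : ℂ) ≠ 0 := by
  intro h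
  have := congrArg Complex.im h
  simp at this
  linarith [z.im_pos, w.im_pos]

/-- The covariance of `z - conj w`. It is stated for the square, since the factor `1 / (cz + d)` whose
square is `γ'(z)` is determined by `γ` only up to sign. -/
theorem smul_sub_conj_smul_sq (γ : PSL(2, ℝ)) (z w : ℍ) :
    (((γ • z : ℍ) : ℂ) - conj ((γ • w : ℍ) : ℂ)) ^ 2 =
      ((z : ℂ) - conj (w : ℂ)) ^ 2 * (mobDeriv γ z * conj (mobDeriv γ w)) := by
  obtain ⟨A, rfl⟩ := QuotientGroup.mk_surjective γ
  have h1 := denominator_ne_zero A z.im_pos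
  have h2 := denominator_ne_zero A w.im_pos
  have h3 : (A 1 0 : ℂ) * conj (w : ℂ) + A 1 1 ≠ 0 := by
    intro h
    apply h2
    have := congrArg conj h
    simpa using this
  rw [mobDeriv_mk, mobDeriv_mk, coe_mk_smul, coe_mk_smul]
  simp only [map_div₀, map_add, map_mul, Complex.conj_ofReal, map_pow, map_one]
  rw [one_div_mul_one_div, ← mul_pow, ← div_eq_mul_one_div, ← div_pow]
  congr 1
  have hd : (A 0 0 : ℂ) * A 1 1 - A 0 1 * A 1 0 = 1 := by exact_mod_cast det_eq A
  rw [div_sub_div _ _ h1 h3]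
  congr 1
  linear_combination ((z : ℂ) - conj (w : ℂ)) * hd

theorem im_smul (γ : PSL(2, ℝ)) (z : ℍ) : (γ • z).im = ‖mobDeriv γ z‖ * z.im := by
  have h := congrArg norm (smul_sub_conj_smul_sq γ z z)
  have key : ∀ w : ℍ, ‖(w : ℂ) - conj (w : ℂ)‖ = 2 * w.im := fun w => by
    rw [Complex.sub_conj]
    simp [abs_of_pos w.im_pos]
  simp only [norm_mul, norm_pow, key, Complex.norm_conj] at h
  have h0 := (γ • z).im_pos
  have h1 := z.im_pos
  have h2 := norm_nonneg (mobDeriv γ z)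
  refine (pow_left_inj₀ h0.le (by positivity) two_ne_zero).mp ?_
  linear_combination h / 4

theorem coe_translation_smul (t : ℝ) (z : ℍ) : ((translation t • z : ℍ) : ℂ) = z + t := by
  rw [translation, coe_mk_smul]
  simp [translationMatrix]

theorem translation_smul (t : ℝ) (z : ℍ) : translation t • z = t +ᵥ z := by
  ext
  rw [coe_translation_smul, coe_vadd, add_comm]

theorem mobDeriv_translation (t : ℝ) (z : ℍ) : mobDeriv (translation t) z = 1 := by
  rw [translation, mobDeriv_mk]
  simp [translationMatrix]

theorem translation_add (s t : ℝ) : translation (s + t) = translation s * translation t := by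
  rw [translation, translation, translation, ← QuotientGroup.mk_mul]
  congr 1
  ext i j
  rw [Matrix.SpecialLinearGroup.coe_mul]
  fin_cases i <;> fin_cases j <;> simp [translationMatrix, add_comm]

theorem translation_zero : translation 0 = 1 := by
  rw [translation, ← QuotientGroup.mk_one]
  congr 1
  ext i j
  fin_cases i <;> fin_cases j <;> simp [translationMatrix]

theorem translation_zpow (t : ℝ) (n : ℤ) : translation t ^ n = translation (n * t) := by
  let f : Multiplicative ℝ →* PSL(2, ℝ) :=
    { toFun := fun s => translation s.toAdd
      map_one' := translation_zero
      map_mul' := fun s t => translation_add _ _ }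
  have := map_zpow f (Multiplicative.ofAdd t) n
  simpa [f, ← ofAdd_zsmul] using this.symm

/-! ### Invariance of the hyperbolic area and distance -/

instance : IsIsometricSMul PSL(2, ℝ) ℍ where
  isometry_smul γ := by
    obtain ⟨A, rfl⟩ := QuotientGroup.mk_surjective γ
    exact isometry_smul ℍ A

instance : SMulInvariantMeasure SL(2, ℝ) ℍ volume where
  measure_preimage_smul A _ hs := measure_preimage_smul_of_nullMeasurableSet (μ := (volume : Measure ℍ))
    hs.nullMeasurableSet (A : GL (Fin 2) ℝ)

instance : SMulInvariantMeasure PSL(2, ℝ) ℍ volume where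
  measure_preimage_smul γ s hs := by
    obtain ⟨A, rfl⟩ := QuotientGroup.mk_surjective γ
    exact measure_preimage_smul_of_nullMeasurableSet (μ := (volume : Measure ℍ))
      hs.nullMeasurableSet A

instance : SecondCountableTopology SL(2, ℝ) :=
  have : SecondCountableTopology (Matrix (Fin 2) (Fin 2) ℝ) :=
    inferInstanceAs (SecondCountableTopology (Fin 2 → Fin 2 → ℝ))
  TopologicalSpace.Subtype.secondCountableTopology _

theorem countable_of_discrete (Γ : Subgroup PSL(2, ℝ)) [DiscreteTopology Γ] : Countable Γ := by
  have : SecondCountableTopology PSL(2, ℝ) :=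
    QuotientGroup.instSecondCountableTopology _
  exact TopologicalSpace.separableSpace_iff_countable.mp inferInstance

/-- The point-pair invariant `(Im z · Im w)² / |z - conj w|⁴`. -/
def pairKernel (z w : ℍ) : ℝ := (z.im * w.im) ^ 2 / ‖(z : ℂ) - conj (w : ℂ)‖ ^ 4

theorem pairKernel_smul (γ : PSL(2, ℝ)) (z w : ℍ) :
    pairKernel (γ • z) (γ • w) = pairKernel z w := by
  have h := congrArg (fun x => ‖x‖ ^ 2) (smul_sub_conj_smul_sq γ z w)
  simp only [norm_mul, norm_pow, Complex.norm_conj, ← pow_mul, mul_pow] at h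
  norm_num at h
  rw [pairKernel, h, pairKernel, im_smul, im_smul]
  have h0 : ‖mobDeriv γ z‖ ≠ 0 := norm_ne_zero_iff.mpr (mobDeriv_ne_zero γ z)
  have h1 : ‖mobDeriv γ w‖ ≠ 0 := norm_ne_zero_iff.mpr (mobDeriv_ne_zero γ w)
  have h2 : ‖(z : ℂ) - conj (w : ℂ)‖ ≠ 0 := norm_ne_zero_iff.mpr (sub_conj_ne_zero z w)
  field_simp

/-! ### Discreteness and the stabilizer of a cusp -/

theorem translation_injective : Function.Injective translation := by
  intro s t h
  have := coe_translation_smul s I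
  rw [h, coe_translation_smul] at this
  simpa using this.symm

theorem apply_one_zero_eq_zero {A : SL(2, ℝ)} {t : ℝ}
    (h : (QuotientGroup.mk A : PSL(2, ℝ)) = translation t) : A 1 0 = 0 := by
  have h1 := mobDeriv_mk A I
  rw [h, mobDeriv_translation, eq_comm, one_div, inv_eq_one] at h1
  have hre := congrArg Complex.re h1
  have him := congrArg Complex.im h1
  simp [pow_two] at hre him
  nlinarith [sq_nonneg (A 1 0), sq_nonneg (A 1 1), sq_nonneg (A 1 0 * A 1 1)]

/-- Conjugating the translation by `s` with `(a, b; c, d)` gives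
`(1 - acs, a²s; -c²s, 1 + acs)`. -/
theorem conj_translationMatrix (A : SL(2, ℝ)) (s : ℝ) :
    ((A * translationMatrix s * A⁻¹ : SL(2, ℝ)) : Matrix (Fin 2) (Fin 2) ℝ) =
      !![1 - A 0 0 * A 1 0 * s, A 0 0 ^ 2 * s; -(A 1 0 ^ 2 * s), 1 + A 0 0 * A 1 0 * s] := by
  have hd := det_eq A
  rw [Matrix.SpecialLinearGroup.coe_mul, Matrix.SpecialLinearGroup.coe_mul,
    Matrix.SpecialLinearGroup.coe_inv, Matrix.adjugate_fin_two]
  ext i j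
  fin_cases i <;> fin_cases j <;>
    simp [translationMatrix, Matrix.mul_apply, Fin.sum_univ_two] <;> linarith

theorem mk_eq_translation {A : SL(2, ℝ)} (hc : A 1 0 = 0) (ha : A 0 0 ^ 2 = 1) :
    (QuotientGroup.mk A : PSL(2, ℝ)) = translation (A 0 0 * A 0 1) := by
  have hd := det_eq A
  rw [hc] at hd
  have h11 : A 1 1 = A 0 0 := by
    have : A 0 0 * (A 1 1 - A 0 0) = 0 := by linear_combination hd - ha
    rcases mul_eq_zero.mp this with h | h
    · rw [h] at ha; norm_num at ha
    · linarith
  rw [translation, QuotientGroup.eq, Matrix.SpecialLinearGroup.mem_center_iff]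
  refine ⟨A 0 0, by simpa using ha, ?_⟩
  rw [Matrix.SpecialLinearGroup.coe_mul, Matrix.SpecialLinearGroup.coe_inv,
    Matrix.adjugate_fin_two]
  ext i j
  fin_cases i <;> fin_cases j <;>
    simp [translationMatrix, Matrix.mul_apply, Fin.sum_univ_two, h11, hc]
  linear_combination (-A 0 1) * ha

section Discrete

variable {Γ : Subgroup PSL(2, ℝ)}

theorem IsScaling.exists_sign {κ : Γ} {σ : PSL(2, ℝ)} (hσ : IsScaling κ σ) :
    ∃ ε : ℤ, (ε = 1 ∨ ε = -1) ∧
      ∀ l : ℤ, ((κ ^ l : Γ) : PSL(2, ℝ)) = σ * translation ((ε * l : ℤ) : ℝ) * σ⁻¹ := by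
  have key : ∀ ε : ℤ, σ⁻¹ * (κ : PSL(2, ℝ)) * σ = translation (ε : ℝ) → ∀ l : ℤ,
      ((κ ^ l : Γ) : PSL(2, ℝ)) = σ * translation ((ε * l : ℤ) : ℝ) * σ⁻¹ := by
    intro ε h l
    have h2 : (κ : PSL(2, ℝ)) = σ * translation (ε : ℝ) * σ⁻¹ := by rw [← h]; group
    rw [Subgroup.coe_zpow, h2, conj_zpow, translation_zpow]
    congr 3
    push_cast; ring
  rcases hσ with h | h
  · exact ⟨1, Or.inl rfl, key 1 (by simpa using h)⟩
  · exact ⟨-1, Or.inr rfl, key (-1) (by simpa using h)⟩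

theorem IsScaling.translation_mem {κ : Γ} {σ : PSL(2, ℝ)} (hσ : IsScaling κ σ) :
    σ * translation 1 * σ⁻¹ ∈ Γ := by
  obtain ⟨ε, hε, h⟩ := hσ.exists_sign
  have := h ε
  have h1 : ε * ε = 1 := by rcases hε with rfl | rfl <;> norm_num
  rw [h1, Int.cast_one] at this
  rw [← this]
  exact (κ ^ ε).2

/-- The map `z ↦ σ⁻¹ γ z` for the chosen representative `γ` of a coset. -/
def cosetMap (κ : Γ) (σ : PSL(2, ℝ)) (c : Cosets κ) : PSL(2, ℝ) := σ⁻¹ * ((c.out : Γ) : PSL(2, ℝ))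

theorem cosets_eq {κ : Γ} {c c' : Cosets κ} (h : c'.out * c.out⁻¹ ∈ stab κ) : c = c' := by
  rw [← Quotient.out_eq c, ← Quotient.out_eq c']
  exact Quotient.sound (QuotientGroup.rightRel_apply.mpr h)

theorem IsScaling.zpow_injective {κ : Γ} {σ : PSL(2, ℝ)} (hσ : IsScaling κ σ) :
    Function.Injective (fun l : ℤ => κ ^ l) := by
  intro l m h
  obtain ⟨ε, hε, hl⟩ := hσ.exists_sign
  have h1 : ((κ ^ l : Γ) : PSL(2, ℝ)) = ((κ ^ m : Γ) : PSL(2, ℝ)) := congrArg _ h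
  rw [hl, hl] at h1
  have h2 := translation_injective (mul_left_cancel (mul_right_cancel h1))
  have h3 : ε * l = ε * m := by exact_mod_cast h2
  rcases hε with rfl | rfl <;> omega

theorem exists_out_eq (κ : Γ) (γ : Γ) :
    ∃ k ∈ stab κ, ((Quotient.mk (QuotientGroup.rightRel (stab κ)) γ : Cosets κ).out : Γ) = k * γ := by
  have h := Quotient.exact (Quotient.out_eq (Quotient.mk (QuotientGroup.rightRel (stab κ)) γ : Cosets κ))
  have h2 := QuotientGroup.rightRel_apply.mp ((QuotientGroup.rightRel (stab κ)).symm h)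
  exact ⟨_, h2, by group⟩

/-- Every element of `Γ` is uniquely `κᵏ` times a chosen coset representative. -/
theorem bijective_zpow_mul_out {κ : Γ} (hκ : IsParabolicGenerator κ) {σ : PSL(2, ℝ)}
    (hσ : IsScaling κ σ) :
    Function.Bijective (fun p : Cosets κ × ℤ => κ ^ p.2 * (p.1.out : Γ)) := by
  constructor
  · rintro ⟨c, k⟩ ⟨c', k'⟩ h
    simp only at h
    have hc : c = c' := by
      apply cosets_eq
      have : c'.out * c.out⁻¹ = κ ^ (-k' + k) := by
        rw [zpow_add, zpow_neg, mul_inv_eq_iff_eq_mul, mul_assoc, h, inv_mul_cancel_left]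
      rw [this, hκ.stab_eq]
      exact Subgroup.zpow_mem_zpowers _ _
    subst hc
    rw [IsScaling.zpow_injective hσ (mul_right_cancel h)]
  · intro γ
    obtain ⟨k, hk, h⟩ := exists_out_eq κ γ
    rw [hκ.stab_eq] at hk
    obtain ⟨l, rfl⟩ := Subgroup.mem_zpowers_iff.mp hk
    refine ⟨(Quotient.mk _ γ, -l), ?_⟩
    simp only [h]
    group

variable [DiscreteTopology Γ]

/-- A convergent sequence in a conjugate of a discrete group is eventually constant. -/
theorem eventually_mk_eq (σ : PSL(2, ℝ)) {u : ℕ → SL(2, ℝ)} {A : SL(2, ℝ)}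
    (hu : ∀ n, σ * QuotientGroup.mk (u n) * σ⁻¹ ∈ Γ) (hA : σ * QuotientGroup.mk A * σ⁻¹ ∈ Γ)
    (h : ∀ i j, Filter.Tendsto (fun n => u n i j) Filter.atTop (nhds (A i j))) :
    ∀ᶠ n in Filter.atTop, (QuotientGroup.mk (u n) : PSL(2, ℝ)) = QuotientGroup.mk A := by
  have h1 : Filter.Tendsto u Filter.atTop (nhds A) := by
    refine tendsto_subtype_rng.mpr ?_
    exact tendsto_pi_nhds.mpr fun i => tendsto_pi_nhds.mpr fun j => h i j
  have h2 : Filter.Tendsto (fun n => σ * QuotientGroup.mk (u n) * σ⁻¹) Filter.atTop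
      (nhds (σ * QuotientGroup.mk A * σ⁻¹)) :=
    (((continuous_quotient_mk'.tendsto A).comp h1).const_mul σ).mul_const σ⁻¹
  have h3 : Filter.Tendsto (fun n => (⟨_, hu n⟩ : Γ)) Filter.atTop (nhds ⟨_, hA⟩) :=
    tendsto_subtype_rng.mpr h2
  rw [nhds_discrete, Filter.tendsto_pure] at h3
  filter_upwards [h3] with n hn
  simpa using hn

/-- **Shimizu's lemma**: in a discrete group containing `z ↦ z + 1`, a lower left entry which is
not zero is at least one in absolute value. Otherwise the iteration `Aₙ₊₁ = Aₙ T Aₙ⁻¹` produces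
infinitely many elements of the group converging to `T`. -/
theorem one_le_abs_apply_one_zero {σ : PSL(2, ℝ)} (hT : σ * translation 1 * σ⁻¹ ∈ Γ) {A : SL(2, ℝ)}
    (hA : σ * QuotientGroup.mk A * σ⁻¹ ∈ Γ) (hc : A 1 0 ≠ 0) : 1 ≤ |A 1 0| := by
  by_contra! hlt
  obtain ⟨u, hu0, hu⟩ : ∃ u : ℕ → SL(2, ℝ), u 0 = A ∧
      ∀ n, u (n + 1) = u n * translationMatrix 1 * (u n)⁻¹ :=
    ⟨fun n => Nat.rec A (fun _ B => B * translationMatrix 1 * B⁻¹) n, rfl, fun n => rfl⟩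
  have e := fun n => congrArg (fun M : Matrix (Fin 2) (Fin 2) ℝ => M 0 0) (conj_translationMatrix (u n) 1)
  have e01 := fun n => congrArg (fun M : Matrix (Fin 2) (Fin 2) ℝ => M 0 1) (conj_translationMatrix (u n) 1)
  have e10 := fun n => congrArg (fun M : Matrix (Fin 2) (Fin 2) ℝ => M 1 0) (conj_translationMatrix (u n) 1)
  have e11 := fun n => congrArg (fun M : Matrix (Fin 2) (Fin 2) ℝ => M 1 1) (conj_translationMatrix (u n) 1)
  simp only [← hu] at e e01 e10 e11
  simp at e e01 e10 e11
  have hmem : ∀ n, σ * QuotientGroup.mk (u n) * σ⁻¹ ∈ Γ := by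
    intro n
    induction n with
    | zero => rw [hu0]; exact hA
    | succ n ih =>
      rw [hu, QuotientGroup.mk_mul, QuotientGroup.mk_mul, QuotientGroup.mk_inv]
      have := mul_mem (mul_mem ih hT) (inv_mem ih)
      convert this using 1
      simp only [translation]
      group
  have hc0 : ∀ n, u n 1 0 ≠ 0 := by
    intro n
    induction n with
    | zero => rw [hu0]; exact hc
    | succ n ih => rw [e10]; simpa using ih
  have hcb : ∀ n, |u n 1 0| ≤ |A 1 0| ^ (n + 1) := by
    intro n
    induction n with
    | zero => simp [hu0]
    | succ n ih =>
      rw [e10, abs_neg, abs_pow, pow_two]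
      have h1 : |A 1 0| ^ (n + 1) ≤ |A 1 0| := pow_le_of_le_one (abs_nonneg _) hlt.le (by omega)
      calc |u n 1 0| * |u n 1 0| ≤ |A 1 0| ^ (n + 1) * |A 1 0| :=
          mul_le_mul ih (ih.trans h1) (abs_nonneg _) (by positivity)
        _ = _ := by ring
  -- `M` is chosen with `1 + M |c| ≤ M`, so that the bound `|aₙ| ≤ M` is inherited
  set M : ℝ := max |A 0 0| (1 / (1 - |A 1 0|)) with hM
  have hM1 : 1 + M * |A 1 0| ≤ M := by
    have : 1 / (1 - |A 1 0|) ≤ M := le_max_right _ _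
    rw [div_le_iff₀ (by linarith)] at this
    linarith
  have hM0 : 0 ≤ M := (abs_nonneg _).trans (le_max_left _ _)
  have hab : ∀ n, |u n 0 0| ≤ M := by
    intro n
    induction n with
    | zero => rw [hu0]; exact le_max_left _ _
    | succ n ih =>
      rw [e]
      refine (abs_sub _ _).trans (le_trans ?_ hM1)
      rw [abs_one, abs_mul]
      have h1 : |u n 1 0| ≤ |A 1 0| :=
        (hcb n).trans (pow_le_of_le_one (abs_nonneg _) hlt.le (by omega))
      gcongr
  have hpow : Filter.Tendsto (fun n : ℕ => |A 1 0| ^ (n + 1)) Filter.atTop (nhds 0) :=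
    (tendsto_pow_atTop_nhds_zero_of_lt_one (abs_nonneg _) hlt).comp (Filter.tendsto_add_atTop_nat 1)
  have hct : Filter.Tendsto (fun n => u n 1 0) Filter.atTop (nhds 0) :=
    squeeze_zero_norm (fun n => hcb n) hpow
  have hact : Filter.Tendsto (fun n => u n 0 0 * u n 1 0) Filter.atTop (nhds 0) := by
    refine squeeze_zero_norm (a := fun n => M * |A 1 0| ^ (n + 1)) (fun n => ?_)
      (by simpa using hpow.const_mul M)
    rw [Real.norm_eq_abs, abs_mul]
    exact mul_le_mul (hab n) (hcb n) (abs_nonneg _) hM0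
  have hat : Filter.Tendsto (fun n => u (n + 1) 0 0) Filter.atTop (nhds 1) := by
    simp only [e]; simpa using hact.const_sub 1
  -- the upper right entry of `u (n + 1)` is `aₙ²`, which tends to `1` one step after the other entries
  have key := eventually_mk_eq σ (u := fun n => u (n + 2)) (A := translationMatrix 1)
    (fun n => hmem _) hT (by
      intro i j
      fin_cases i <;> fin_cases j
      · simp only [translationMatrix, Fin.zero_eta, Matrix.of_apply, Matrix.cons_val_zero]
        exact hat.comp (Filter.tendsto_add_atTop_nat 1)
      · simpa [translationMatrix, e01] using hat.pow 2
      · simp only [translationMatrix, Fin.zero_eta, Fin.mk_one, Matrix.of_apply, Matrix.cons_val_zero,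
          Matrix.cons_val_one]
        exact hct.comp (Filter.tendsto_add_atTop_nat 2)
      · simpa [translationMatrix, e11] using (hact.comp (Filter.tendsto_add_atTop_nat 1)).const_add 1)
  obtain ⟨n, hn⟩ := key.exists
  exact hc0 _ (apply_one_zero_eq_zero hn)

/-- A discrete group does not contain translations of arbitrarily small length. -/
theorem not_mem_of_lt_one {σ : PSL(2, ℝ)} {r : ℝ} (hr0 : 0 < r) (hr1 : r < 1)
    (h : ∀ n : ℕ, σ * translation (r ^ n) * σ⁻¹ ∈ Γ) : False := by
  have key := eventually_mk_eq σ (u := fun n => translationMatrix (r ^ n)) (A := translationMatrix 0)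
    h (by rw [← translation, translation_zero]; simp [one_mem]) (by
      intro i j
      fin_cases i <;> fin_cases j
      · simp [translationMatrix]
      · simpa [translationMatrix] using tendsto_pow_atTop_nhds_zero_of_lt_one hr0.le hr1
      · simp [translationMatrix]
      · simp [translationMatrix])
  obtain ⟨n, hn⟩ := key.exists
  exact (pow_pos hr0 n).ne' (translation_injective hn)

/-- An element fixing the cusp `∞` of a discrete group containing `z ↦ z + 1` is a translation:
otherwise conjugation by it would produce arbitrarily short translations. -/
theorem exists_eq_translation {σ : PSL(2, ℝ)} (hT : σ * translation 1 * σ⁻¹ ∈ Γ) {A : SL(2, ℝ)}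
    (hA : σ * QuotientGroup.mk A * σ⁻¹ ∈ Γ) (hc : A 1 0 = 0) :
    ∃ t, (QuotientGroup.mk A : PSL(2, ℝ)) = translation t := by
  refine ⟨_, mk_eq_translation hc ?_⟩
  have hd := det_eq A
  rw [hc, mul_zero, sub_zero] at hd
  have ha0 : A 0 0 ≠ 0 := left_ne_zero_of_mul_eq_one hd
  have hconj : ∀ s, (QuotientGroup.mk A : PSL(2, ℝ)) * translation s * (QuotientGroup.mk A)⁻¹ =
      translation (A 0 0 ^ 2 * s) := by
    intro s
    rw [translation, translation, ← QuotientGroup.mk_mul, ← QuotientGroup.mk_inv,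
      ← QuotientGroup.mk_mul]
    congr 1
    apply Subtype.ext
    rw [conj_translationMatrix, hc]
    simp [translationMatrix]
  have hup : ∀ s, σ * translation s * σ⁻¹ ∈ Γ → σ * translation (A 0 0 ^ 2 * s) * σ⁻¹ ∈ Γ := by
    intro s hs
    have := mul_mem (mul_mem hA hs) (inv_mem hA)
    rw [← hconj]
    convert this using 1
    group
  have hdown : ∀ s, σ * translation s * σ⁻¹ ∈ Γ →
      σ * translation ((A 0 0 ^ 2)⁻¹ * s) * σ⁻¹ ∈ Γ := by
    intro s hs
    have := mul_mem (mul_mem (inv_mem hA) hs) hA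
    have h2 := hconj ((A 0 0 ^ 2)⁻¹ * s)
    rw [mul_inv_cancel_left₀ (pow_ne_zero 2 ha0)] at h2
    rw [← h2] at this
    convert this using 1
    group
  have hpos : 0 < A 0 0 ^ 2 := by positivity
  rcases lt_trichotomy (A 0 0 ^ 2) 1 with h | h | h
  · refine (not_mem_of_lt_one (Γ := Γ) (σ := σ) hpos h fun n => ?_).elim
    induction n with
    | zero => simpa using hT
    | succ n ih => rw [pow_succ']; exact hup _ ih
  · exact h
  · refine (not_mem_of_lt_one (Γ := Γ) (σ := σ) (inv_pos.mpr hpos) (inv_lt_one_of_one_lt₀ h)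
      fun n => ?_).elim
    induction n with
    | zero => simpa using hT
    | succ n ih => rw [pow_succ']; exact hdown _ ih

/-- An element of `Γ` which after scaling fixes `∞` lies in the stabilizer of the cusp. -/
theorem IsScaling.mem_stab {κ : Γ} {σ : PSL(2, ℝ)} (hσ : IsScaling κ σ) {δ : Γ} {A : SL(2, ℝ)}
    (hA : QuotientGroup.mk A = σ⁻¹ * (δ : PSL(2, ℝ)) * σ) (hc : A 1 0 = 0) : δ ∈ stab κ := by
  have hδ : (δ : PSL(2, ℝ)) = σ * QuotientGroup.mk A * σ⁻¹ := by rw [hA]; group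
  obtain ⟨t, ht⟩ := exists_eq_translation hσ.translation_mem (hδ ▸ δ.2) hc
  obtain ⟨ε, -, hε⟩ := hσ.exists_sign
  have hκ := hε 1
  rw [zpow_one, mul_one] at hκ
  rw [ht] at hδ
  rw [stab, Subgroup.mem_centralizer_singleton_iff]
  apply Subtype.ext
  rw [Subgroup.coe_mul, Subgroup.coe_mul, hδ, hκ]
  have : translation t * translation (ε : ℝ) = translation (ε : ℝ) * translation t := by
    rw [← translation_add, ← translation_add, add_comm]
  calc σ * translation t * σ⁻¹ * (σ * translation (ε : ℝ) * σ⁻¹)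
      = σ * (translation t * translation (ε : ℝ)) * σ⁻¹ := by group
    _ = _ := by rw [this]; group

/-- The horoball `{Im > 1}` at the cusp is precisely invariant under the stabilizer. -/
theorem IsScaling.mem_stab_of_one_lt_im {κ : Γ} {σ : PSL(2, ℝ)} (hσ : IsScaling κ σ) {δ : Γ} {w : ℍ}
    (hw : 1 < w.im) (hw' : 1 < ((σ⁻¹ * (δ : PSL(2, ℝ)) * σ) • w).im) : δ ∈ stab κ := by
  obtain ⟨A, hA⟩ := QuotientGroup.mk_surjective (σ⁻¹ * (δ : PSL(2, ℝ)) * σ)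
  by_cases hc : A 1 0 = 0
  · exact hσ.mem_stab hA hc
  exfalso
  have hδ : (δ : PSL(2, ℝ)) = σ * QuotientGroup.mk A * σ⁻¹ := by rw [hA]; group
  have h1 := one_le_abs_apply_one_zero hσ.translation_mem (hδ ▸ δ.2) hc
  rw [← hA, im_smul, mobDeriv_mk, norm_div, norm_one, norm_pow, one_div_mul_eq_div] at hw'
  have h2 : w.im ≤ ‖(A 1 0 : ℂ) * w + A 1 1‖ := by
    refine le_trans ?_ (Complex.abs_im_le_norm _)
    simp only [Complex.add_im, Complex.mul_im, Complex.ofReal_re, Complex.ofReal_im, coe_im, zero_mul,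
      add_zero, abs_mul, abs_of_pos w.im_pos]
    exact le_mul_of_one_le_left w.im_pos.le h1
  have h3 : 0 < ‖(A 1 0 : ℂ) * w + A 1 1‖ := w.im_pos.trans_le h2
  rw [lt_div_iff₀ (by positivity)] at hw'
  nlinarith

theorem IsScaling.eq_of_one_lt_im {κ : Γ} {σ : PSL(2, ℝ)} (hσ : IsScaling κ σ) {c c' : Cosets κ}
    {z : ℍ} (h : 1 < (cosetMap κ σ c • z).im) (h' : 1 < (cosetMap κ σ c' • z).im) : c = c' := by
  refine cosets_eq (hσ.mem_stab_of_one_lt_im h ?_)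
  rw [smul_smul]
  convert h' using 3
  simp only [cosetMap, Subgroup.coe_mul, Subgroup.coe_inv]
  group

/-- The conjugates of the nonzero powers of `κ` are parametrized without repetition by a coset
`Γ_κ δ` and an exponent `l ≠ 0`, through `δ⁻¹ κˡ δ`. -/
theorem bijective_conjPowers {κ : Γ} {σ : PSL(2, ℝ)}
    (hσ : IsScaling κ σ) :
    Function.Bijective (fun p : Cosets κ × {l : ℤ // l ≠ 0} =>
      (⟨(p.1.out : Γ)⁻¹ * κ ^ (p.2 : ℤ) * (p.1.out : Γ),
        (p.1.out : Γ)⁻¹, p.2, p.2.2, by simp⟩ : conjPowers κ)) := by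
  obtain ⟨ε, hε, hl⟩ := hσ.exists_sign
  constructor
  · rintro ⟨c, l, hl0⟩ ⟨c', m, hm0⟩ h
    have h := congrArg Subtype.val h
    simp only at h
    have h1 : (c'.out * c.out⁻¹) * κ ^ l * (c'.out * c.out⁻¹)⁻¹ = κ ^ m := by
      calc _ = c'.out * (c.out⁻¹ * κ ^ l * c.out) * c'.out⁻¹ := by group
        _ = _ := by rw [h]; group
    have hc : c = c' := by
      apply cosets_eq
      set δ := c'.out * c.out⁻¹
      obtain ⟨A, hA⟩ := QuotientGroup.mk_surjective (σ⁻¹ * (δ : PSL(2, ℝ)) * σ)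
      refine hσ.mem_stab hA ?_
      have h2 := congrArg (Subtype.val : Γ → PSL(2, ℝ)) h1
      simp only [Subgroup.coe_mul, Subgroup.coe_inv] at h2
      rw [hl, hl] at h2
      have h3 : (QuotientGroup.mk (A * translationMatrix ((ε * l : ℤ) : ℝ) * A⁻¹) : PSL(2, ℝ)) =
          translation ((ε * m : ℤ) : ℝ) := by
        rw [QuotientGroup.mk_mul, QuotientGroup.mk_mul, QuotientGroup.mk_inv, hA, ← translation]
        calc _ = σ⁻¹ * ((δ : PSL(2, ℝ)) * (σ * translation ((ε * l : ℤ) : ℝ) * σ⁻¹) *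
              (δ : PSL(2, ℝ))⁻¹) * σ := by group
          _ = _ := by rw [h2]; group
      have h4 := apply_one_zero_eq_zero h3
      rw [conj_translationMatrix] at h4
      have h5 : ε * l ≠ 0 := by rcases hε with rfl | rfl <;> omega
      have h6 : ((ε * l : ℤ) : ℝ) ≠ 0 := by exact_mod_cast h5
      simpa only [Matrix.of_apply, Matrix.cons_val_one, Matrix.cons_val_zero, neg_eq_zero, mul_eq_zero,
      h6, or_false, pow_eq_zero_iff two_ne_zero] using h4
    subst hc
    have h7 := IsScaling.zpow_injective hσ (mul_left_cancel (mul_right_cancel h))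
    subst h7
    rfl
  · rintro ⟨γ, α, l, hl0, rfl⟩
    obtain ⟨k, hk, h⟩ := exists_out_eq κ α⁻¹
    refine ⟨(Quotient.mk _ α⁻¹, ⟨l, hl0⟩), Subtype.ext ?_⟩
    simp only [h]
    have hk2 : k * κ ^ l = κ ^ l * k := by
      rw [stab, Subgroup.mem_centralizer_singleton_iff] at hk
      exact ((show Commute k κ from hk).zpow_right l).eq
    calc (k * α⁻¹)⁻¹ * κ ^ l * (k * α⁻¹) = α * k⁻¹ * (κ ^ l * k) * α⁻¹ := by group
      _ = _ := by rw [← hk2]; group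

end Discrete

/-! ### Cartesian coordinates on the upper half plane -/

/-- The point `x + iy` of the upper half plane (a junk value for `y ≤ 0`). -/
def point (x y : ℝ) : ℍ := ofComplex (x + y * Complex.I)

theorem coe_point (x : ℝ) {y : ℝ} (hy : 0 < y) : (point x y : ℂ) = x + y * Complex.I := by
  rw [point, ofComplex_apply_of_im_pos (by simpa using hy)]

theorem im_point (x : ℝ) {y : ℝ} (hy : 0 < y) : (point x y).im = y := by
  rw [← coe_im, coe_point x hy]; simp

theorem re_point (x : ℝ) {y : ℝ} (hy : 0 < y) : (point x y).re = x := by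
  rw [← coe_re, coe_point x hy]; simp

theorem point_re_im (z : ℍ) : point z.re z.im = z := by
  ext; rw [coe_point _ z.im_pos]; exact Complex.re_add_im (z : ℂ)

theorem measurable_ofComplex : Measurable (ofComplex : ℂ → ℍ) := by
  rw [← measurableEmbedding_coe.measurable_comp_iff]
  have : (UpperHalfPlane.coe ∘ ofComplex : ℂ → ℂ) = fun w =>
      if 0 < w.im then w else ((Classical.choice inferInstance : ℍ) : ℂ) := by
    funext w
    by_cases h : 0 < w.im
    · simp [h, ofComplex_apply_of_im_pos h]
    · simp only [Function.comp, h, if_false, ofComplex_apply_of_im_nonpos (not_lt.mp h)]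
  rw [this]
  exact Measurable.ite (measurableSet_lt measurable_const Complex.measurable_im) measurable_id
    measurable_const

theorem measurable_point : Measurable fun p : ℝ × ℝ => point p.2 p.1 :=
  measurable_ofComplex.comp (by fun_prop)

/-- The part of the upper half plane lying over a set of real parts. -/
def reIn (S : Set ℝ) : Set ℍ := {z | z.re ∈ S}

/-- The vertical strip `0 < Re z ≤ 1`, a fundamental domain for the translations by integers. -/
def strip : Set ℍ := reIn (Set.Ioc 0 1)

theorem measurableSet_reIn {S : Set ℝ} (hS : MeasurableSet S) : MeasurableSet (reIn S) :=
  UpperHalfPlane.continuous_re.measurable hS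

theorem measurableSet_strip : MeasurableSet strip := measurableSet_reIn measurableSet_Ioc

theorem measurePreserving_point {S : Set ℝ} (hS : MeasurableSet S) :
    MeasurePreserving (fun p : ℝ × ℝ => point p.2 p.1)
      ((volume.restrict (Set.Ioi 0)).prod (volume.restrict S)) (euclideanArea.restrict (reIn S)) := by
  refine ⟨measurable_point, Measure.ext fun s hs => ?_⟩
  have he : MeasurePreserving (fun p : ℝ × ℝ => Complex.measurableEquivRealProd.symm p.swap)
      volume volume :=
    (Complex.volume_preserving_equiv_real_prod.symm).comp
      (Measure.measurePreserving_swap (μ := (volume : Measure ℝ)) (ν := (volume : Measure ℝ)))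
  have hT : MeasurableSet (UpperHalfPlane.coe '' (s ∩ reIn S)) :=
    measurableEmbedding_coe.measurableSet_image.mpr (hs.inter (measurableSet_reIn hS))
  rw [Measure.map_apply measurable_point hs, Measure.restrict_apply hs, euclideanArea,
    measurableEmbedding_coe.comap_apply, ← he.measure_preimage hT.nullMeasurableSet,
    Measure.prod_restrict, Measure.restrict_apply (measurable_point hs), Measure.volume_eq_prod]
  congr 1
  ext ⟨y, x⟩
  constructor
  · rintro ⟨h1, h2, h3⟩
    exact ⟨point x y, ⟨h1, by simpa [reIn, re_point x h2] using h3⟩, by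
      apply Complex.ext <;> simp [coe_point x h2]⟩
  · rintro ⟨z, ⟨h1, h2⟩, h3⟩
    have hx : z.re = x := by simpa using congrArg Complex.re h3
    have hy : z.im = y := by simpa using congrArg Complex.im h3
    subst hx hy
    exact ⟨by simpa [point_re_im] using h1, z.im_pos, h2⟩

theorem setLIntegral_reIn {S : Set ℝ} (hS : MeasurableSet S) {f : ℍ → ENNReal} (hf : Measurable f) :
    ∫⁻ z in reIn S, f z ∂euclideanArea = ∫⁻ y in Set.Ioi 0, ∫⁻ x in S, f (point x y) := by
  rw [← (measurePreserving_point hS).lintegral_comp hf, lintegral_prod]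
  exact (hf.comp measurable_point).aemeasurable

theorem lintegral_euclideanArea {f : ℍ → ENNReal} (hf : Measurable f) :
    ∫⁻ z, f z ∂euclideanArea = ∫⁻ y in Set.Ioi 0, ∫⁻ x, f (point x y) := by
  have := setLIntegral_reIn MeasurableSet.univ hf
  simpa [reIn] using this

theorem setIntegral_reIn {S : Set ℝ} (hS : MeasurableSet S) {f : ℍ → ℂ}
    (hf : IntegrableOn f (reIn S) euclideanArea) :
    ∫ z in reIn S, f z ∂euclideanArea = ∫ y in Set.Ioi 0, ∫ x in S, f (point x y) := by
  have h := measurePreserving_point hS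
  have hf' : Integrable f (Measure.map (fun p : ℝ × ℝ => point p.2 p.1)
      ((volume.restrict (Set.Ioi 0)).prod (volume.restrict S))) := by rw [h.map_eq]; exact hf
  rw [← h.map_eq, integral_map measurable_point.aemeasurable hf'.aestronglyMeasurable,
    integral_prod]
  exact hf'.comp_measurable measurable_point

theorem integral_euclideanArea {f : ℍ → ℂ} (hf : Integrable f euclideanArea) :
    ∫ z, f z ∂euclideanArea = ∫ y in Set.Ioi 0, ∫ x, f (point x y) := by
  have := setIntegral_reIn MeasurableSet.univ (f := f) (by simpa [reIn] using hf)
  simpa [reIn] using this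

/-! ### Comparison of the Euclidean and the hyperbolic area -/

theorem measurable_density :
    Measurable fun z : ℍ => (1 / NNReal.mk z.im z.im_pos.le : NNReal) ^ 2 :=
  have h : Measurable fun z : ℍ => (NNReal.mk z.im z.im_pos.le : NNReal) :=
    UpperHalfPlane.continuous_im.measurable.subtype_mk
  (measurable_const.div h).pow_const 2

theorem restrict_volume (s : Set ℍ) : (volume : Measure ℍ).restrict s =
    (euclideanArea.restrict s).withDensity
      fun z => ((1 / NNReal.mk z.im z.im_pos.le : NNReal) ^ 2 : NNReal) := by
  rw [volume_def]
  exact restrict_withDensity' s _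

theorem setLIntegral_volume (s : Set ℍ) {f : ℍ → ENNReal} (hf : Measurable f) :
    ∫⁻ z in s, f z * ENNReal.ofReal (z.im ^ 2) = ∫⁻ z in s, f z ∂euclideanArea := by
  have hm : Measurable fun z : ℍ => f z * ENNReal.ofReal (z.im ^ 2) :=
    hf.mul (UpperHalfPlane.continuous_im.measurable.pow_const 2).ennreal_ofReal
  rw [restrict_volume, lintegral_withDensity_eq_lintegral_mul _ measurable_density.coe_nnreal_ennreal hm]
  refine lintegral_congr fun z => ?_
  have h1 : (((1 / NNReal.mk z.im z.im_pos.le : NNReal) ^ 2 : NNReal) : ENNReal) =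
      ENNReal.ofReal ((z.im ^ 2)⁻¹) := by
    rw [ENNReal.ofReal, ENNReal.coe_inj]
    ext
    have := z.im_pos
    rw [Real.coe_toNNReal _ (by positivity)]
    simp
  simp only [Pi.mul_apply]
  rw [h1, mul_left_comm, ← ENNReal.ofReal_mul (by positivity), inv_mul_cancel₀
    (pow_ne_zero 2 z.im_ne_zero), ENNReal.ofReal_one, mul_one]

theorem density_smul (z : ℍ) (a : ℂ) : ((1 / NNReal.mk z.im z.im_pos.le : NNReal) ^ 2) • ((z.im : ℂ) ^ 2 * a) = a := by
  have h := z.im_ne_zero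
  have h' : (z.im : ℂ) ≠ 0 := by exact_mod_cast h
  rw [NNReal.smul_def, Complex.real_smul]
  simp only [one_div, NNReal.coe_pow, NNReal.coe_inv, NNReal.coe_mk]
  push_cast
  field_simp

theorem integrableOn_volume_iff (s : Set ℍ) {f : ℍ → ℂ} :
    IntegrableOn (fun z : ℍ => (z.im : ℂ) ^ 2 * f z) s volume ↔ IntegrableOn f s euclideanArea := by
  rw [IntegrableOn, restrict_volume, integrable_withDensity_iff_integrable_smul measurable_density]
  simp only [density_smul]
  rfl

theorem setIntegral_volume (s : Set ℍ) (f : ℍ → ℂ) :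
    ∫ z in s, (z.im : ℂ) ^ 2 * f z = ∫ z in s, f z ∂euclideanArea := by
  rw [restrict_volume, integral_withDensity_eq_integral_smul measurable_density]
  simp only [density_smul]

theorem integral_volume (f : ℍ → ℂ) :
    ∫ z : ℍ, (z.im : ℂ) ^ 2 * f z = ∫ z, f z ∂euclideanArea := by
  simpa using setIntegral_volume Set.univ f

/-! ### The integral of the point-pair invariant -/

theorem measurable_pairKernel (z : ℍ) : Measurable (pairKernel z) := by
  unfold pairKernel
  have h1 := UpperHalfPlane.continuous_im.measurable
  have h2 := measurable_coe
  have h3 : Measurable fun w : ℍ => conj (w : ℂ) := Complex.continuous_conj.measurable.comp h2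
  exact ((h1.const_mul _).pow_const 2).div (((h3.const_sub _).norm).pow_const 4)

theorem measurable_norm_sub_conj (z : ℍ) : Measurable fun w : ℍ => ‖(z : ℂ) - conj (w : ℂ)‖ :=
  ((Complex.continuous_conj.measurable.comp measurable_coe).const_sub _).norm

theorem ofReal_pairKernel (z w : ℍ) : ENNReal.ofReal (pairKernel z w) =
    ENNReal.ofReal (z.im ^ 2 / ‖(z : ℂ) - conj (w : ℂ)‖ ^ 4) * ENNReal.ofReal (w.im ^ 2) := by
  rw [← ENNReal.ofReal_mul (by positivity), pairKernel]
  congr 1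
  ring

theorem norm_sub_conj_sq (z w : ℍ) :
    ‖(z : ℂ) - conj (w : ℂ)‖ ^ 2 = (z.re - w.re) ^ 2 + (z.im + w.im) ^ 2 := by
  rw [← Complex.normSq_eq_norm_sq, Complex.normSq_apply]
  simp
  ring

theorem lintegral_pairKernel_I_lt_top : ∫⁻ w : ℍ, ENNReal.ofReal (pairKernel I w) < ⊤ := by
  have hm : Measurable fun w : ℍ => ENNReal.ofReal (I.im ^ 2 / ‖(I : ℂ) - conj (w : ℂ)‖ ^ 4) :=
    (measurable_const.div ((measurable_norm_sub_conj I).pow_const 4)).ennreal_ofReal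
  simp only [ofReal_pairKernel]
  have := setLIntegral_volume Set.univ hm
  simp only [Measure.restrict_univ] at this
  rw [this, lintegral_euclideanArea hm]
  have hg : ∀ s : Set ℝ, ∫⁻ x in s, ENNReal.ofReal ((1 + x ^ 2)⁻¹) < ⊤ := fun s =>
    (setLIntegral_le_lintegral _ _).trans_lt integrable_inv_one_add_sq.lintegral_lt_top
  have hb : ∀ y ∈ Set.Ioi (0 : ℝ), ∫⁻ x, ENNReal.ofReal
      (I.im ^ 2 / ‖(I : ℂ) - conj (point x y : ℂ)‖ ^ 4) ≤
      ENNReal.ofReal ((1 + y ^ 2)⁻¹) * ∫⁻ x, ENNReal.ofReal ((1 + x ^ 2)⁻¹) := by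
    intro y hy
    have hy : 0 < y := hy
    rw [← lintegral_const_mul _ (by fun_prop)]
    refine lintegral_mono fun x => ?_
    rw [← ENNReal.ofReal_mul (by positivity)]
    refine ENNReal.ofReal_le_ofReal ?_
    rw [show 4 = 2 * 2 from rfl, pow_mul, norm_sub_conj_sq, re_point x hy, im_point x hy, I_im, I_re,
      ← mul_inv, one_pow, one_div]
    refine inv_anti₀ (by positivity) ?_
    have h1 : 1 + x ^ 2 ≤ (0 - x) ^ 2 + (1 + y) ^ 2 := by nlinarith
    have h2 : 1 + y ^ 2 ≤ (0 - x) ^ 2 + (1 + y) ^ 2 := by nlinarith [sq_nonneg x]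
    exact (mul_le_mul h2 h1 (by positivity) (by positivity)).trans_eq (sq _).symm
  refine (setLIntegral_mono' measurableSet_Ioi hb).trans_lt ?_
  rw [lintegral_mul_const _ (by fun_prop)]
  exact ENNReal.mul_lt_top (hg _) (by simpa using hg Set.univ)

/-- The integral of the point-pair invariant does not depend on the base point. -/
theorem lintegral_pairKernel (z : ℍ) :
    ∫⁻ w : ℍ, ENNReal.ofReal (pairKernel z w) = ∫⁻ w : ℍ, ENNReal.ofReal (pairKernel I w) := by
  obtain ⟨A, rfl⟩ := MulAction.exists_smul_eq SL(2, ℝ) I z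
  rw [← mk_smul]
  have h := (measurePreserving_smul (QuotientGroup.mk A : PSL(2, ℝ)) (volume : Measure ℍ)).lintegral_comp
    (measurable_pairKernel ((QuotientGroup.mk A : PSL(2, ℝ)) • I)).ennreal_ofReal
  rw [← h]
  simp only [pairKernel_smul]

theorem integrable_inv_norm_sub_conj (z : ℍ) :
    Integrable (fun w : ℍ => (‖(z : ℂ) - conj (w : ℂ)‖ ^ 4)⁻¹) euclideanArea := by
  have hm : Measurable fun w : ℍ => z.im ^ 2 / ‖(z : ℂ) - conj (w : ℂ)‖ ^ 4 :=
    (measurable_const.div ((measurable_norm_sub_conj z).pow_const 4))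
  have h := lintegral_pairKernel z
  simp only [ofReal_pairKernel z] at h
  have := setLIntegral_volume Set.univ hm.ennreal_ofReal
  simp only [Measure.restrict_univ] at this
  rw [this] at h
  have h1 : Integrable (fun w : ℍ => z.im ^ 2 / ‖(z : ℂ) - conj (w : ℂ)‖ ^ 4) euclideanArea := by
    refine ⟨hm.aestronglyMeasurable, ?_⟩
    rw [hasFiniteIntegral_iff_ofReal (Filter.Eventually.of_forall fun w => by positivity), h]
    exact lintegral_pairKernel_I_lt_top
  refine (h1.const_mul (z.im ^ 2)⁻¹).congr (Filter.Eventually.of_forall fun w => ?_)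
  have := z.im_ne_zero
  simp only
  field_simp

/-- The horoball `{Im > 1}` carries at least a multiple `(Im z)²` of the mass of the point-pair
invariant based at a point `z` outside it. -/
theorem ofReal_im_sq_le (z : ℍ) (hz : z.im ≤ 1) : ENNReal.ofReal (z.im ^ 2) ≤
    100 * ∫⁻ w in {w : ℍ | 1 < w.im}, ENNReal.ofReal (pairKernel z w) := by
  have hH : MeasurableSet {w : ℍ | 1 < w.im} :=
    measurableSet_lt measurable_const UpperHalfPlane.continuous_im.measurable
  have hm : Measurable fun w : ℍ => ENNReal.ofReal (z.im ^ 2 / ‖(z : ℂ) - conj (w : ℂ)‖ ^ 4) :=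
    (measurable_const.div ((measurable_norm_sub_conj z).pow_const 4)).ennreal_ofReal
  have h1 : ENNReal.ofReal (z.im ^ 2 / 100) ≤
      ∫⁻ w in {w : ℍ | 1 < w.im}, ENNReal.ofReal (pairKernel z w) := by
    simp only [ofReal_pairKernel z]
    rw [setLIntegral_volume _ hm, ← lintegral_indicator hH,
      lintegral_euclideanArea (hm.indicator hH)]
    -- on the unit square of points `x + iy` with `Re z < x ≤ Re z + 1` and `1 < y ≤ 2`, the distance
    -- `|z - conj w|` is at most `√10`
    calc ENNReal.ofReal (z.im ^ 2 / 100)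
        = ∫⁻ y in Set.Ioc (1 : ℝ) 2, ∫⁻ x in Set.Ioc z.re (z.re + 1),
            ENNReal.ofReal (z.im ^ 2 / 100) := by
          simp; norm_num
      _ ≤ ∫⁻ y in Set.Ioc (1 : ℝ) 2, ∫⁻ x in Set.Ioc z.re (z.re + 1),
            {w : ℍ | 1 < w.im}.indicator (fun w : ℍ =>
              ENNReal.ofReal (z.im ^ 2 / ‖(z : ℂ) - conj (w : ℂ)‖ ^ 4)) (point x y) := by
          refine setLIntegral_mono' measurableSet_Ioc fun y hy => ?_
          refine setLIntegral_mono' measurableSet_Ioc fun x hx => ?_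
          have hy0 : 0 < y := by linarith [hy.1]
          rw [Set.indicator_of_mem (by simpa [im_point x hy0] using hy.1)]
          refine ENNReal.ofReal_le_ofReal ?_
          have h2 := norm_sub_conj_sq z (point x y)
          rw [re_point x hy0, im_point x hy0] at h2
          have h3 : ‖(z : ℂ) - conj (point x y : ℂ)‖ ^ 2 ≤ 10 := by
            rw [h2]; nlinarith [hx.1, hx.2, hy.1, hy.2, z.im_pos]
          have h4 : 0 < ‖(z : ℂ) - conj (point x y : ℂ)‖ ^ 2 := by
            have := norm_pos_iff.mpr (sub_conj_ne_zero z (point x y)); positivity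
          rw [show 4 = 2 * 2 from rfl, pow_mul]
          gcongr
          nlinarith
      _ ≤ ∫⁻ y in Set.Ioi (0 : ℝ), ∫⁻ x, {w : ℍ | 1 < w.im}.indicator (fun w : ℍ =>
              ENNReal.ofReal (z.im ^ 2 / ‖(z : ℂ) - conj (w : ℂ)‖ ^ 4)) (point x y) := by
          refine (lintegral_mono fun y => setLIntegral_le_lintegral _ _).trans ?_
          exact lintegral_mono_set fun y hy => zero_lt_one.trans hy.1
  calc ENNReal.ofReal (z.im ^ 2) = 100 * ENNReal.ofReal (z.im ^ 2 / 100) := by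
        rw [show (100 : ENNReal) = ENNReal.ofReal 100 by norm_num, ← ENNReal.ofReal_mul (by norm_num)]
        congr 1; ring
    _ ≤ _ := by gcongr

/-! ### The Eisenstein series -/

section Cusp

variable {Γ : Subgroup PSL(2, ℝ)} {κ : Γ} {σ : PSL(2, ℝ)}

theorem eisensteinTerm_two (κ : Γ) (σ : PSL(2, ℝ)) (z : ℍ) (c : Cosets κ) :
    eisensteinTerm κ σ 2 z c = (((cosetMap κ σ c • z).im ^ 2 : ℝ) : ℂ) := by
  rw [eisensteinTerm, cosetMap, show (2 : ℂ) = ((2 : ℕ) : ℂ) by norm_num, Complex.cpow_natCast]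
  push_cast; rfl

theorem IsScaling.inv_mul_zpow (hσ : IsScaling κ σ) : ∃ ε : ℤ, (ε = 1 ∨ ε = -1) ∧
    ∀ (c : Cosets κ) (k : ℤ) (z : ℍ), σ⁻¹ • (κ ^ k * (c.out : Γ)) • z =
      translation ((ε * k : ℤ) : ℝ) • cosetMap κ σ c • z := by
  obtain ⟨ε, hε, h⟩ := hσ.exists_sign
  refine ⟨ε, hε, fun c k z => ?_⟩
  have h1 : (κ ^ k * (c.out : Γ)) • z = (((κ ^ k * (c.out : Γ) : Γ)) : PSL(2, ℝ)) • z := rfl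
  rw [h1, Subgroup.coe_mul, h, smul_smul, smul_smul, cosetMap]
  congr 1
  group

theorem exists_equiv_prod (hκ : IsParabolicGenerator κ) (hσ : IsScaling κ σ) :
    ∃ ε : ℤ, (ε = 1 ∨ ε = -1) ∧ ∃ e : Cosets κ × ℤ ≃ Γ, ∀ (p : Cosets κ × ℤ) (z : ℍ),
      σ⁻¹ • e p • z = translation ((ε * p.2 : ℤ) : ℝ) • cosetMap κ σ p.1 • z := by
  obtain ⟨ε, hε, h⟩ := hσ.inv_mul_zpow
  exact ⟨ε, hε, Equiv.ofBijective _ (bijective_zpow_mul_out hκ hσ), fun p z => h p.1 p.2 z⟩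

variable [DiscreteTopology Γ]

theorem countable_cosets (κ : Γ) : Countable (Cosets κ) :=
  haveI := countable_of_discrete Γ
  inferInstanceAs (Countable (Quotient _))

/-- Away from the horoball of the cusp itself the Eisenstein series of parameter `2` is bounded,
uniformly on the upper half plane: its terms are dominated by the masses which the point-pair
invariant based at `z` gives to the pairwise disjoint images of the horoball. -/
theorem tsum_im_sq_le (hσ : IsScaling κ σ) (z : ℍ) :
    ∑' c : Cosets κ, (if (cosetMap κ σ c • z).im ≤ 1 then
      ENNReal.ofReal ((cosetMap κ σ c • z).im ^ 2) else 0) ≤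
      100 * ∫⁻ w : ℍ, ENNReal.ofReal (pairKernel I w) := by
  have := countable_cosets κ
  have hH : MeasurableSet {w : ℍ | 1 < w.im} :=
    measurableSet_lt measurable_const UpperHalfPlane.continuous_im.measurable
  have hterm : ∀ c : Cosets κ, (if (cosetMap κ σ c • z).im ≤ 1 then
      ENNReal.ofReal ((cosetMap κ σ c • z).im ^ 2) else 0) ≤
      100 * ∫⁻ w in (fun w => cosetMap κ σ c • w) ⁻¹' {w : ℍ | 1 < w.im},
        ENNReal.ofReal (pairKernel z w) := by
    intro c
    split_ifs with h
    · refine (ofReal_im_sq_le _ h).trans_eq ?_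
      rw [← (measurePreserving_smul (cosetMap κ σ c) (volume : Measure ℍ)).setLIntegral_comp_preimage hH
        (measurable_pairKernel _).ennreal_ofReal]
      simp only [pairKernel_smul]
    · exact zero_le
  refine (ENNReal.tsum_le_tsum hterm).trans ?_
  rw [ENNReal.tsum_mul_left, ← lintegral_iUnion, ← lintegral_pairKernel z]
  · gcongr
    exact Measure.restrict_le_self
  · exact fun c => hH.preimage (measurable_const_smul _)
  · intro c c' hcc'
    refine Set.disjoint_left.mpr fun w hw hw' => hcc' ?_
    exact hσ.eq_of_one_lt_im hw hw'

/-- At most one term of a series over the cosets comes from the horoball of the cusp. -/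
theorem tsum_one_lt_im_eq (hσ : IsScaling κ σ) (z : ℍ) (f : ℍ → ENNReal) :
    ∃ c : Cosets κ, ∑' c : Cosets κ, (if (cosetMap κ σ c • z).im ≤ 1 then 0
      else f (cosetMap κ σ c • z)) ≤ f (cosetMap κ σ c • z) := by
  by_cases h : ∃ c : Cosets κ, 1 < (cosetMap κ σ c • z).im
  · obtain ⟨c, hc⟩ := h
    refine ⟨c, ?_⟩
    rw [tsum_eq_single c, if_neg (not_le.mpr hc)]
    intro c' hc'
    rw [if_pos]
    by_contra! h'
    exact hc' (hσ.eq_of_one_lt_im h' hc)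
  · push Not at h
    exact ⟨Quotient.mk _ 1, by simp [h]⟩

theorem tsum_im_sq_ne_top (hσ : IsScaling κ σ) (z : ℍ) :
    ∑' c : Cosets κ, ENNReal.ofReal ((cosetMap κ σ c • z).im ^ 2) ≠ ⊤ := by
  have hfin : 100 * ∫⁻ w : ℍ, ENNReal.ofReal (pairKernel I w) ≠ ⊤ :=
    ENNReal.mul_ne_top (by norm_num) lintegral_pairKernel_I_lt_top.ne
  have hsplit : ∀ c : Cosets κ, ENNReal.ofReal ((cosetMap κ σ c • z).im ^ 2) =
      (if (cosetMap κ σ c • z).im ≤ 1 then ENNReal.ofReal ((cosetMap κ σ c • z).im ^ 2) else 0) +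
      (if (cosetMap κ σ c • z).im ≤ 1 then 0 else ENNReal.ofReal ((cosetMap κ σ c • z).im ^ 2)) := by
    intro c; split_ifs <;> simp
  rw [tsum_congr hsplit, ENNReal.tsum_add]
  refine ENNReal.add_ne_top.mpr ⟨ne_top_of_le_ne_top hfin (tsum_im_sq_le hσ z), ?_⟩
  obtain ⟨c, hc⟩ := tsum_one_lt_im_eq hσ z fun w => ENNReal.ofReal (w.im ^ 2)
  exact ne_top_of_le_ne_top ENNReal.ofReal_ne_top hc

theorem summable_im_sq (hσ : IsScaling κ σ) (z : ℍ) :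
    Summable fun c : Cosets κ => (cosetMap κ σ c • z).im ^ 2 :=
  (ENNReal.summable_toReal (tsum_im_sq_ne_top hσ z)).congr fun c =>
    ENNReal.toReal_ofReal (by positivity)

theorem summable_eisensteinTerm (hσ : IsScaling κ σ) (z : ℍ) :
    Summable (eisensteinTerm κ σ 2 z) := by
  simp_rw [funext (eisensteinTerm_two κ σ z)]
  exact Complex.ofRealCLM.summable (summable_im_sq hσ z)

/-! ### Unfolding -/

variable {F : Set ℍ}

theorem existsUnique_translation_mem_strip {ε : ℤ} (hε : ε = 1 ∨ ε = -1) (w : ℍ) :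
    ∃! k : ℤ, translation ((ε * k : ℤ) : ℝ) • w ∈ strip := by
  obtain ⟨m, hm, hu⟩ := existsUnique_add_zsmul_mem_Ioc (zero_lt_one' ℝ) w.re 0
  have hre : ∀ k : ℤ, translation (k : ℝ) • w ∈ strip ↔ w.re + k • (1 : ℝ) ∈ Set.Ioc (0 : ℝ) (0 + 1) := by
    intro k
    rw [translation_smul, strip, reIn, Set.mem_ofPred_eq, vadd_re, zero_add, add_comm]
    simp
  have h1 : ε * ε = 1 := by rcases hε with rfl | rfl <;> norm_num
  refine ⟨ε * m, ?_, fun k hk => ?_⟩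
  · simp only
    rw [← mul_assoc, h1, one_mul, hre]
    exact hm
  · have := hu _ ((hre _).mp hk)
    rw [← this, ← mul_assoc, h1, one_mul]

theorem tsum_indicator_strip {E : Type*} [AddCommMonoid E] [TopologicalSpace E]
    {ε : ℤ} (hε : ε = 1 ∨ ε = -1) {f : ℍ → E}
    (hT : ∀ (n : ℤ) (z : ℍ), f (translation n • z) = f z) (w : ℍ) :
    ∑' k : ℤ, strip.indicator f (translation ((ε * k : ℤ) : ℝ) • w) = f w := by
  obtain ⟨k, hk, hu⟩ := existsUnique_translation_mem_strip hε w
  rw [tsum_eq_single k, Set.indicator_of_mem hk, hT]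
  exact fun k' hk' => Set.indicator_of_notMem (fun h => hk' (hu k' h)) _

/-- The unfolding identity for nonnegative functions. -/
theorem setLIntegral_tsum_cosetMap (hF : IsFundamentalDomain Γ F (volume : Measure ℍ))
    (hκ : IsParabolicGenerator κ) (hσ : IsScaling κ σ) {f : ℍ → ENNReal} (hf : Measurable f)
    (hT : ∀ (n : ℤ) (z : ℍ), f (translation n • z) = f z) :
    ∫⁻ z in F, ∑' c : Cosets κ, f (cosetMap κ σ c • z) = ∫⁻ z in strip, f z := by
  have := countable_of_discrete Γ
  have := countable_cosets κ
  obtain ⟨ε, hε, e, h⟩ := exists_equiv_prod hκ hσ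
  have hm : Measurable (strip.indicator f) := hf.indicator measurableSet_strip
  rw [← lintegral_indicator measurableSet_strip,
    ← (measurePreserving_smul σ⁻¹ (volume : Measure ℍ)).lintegral_comp hm, hF.lintegral_eq_tsum'',
    ← e.tsum_eq, ENNReal.tsum_prod']
  simp only [h]
  have hfc : ∀ c : Cosets κ, AEMeasurable (fun z => f (cosetMap κ σ c • z)) (volume.restrict F) :=
    fun c => (hf.comp (measurable_const_smul _)).aemeasurable
  rw [lintegral_tsum hfc]
  refine tsum_congr fun c => ?_
  have hmk : ∀ k : ℤ, AEMeasurable (fun z => strip.indicator f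
      (translation ((ε * k : ℤ) : ℝ) • cosetMap κ σ c • z)) (volume.restrict F) := fun k =>
    (hm.comp ((measurable_const_smul _).comp (measurable_const_smul _))).aemeasurable
  rw [← lintegral_tsum hmk]
  simp only [tsum_indicator_strip hε hT]

theorem tsum_setLIntegral_cosetMap (hF : IsFundamentalDomain Γ F (volume : Measure ℍ))
    (hκ : IsParabolicGenerator κ) (hσ : IsScaling κ σ) {f : ℍ → ENNReal} (hf : Measurable f)
    (hT : ∀ (n : ℤ) (z : ℍ), f (translation n • z) = f z) :
    ∑' c : Cosets κ, ∫⁻ z in F, f (cosetMap κ σ c • z) = ∫⁻ z in strip, f z := by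
  have := countable_cosets κ
  rw [← setLIntegral_tsum_cosetMap hF hκ hσ hf hT]
  exact (lintegral_tsum fun c => (hf.comp (measurable_const_smul _)).aemeasurable).symm

theorem tsum_setLIntegral_enorm_lt_top (hF : IsFundamentalDomain Γ F (volume : Measure ℍ))
    (hκ : IsParabolicGenerator κ) (hσ : IsScaling κ σ) {f : ℍ → ℂ} (hf : Measurable f)
    (hT : ∀ (n : ℤ) (z : ℍ), f (translation n • z) = f z) (hfi : IntegrableOn f strip) :
    ∑' c : Cosets κ, ∫⁻ z in F, ‖f (cosetMap κ σ c • z)‖ₑ < ⊤ := by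
  rw [tsum_setLIntegral_cosetMap hF hκ hσ hf.enorm fun n z => by rw [hT]]
  exact hfi.2

theorem integrableOn_cosetMap (hF : IsFundamentalDomain Γ F (volume : Measure ℍ))
    (hκ : IsParabolicGenerator κ) (hσ : IsScaling κ σ) {f : ℍ → ℂ} (hf : Measurable f)
    (hT : ∀ (n : ℤ) (z : ℍ), f (translation n • z) = f z) (hfi : IntegrableOn f strip)
    (c : Cosets κ) : IntegrableOn (fun z => f (cosetMap κ σ c • z)) F :=
  ⟨(hf.comp (measurable_const_smul _)).aestronglyMeasurable,
    (ENNReal.le_tsum c).trans_lt (tsum_setLIntegral_enorm_lt_top hF hκ hσ hf hT hfi)⟩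

/-- The unfolding identity for integrable functions. -/
theorem tsum_setIntegral_cosetMap (hF : IsFundamentalDomain Γ F (volume : Measure ℍ))
    (hκ : IsParabolicGenerator κ) (hσ : IsScaling κ σ) {f : ℍ → ℂ} (hf : Measurable f)
    (hT : ∀ (n : ℤ) (z : ℍ), f (translation n • z) = f z) (hfi : IntegrableOn f strip) :
    ∑' c : Cosets κ, ∫ z in F, f (cosetMap κ σ c • z) = ∫ z in strip, f z := by
  have := countable_of_discrete Γ
  have := countable_cosets κ
  obtain ⟨ε, hε, e, h⟩ := exists_equiv_prod hκ hσ
  have hm : Measurable (strip.indicator f) := hf.indicator measurableSet_strip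
  have hmp := measurePreserving_smul σ⁻¹ (volume : Measure ℍ)
  have hi0 : Integrable (strip.indicator f) := (integrable_indicator_iff measurableSet_strip).mpr hfi
  have hi : Integrable (fun z : ℍ => strip.indicator f (σ⁻¹ • z)) := by
    have := hmp.integrable_comp_of_integrable hi0
    exact this
  have hmk : ∀ (c : Cosets κ) (k : ℤ),
      Measurable fun z => strip.indicator f (translation ((ε * k : ℤ) : ℝ) • cosetMap κ σ c • z) :=
    fun c k => hm.comp ((measurable_const_smul _).comp (measurable_const_smul _))
  have hsum : ∑' p : Cosets κ × ℤ, ∫⁻ z in F,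
      ‖strip.indicator f (translation ((ε * p.2 : ℤ) : ℝ) • cosetMap κ σ p.1 • z)‖ₑ < ⊤ := by
    have h1 := hi.2
    rw [hasFiniteIntegral_iff_enorm, hF.lintegral_eq_tsum'',
      ← e.tsum_eq] at h1
    simpa only [h] using h1
  have hsum1 : ∀ c : Cosets κ, ∑' k : ℤ, ∫⁻ z in F,
      ‖strip.indicator f (translation ((ε * k : ℤ) : ℝ) • cosetMap κ σ c • z)‖ₑ < ⊤ := fun c => by
    rw [ENNReal.tsum_prod'] at hsum
    exact (ENNReal.le_tsum c).trans_lt hsum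
  have hsummable : Summable fun p : Cosets κ × ℤ => ∫ z in F,
      strip.indicator f (translation ((ε * p.2 : ℤ) : ℝ) • cosetMap κ σ p.1 • z) := by
    refine Summable.of_norm ?_
    have h2 : ∑' p : Cosets κ × ℤ, ‖∫ z in F, strip.indicator f
        (translation ((ε * p.2 : ℤ) : ℝ) • cosetMap κ σ p.1 • z)‖ₑ ≠ ⊤ :=
      ne_top_of_le_ne_top hsum.ne (ENNReal.tsum_le_tsum fun p => enorm_integral_le_lintegral_enorm _)
    have h3 := ENNReal.summable_toReal h2
    simpa only [toReal_enorm] using h3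
  rw [← integral_indicator measurableSet_strip,
    ← hmp.integral_comp (measurableEmbedding_const_smul _), hF.integral_eq_tsum'' _ hi,
    ← e.tsum_eq]
  simp only [h]
  rw [hsummable.tsum_prod]
  refine tsum_congr fun c => ?_
  rw [← integral_tsum (fun k => (hmk c k).aestronglyMeasurable) (hsum1 c).ne]
  simp only [tsum_indicator_strip hε hT]

end Cusp

/-! ### Quadratic differentials in the coordinate of a cusp -/

/-- The pull-back `φ(B ζ) B'(ζ)²` of a quadratic differential under a Möbius transformation. -/
def pullback (φ : ℍ → ℂ) (B : PSL(2, ℝ)) (ζ : ℍ) : ℂ := φ (B • ζ) * mobDeriv B ζ ^ 2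

theorem pullback_mul {Γ : Subgroup PSL(2, ℝ)} {φ : ℍ → ℂ}
    (h : ∀ γ ∈ Γ, ∀ z : ℍ, φ (γ • z) * mobDeriv γ z ^ 2 = φ z) {γ : PSL(2, ℝ)} (hγ : γ ∈ Γ)
    (B : PSL(2, ℝ)) : pullback φ (γ * B) = pullback φ B := by
  funext ζ
  rw [pullback, pullback, mobDeriv_mul, mul_smul, ← h γ hγ (B • ζ)]
  ring

theorem pullback_translation_smul {Γ : Subgroup PSL(2, ℝ)} {φ : ℍ → ℂ}
    (h : ∀ γ ∈ Γ, ∀ z : ℍ, φ (γ • z) * mobDeriv γ z ^ 2 = φ z) {B : PSL(2, ℝ)} {t : ℝ}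
    (ht : B * translation t * B⁻¹ ∈ Γ) (z : ℍ) :
    pullback φ B (translation t • z) = pullback φ B z := by
  have h1 := congrFun (pullback_mul h ht B) z
  rw [inv_mul_cancel_right] at h1
  rw [← h1, pullback, pullback, mobDeriv_mul, mobDeriv_translation, mul_one, mul_smul]

theorem norm_pullback_sq (φ : ℍ → ℂ) (B : PSL(2, ℝ)) (z : ℍ) :
    ‖pullback φ B z‖ ^ 2 * z.im ^ 4 = ‖φ (B • z)‖ ^ 2 * (B • z).im ^ 4 := by
  rw [pullback, im_smul, norm_mul, norm_pow]
  ring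

theorem differentiableOn_pullback {φ : ℍ → ℂ} (h : MDifferentiable 𝓘(ℂ) 𝓘(ℂ) φ) (B : PSL(2, ℝ)) :
    DifferentiableOn ℂ (pullback φ B ∘ ofComplex) {z | 0 < z.im} := by
  rw [UpperHalfPlane.mdifferentiable_iff] at h
  obtain ⟨A, rfl⟩ := QuotientGroup.mk_surjective B
  have hd : ∀ w : ℂ, 0 < w.im → (A 1 0 : ℂ) * w + A 1 1 ≠ 0 := fun w hw => denominator_ne_zero A hw
  have h1 : DifferentiableOn ℂ (fun w : ℂ => ((A 0 0 : ℂ) * w + A 0 1) / ((A 1 0 : ℂ) * w + A 1 1))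
      {z | 0 < z.im} := fun w hw => by
    refine DifferentiableAt.differentiableWithinAt ?_
    have := hd w hw
    fun_prop (disch := assumption)
  have h2 : DifferentiableOn ℂ (fun w : ℂ => (1 / ((A 1 0 : ℂ) * w + A 1 1) ^ 2) ^ 2)
      {z | 0 < z.im} := fun w hw => by
    refine DifferentiableAt.differentiableWithinAt ?_
    have := pow_ne_zero 2 (hd w hw)
    fun_prop (disch := assumption)
  have hco : ∀ w : ℂ, 0 < w.im → ((A 0 0 : ℂ) * w + A 0 1) / ((A 1 0 : ℂ) * w + A 1 1) =
      (((QuotientGroup.mk A : PSL(2, ℝ)) • ofComplex w : ℍ) : ℂ) := fun w hw => by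
    rw [coe_mk_smul, ofComplex_apply_of_im_pos hw]
  have h3 := h.comp h1 fun w (hw : 0 < w.im) => by
    rw [hco w hw]
    exact ((QuotientGroup.mk A : PSL(2, ℝ)) • ofComplex w).im_pos
  refine (h3.mul h2).congr fun w (hw : 0 < w.im) => ?_
  simp only [Function.comp, pullback, Pi.mul_apply, hco w hw, mobDeriv_mk, ofComplex_apply]
  rw [ofComplex_apply_of_im_pos hw]

/-- The properties of a quadratic differential in the coordinate of a cusp on which its Fourier
expansion rests: it is holomorphic and invariant under the integral translations, and it has two
weighted square integrability properties, below and above height one. -/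
structure IsCuspidal (f : ℍ → ℂ) : Prop where
  differentiableOn : DifferentiableOn ℂ (f ∘ ofComplex) {z | 0 < z.im}
  periodic : ∀ (n : ℤ) (z : ℍ), f (translation n • z) = f z
  lintegral_low : ∫⁻ z in strip, (if z.im ≤ 1 then ENNReal.ofReal (‖f z‖ ^ 2 * z.im ^ 4) else 0)
    ∂euclideanArea < ⊤
  lintegral_high : ∫⁻ z in strip, (if z.im ≤ 1 then 0 else ENNReal.ofReal (‖f z‖ ^ 2 * z.im ^ 2))
    ∂euclideanArea < ⊤

theorem continuous_of_differentiableOn {f : ℍ → ℂ}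
    (h : DifferentiableOn ℂ (f ∘ ofComplex) {z | 0 < z.im}) : Continuous f :=
  (UpperHalfPlane.mdifferentiable_iff.mpr h).continuous

theorem IsCuspidal.continuous {f : ℍ → ℂ} (h : IsCuspidal f) : Continuous f :=
  continuous_of_differentiableOn h.differentiableOn

section Cusp

variable {Γ : Subgroup PSL(2, ℝ)} {κ : Γ} {σ : PSL(2, ℝ)} {F : Set ℍ} {φ : ℍ → ℂ}

theorem IsQuadraticDifferential.continuous (hφ : IsQuadraticDifferential Γ F φ) : Continuous φ :=
  hφ.holomorphic.continuous

theorem IsQuadraticDifferential.lintegral_lt_top (hφ : IsQuadraticDifferential Γ F φ) :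
    ∫⁻ z in F, ENNReal.ofReal (‖φ z‖ ^ 2 * z.im ^ 4) < ⊤ := by
  have h1 := hφ.finite_norm.2
  rw [hasFiniteIntegral_iff_ofReal (Filter.Eventually.of_forall fun z => by positivity),
    ← setLIntegral_volume] at h1
  · convert h1 using 3 with z
    rw [← ENNReal.ofReal_mul (by positivity)]
    congr 1; ring
  · exact ((hφ.continuous.measurable.norm.pow_const 2).mul
      (UpperHalfPlane.continuous_im.measurable.pow_const 2)).ennreal_ofReal

theorem IsQuadraticDifferential.norm_smul (hφ : IsQuadraticDifferential Γ F φ) {γ : PSL(2, ℝ)}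
    (hγ : γ ∈ Γ) (z : ℍ) : ‖φ (γ • z)‖ ^ 2 * (γ • z).im ^ 4 = ‖φ z‖ ^ 2 * z.im ^ 4 := by
  rw [← norm_pullback_sq, pullback, hφ.automorphic γ hγ]

theorem norm_pullback_cosetMap (hφ : IsQuadraticDifferential Γ F φ) (c : Cosets κ) (z : ℍ) :
    ‖pullback φ σ (cosetMap κ σ c • z)‖ ^ 2 * (cosetMap κ σ c • z).im ^ 4 =
      ‖φ z‖ ^ 2 * z.im ^ 4 := by
  rw [norm_pullback_sq, smul_smul, cosetMap, mul_inv_cancel_left, hφ.norm_smul c.out.2]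

variable [DiscreteTopology Γ]

/-- Both integrability properties follow by unfolding. Below height one the sum over the cosets is
the bounded part of the Eisenstein series; above height one it has at most one nonzero term. -/
theorem IsQuadraticDifferential.isCuspidal (hF : IsFundamentalDomain Γ F (volume : Measure ℍ))
    (hκ : IsParabolicGenerator κ) (hσ : IsScaling κ σ) (hφ : IsQuadraticDifferential Γ F φ) :
    IsCuspidal (pullback φ σ) := by
  obtain ⟨ε, hε, hl⟩ := hσ.exists_sign
  have hper : ∀ (n : ℤ) (z : ℍ), pullback φ σ (translation n • z) = pullback φ σ z := by
    intro n z
    refine pullback_translation_smul hφ.automorphic ?_ z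
    have h1 : ε * ε = 1 := by rcases hε with rfl | rfl <;> norm_num
    have := hl (ε * n)
    rw [← mul_assoc, h1, one_mul] at this
    rw [← this]
    exact (κ ^ (ε * n)).2
  have hdiff := differentiableOn_pullback hφ.holomorphic σ
  have hcont := continuous_of_differentiableOn hdiff
  have him : ∀ (n : ℤ) (z : ℍ), (translation n • z).im = z.im := fun n z => by
    rw [translation_smul, vadd_im]
  have him_meas : Measurable fun z : ℍ => z.im := UpperHalfPlane.continuous_im.measurable
  have hset : MeasurableSet {z : ℍ | z.im ≤ 1} := measurableSet_le him_meas measurable_const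
  have hfm : ∀ k : ℕ, Measurable fun z => ENNReal.ofReal (‖pullback φ σ z‖ ^ 2 * z.im ^ k) :=
    fun k => ((hcont.measurable.norm.pow_const 2).mul (him_meas.pow_const k)).ennreal_ofReal
  have hlow : Measurable fun z => if z.im ≤ 1 then
      ENNReal.ofReal (‖pullback φ σ z‖ ^ 2 * z.im ^ 4) else 0 := (hfm 4).ite hset measurable_const
  have hhigh : Measurable fun z => if z.im ≤ 1 then 0 else
      ENNReal.ofReal (‖pullback φ σ z‖ ^ 2 * z.im ^ 2) := measurable_const.ite hset (hfm 2)
  have hfin := hφ.lintegral_lt_top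
  refine ⟨hdiff, hper, ?_, ?_⟩
  · have hm : Measurable fun z : ℍ => (if z.im ≤ 1 then ENNReal.ofReal (‖pullback φ σ z‖ ^ 2 * z.im ^ 4)
        else 0) * ENNReal.ofReal (z.im ^ 2) :=
      hlow.mul (him_meas.pow_const 2).ennreal_ofReal
    rw [← setLIntegral_volume _ hlow, ← setLIntegral_tsum_cosetMap hF hκ hσ hm
      (fun n z => by simp only [hper, him])]
    have hC : 100 * ∫⁻ w : ℍ, ENNReal.ofReal (pairKernel I w) < ⊤ :=
      ENNReal.mul_lt_top (by norm_num) lintegral_pairKernel_I_lt_top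
    refine lt_of_le_of_lt (lintegral_mono fun z => ?_) (b := ∫⁻ z in F,
      ENNReal.ofReal (‖φ z‖ ^ 2 * z.im ^ 4) * (100 * ∫⁻ w : ℍ, ENNReal.ofReal (pairKernel I w))) ?_
    · refine le_trans (le_of_eq ?_) (mul_le_mul_right (tsum_im_sq_le hσ z) _)
      rw [← ENNReal.tsum_mul_left]
      refine tsum_congr fun c => ?_
      rw [norm_pullback_cosetMap hφ]
      split_ifs <;> simp
    · rw [lintegral_mul_const' _ _ hC.ne]
      exact ENNReal.mul_lt_top hfin hC
  · have hm : Measurable fun z : ℍ => (if z.im ≤ 1 then 0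
        else ENNReal.ofReal (‖pullback φ σ z‖ ^ 2 * z.im ^ 2)) * ENNReal.ofReal (z.im ^ 2) :=
      hhigh.mul (him_meas.pow_const 2).ennreal_ofReal
    rw [← setLIntegral_volume _ hhigh, ← setLIntegral_tsum_cosetMap hF hκ hσ hm
      (fun n z => by simp only [hper, him])]
    refine lt_of_le_of_lt (lintegral_mono fun z => ?_) hfin
    obtain ⟨c, hc⟩ := tsum_one_lt_im_eq hσ z fun w =>
      ENNReal.ofReal (‖pullback φ σ w‖ ^ 2 * w.im ^ 4)
    rw [norm_pullback_cosetMap hφ] at hc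
    refine le_trans (le_of_eq (tsum_congr fun c => ?_)) hc
    split_ifs
    · simp
    · rw [← ENNReal.ofReal_mul (by positivity)]
      congr 1; ring

end Cusp

/-! ### Fourier expansions without constant term -/

theorem hasSum_setIntegral_Ioc {ι : Type*} [Countable ι] {G : ι → ℝ → ℂ} {u : ι → ℝ}
    (hc : ∀ i, Continuous (G i)) (hb : ∀ i x, ‖G i x‖ ≤ u i) (hu : Summable u) :
    HasSum (fun i => ∫ x in Set.Ioc (0 : ℝ) 1, G i x) (∫ x in Set.Ioc (0 : ℝ) 1, ∑' i, G i x) := by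
  refine hasSum_integral_of_summable_integral_norm (fun i => ?_) ?_
  · exact ((hc i).integrableOn_Icc).mono_set Set.Ioc_subset_Icc_self
  · refine Summable.of_nonneg_of_le (fun i => integral_nonneg fun x => norm_nonneg _) (fun i => ?_) hu
    have : ∫ x in Set.Ioc (0 : ℝ) 1, ‖G i x‖ ≤ ∫ x in Set.Ioc (0 : ℝ) 1, u i := by
      refine setIntegral_mono_on ?_ ?_ measurableSet_Ioc fun x _ => hb i x
      · exact ((hc i).norm.integrableOn_Icc).mono_set Set.Ioc_subset_Icc_self
      · exact integrableOn_const (by simp)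
    simpa using this

theorem setIntegral_exp (n : ℤ) : ∫ x in Set.Ioc (0 : ℝ) 1, Complex.exp (2 * Real.pi * Complex.I * n * x) =
    if n = 0 then 1 else 0 := by
  rw [← intervalIntegral.integral_of_le zero_le_one]
  split_ifs with h
  · simp [h]
  · have hne : (2 * Real.pi * Complex.I * n : ℂ) ≠ 0 := by
      have h1 : (n : ℂ) ≠ 0 := by exact_mod_cast h
      simpa [Real.pi_ne_zero] using h1
    rw [integral_exp_mul_complex hne]
    simp only [Complex.ofReal_one, mul_one, Complex.ofReal_zero, mul_zero, Complex.exp_zero]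
    rw [mul_comm, Complex.exp_int_mul_two_pi_mul_I]
    simp

theorem norm_exp_two_pi (n : ℤ) (x : ℝ) : ‖Complex.exp (2 * Real.pi * Complex.I * n * x)‖ = 1 := by
  rw [show (2 * Real.pi * Complex.I * n * x : ℂ) = ((2 * Real.pi * n * x : ℝ) : ℂ) * Complex.I by
    push_cast; ring, Complex.norm_exp_ofReal_mul_I]

theorem setIntegral_exp_mul_tsum {c : ℕ → ℂ} (hc : Summable fun n => ‖c n‖) (m : ℕ) :
    ∫ x in Set.Ioc (0 : ℝ) 1, Complex.exp (2 * Real.pi * Complex.I * (-m : ℤ) * x) *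
      ∑' n : ℕ, c n * Complex.exp (2 * Real.pi * Complex.I * (n : ℤ) * x) = c m := by
  have h := hasSum_setIntegral_Ioc
    (G := fun (n : ℕ) (x : ℝ) => c n * Complex.exp (2 * Real.pi * Complex.I * ((n - m : ℤ) : ℤ) * x))
    (u := fun n => ‖c n‖) (fun n => by fun_prop)
    (fun n x => by rw [norm_mul, norm_exp_two_pi, mul_one]) hc
  have h2 : ∀ n : ℕ, ∫ x in Set.Ioc (0 : ℝ) 1,
      c n * Complex.exp (2 * Real.pi * Complex.I * ((n - m : ℤ) : ℤ) * x) =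
      if n = m then c m else 0 := by
    intro n
    rw [integral_const_mul, setIntegral_exp]
    by_cases hnm : n = m
    · simp [hnm]
    · rw [if_neg hnm, if_neg (by omega), mul_zero]
  simp only [h2] at h
  rw [← h.unique (hasSum_ite_eq m (c m))]
  refine setIntegral_congr_fun measurableSet_Ioc fun x _ => ?_
  rw [← tsum_mul_left]
  refine tsum_congr fun n => ?_
  rw [mul_left_comm, ← Complex.exp_add]
  congr 2
  push_cast; ring

/-- Parseval's identity for absolutely convergent Fourier series. -/
theorem hasSum_parseval {a c : ℕ → ℂ} (ha : Summable fun n => ‖a n‖) (hc : Summable fun n => ‖c n‖) :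
    HasSum (fun n => conj (a n) * c n) (∫ x in Set.Ioc (0 : ℝ) 1,
      conj (∑' n : ℕ, a n * Complex.exp (2 * Real.pi * Complex.I * (n : ℤ) * x)) *
        ∑' n : ℕ, c n * Complex.exp (2 * Real.pi * Complex.I * (n : ℤ) * x)) := by
  have hcont : Continuous fun x : ℝ =>
      ∑' n : ℕ, c n * Complex.exp (2 * Real.pi * Complex.I * (n : ℤ) * x) :=
    continuous_tsum (fun n => by fun_prop) hc fun n x => by rw [norm_mul, norm_exp_two_pi, mul_one]
  have hbound : ∀ x : ℝ, ‖∑' n : ℕ, c n * Complex.exp (2 * Real.pi * Complex.I * (n : ℤ) * x)‖ ≤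
      ∑' n, ‖c n‖ := fun x =>
    tsum_of_norm_bounded hc.hasSum fun n => by rw [norm_mul, norm_exp_two_pi, mul_one]
  have h := hasSum_setIntegral_Ioc
    (G := fun (m : ℕ) (x : ℝ) => conj (a m) * (Complex.exp (2 * Real.pi * Complex.I * (-m : ℤ) * x) *
      ∑' n : ℕ, c n * Complex.exp (2 * Real.pi * Complex.I * (n : ℤ) * x)))
    (u := fun m => ‖a m‖ * ∑' n, ‖c n‖) (fun m => by fun_prop)
    (fun m x => by
      rw [norm_mul, norm_mul, norm_exp_two_pi, one_mul, Complex.norm_conj]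
      gcongr
      exact hbound x) (ha.mul_right _)
  simp only [integral_const_mul, setIntegral_exp_mul_tsum hc] at h
  convert h using 1
  refine setIntegral_congr_fun measurableSet_Ioc fun x _ => ?_
  simp only [← mul_assoc]
  rw [tsum_mul_right, Complex.conj_tsum]
  congr 1
  refine tsum_congr fun n => ?_
  rw [map_mul, ← Complex.exp_conj]
  congr 2
  simp [map_ofNat]

/-- `f(z) = ∑_{n ≥ 1} aₙ e^{2πinz}` on the upper half plane, with absolute convergence on every
horizontal line. The coefficients are indexed by all natural numbers, and `a₀ = 0`. -/
structure HasExpansion (f : ℍ → ℂ) (a : ℕ → ℂ) : Prop where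
  zero : a 0 = 0
  summable : ∀ y : ℝ, 0 < y → Summable fun n : ℕ => ‖a n‖ * Real.exp (-(2 * Real.pi * n * y))
  hasSum : ∀ z : ℍ, HasSum (fun n : ℕ => a n * Complex.exp (2 * Real.pi * Complex.I * n * z)) (f z)

theorem exp_point (n : ℕ) (x : ℝ) {y : ℝ} (hy : 0 < y) :
    Complex.exp (2 * Real.pi * Complex.I * n * (point x y : ℂ)) =
      (Real.exp (-(2 * Real.pi * n * y)) : ℂ) * Complex.exp (2 * Real.pi * Complex.I * (n : ℤ) * x) := by
  rw [coe_point x hy, Complex.ofReal_exp, ← Complex.exp_add]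
  congr 1
  push_cast
  linear_combination (2 * Real.pi * n * y : ℂ) * Complex.I_mul_I

theorem HasExpansion.summable_norm {f : ℍ → ℂ} {a : ℕ → ℂ} (h : HasExpansion f a) {y : ℝ} (hy : 0 < y) :
    Summable fun n : ℕ => ‖a n * (Real.exp (-(2 * Real.pi * n * y)) : ℂ)‖ := by
  simpa only [norm_mul, Complex.norm_real, Real.norm_eq_abs, Real.abs_exp] using h.summable y hy

theorem HasExpansion.apply_point {f : ℍ → ℂ} {a : ℕ → ℂ} (h : HasExpansion f a) (x : ℝ) {y : ℝ}
    (hy : 0 < y) : f (point x y) = ∑' n : ℕ, a n * (Real.exp (-(2 * Real.pi * n * y)) : ℂ) *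
      Complex.exp (2 * Real.pi * Complex.I * (n : ℤ) * x) := by
  rw [← (h.hasSum (point x y)).tsum_eq]
  refine tsum_congr fun n => ?_
  rw [exp_point n x hy, ← mul_assoc]

theorem HasExpansion.continuous_point {f : ℍ → ℂ} {a : ℕ → ℂ} (h : HasExpansion f a) {y : ℝ}
    (hy : 0 < y) : Continuous fun x => f (point x y) := by
  rw [funext fun x => h.apply_point x hy]
  exact continuous_tsum (fun n => by fun_prop) (h.summable_norm hy)
    fun n x => by rw [norm_mul _ (Complex.exp _), norm_exp_two_pi, mul_one]

theorem HasExpansion.hasSum_parseval {f g : ℍ → ℂ} {a b : ℕ → ℂ} (hf : HasExpansion f a)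
    (hg : HasExpansion g b) {y : ℝ} (hy : 0 < y) :
    HasSum (fun n : ℕ => conj (a n) * b n * (Real.exp (-(4 * Real.pi * n * y)) : ℂ))
      (∫ x in Set.Ioc (0 : ℝ) 1, conj (f (point x y)) * g (point x y)) := by
  have h := TZ.hasSum_parseval (hf.summable_norm hy) (hg.summable_norm hy)
  convert h using 1
  · funext n
    rw [map_mul, Complex.conj_ofReal, show -(4 * Real.pi * n * y) =
      -(2 * Real.pi * n * y) + -(2 * Real.pi * n * y) by ring, Real.exp_add]
    push_cast; ring
  · simp only [hf.apply_point _ hy, hg.apply_point _ hy]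

theorem HasExpansion.hasSum_norm_sq {f : ℍ → ℂ} {a : ℕ → ℂ} (hf : HasExpansion f a) {y : ℝ} (hy : 0 < y) :
    HasSum (fun n : ℕ => ‖a n‖ ^ 2 * Real.exp (-(4 * Real.pi * n * y)))
      (∫ x in Set.Ioc (0 : ℝ) 1, ‖f (point x y)‖ ^ 2) := by
  have h := hf.hasSum_parseval hf hy
  rw [← Complex.hasSum_ofReal]
  convert h using 1
  · funext n
    rw [mul_comm (conj (a n)), Complex.mul_conj, Complex.normSq_eq_norm_sq]
    push_cast; ring
  · rw [← integral_complex_ofReal]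
    refine integral_congr_ae (Filter.Eventually.of_forall fun x => ?_)
    simp only
    rw [mul_comm, Complex.mul_conj, Complex.normSq_eq_norm_sq]

theorem HasExpansion.lintegral_norm_sq {f : ℍ → ℂ} {a : ℕ → ℂ} (hf : HasExpansion f a) {y : ℝ} (hy : 0 < y) :
    ∫⁻ x in Set.Ioc (0 : ℝ) 1, ENNReal.ofReal (‖f (point x y)‖ ^ 2) =
      ∑' n : ℕ, ENNReal.ofReal (‖a n‖ ^ 2 * Real.exp (-(4 * Real.pi * n * y))) := by
  have h := hf.hasSum_norm_sq hy
  rw [← ENNReal.ofReal_tsum_of_nonneg (fun n => by positivity) h.summable, h.tsum_eq,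
    ofReal_integral_eq_lintegral_ofReal]
  · exact (((hf.continuous_point hy).norm.pow 2).integrableOn_Icc).mono_set Set.Ioc_subset_Icc_self
  · exact Filter.Eventually.of_forall fun x => by positivity

/-! ### Gamma integrals over the strip -/

theorem integrableOn_pow_mul_exp (k : ℕ) {c : ℝ} (hc : 0 < c) :
    IntegrableOn (fun y : ℝ => y ^ k * Real.exp (-(c * y))) (Set.Ioi 0) := by
  have h := integrableOn_rpow_mul_exp_neg_mul_rpow (p := 1) (s := k) (b := c)
    (by linarith [Nat.cast_nonneg (α := ℝ) k]) zero_lt_one hc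
  refine h.congr_fun (fun y hy => ?_) measurableSet_Ioi
  simp

theorem integral_pow_mul_exp (k : ℕ) {c : ℝ} (hc : 0 < c) :
    ∫ y in Set.Ioi (0 : ℝ), y ^ k * Real.exp (-(c * y)) = k.factorial / c ^ (k + 1) := by
  have h := Real.integral_rpow_mul_exp_neg_mul_Ioi (a := k + 1) (r := c) (by positivity) hc
  rw [Real.Gamma_nat_eq_factorial] at h
  simp only [add_sub_cancel_right, Real.rpow_natCast] at h
  rw [h, show ((k : ℝ) + 1) = ((k + 1 : ℕ) : ℝ) by push_cast; ring, Real.rpow_natCast]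
  rw [one_div, inv_pow]
  ring

theorem HasExpansion.setLIntegral_strip {f : ℍ → ℂ} {a : ℕ → ℂ} (hf : HasExpansion f a)
    (hm : Measurable f) (k : ℕ) :
    ∫⁻ z in strip, ENNReal.ofReal (‖f z‖ ^ 2 * z.im ^ k) ∂euclideanArea =
      ∑' n : ℕ, ENNReal.ofReal (‖a n‖ ^ 2 * (k.factorial / (4 * Real.pi * n) ^ (k + 1))) := by
  have hm2 : Measurable fun z : ℍ => ENNReal.ofReal (‖f z‖ ^ 2 * z.im ^ k) :=
    ((hm.norm.pow_const 2).mul (UpperHalfPlane.continuous_im.measurable.pow_const k)).ennreal_ofReal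
  rw [strip, setLIntegral_reIn measurableSet_Ioc hm2]
  have h1 : ∀ y ∈ Set.Ioi (0 : ℝ), ∫⁻ x in Set.Ioc (0 : ℝ) 1,
      ENNReal.ofReal (‖f (point x y)‖ ^ 2 * (point x y).im ^ k) =
      ∑' n : ℕ, ENNReal.ofReal (‖a n‖ ^ 2) *
        ENNReal.ofReal (y ^ k * Real.exp (-(4 * Real.pi * n * y))) := by
    intro y hy
    have hy : 0 < y := hy
    simp only [im_point _ hy]
    simp_rw [ENNReal.ofReal_mul' (pow_nonneg hy.le k)]
    rw [lintegral_mul_const' _ _ ENNReal.ofReal_ne_top, hf.lintegral_norm_sq hy,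
      ← ENNReal.tsum_mul_right]
    refine tsum_congr fun n => ?_
    rw [← ENNReal.ofReal_mul (by positivity), ← ENNReal.ofReal_mul (by positivity)]
    congr 1; ring
  rw [setLIntegral_congr_fun measurableSet_Ioi h1, lintegral_tsum fun n => by fun_prop]
  refine tsum_congr fun n => ?_
  rw [lintegral_const_mul' _ _ ENNReal.ofReal_ne_top]
  rcases Nat.eq_zero_or_pos n with rfl | hn
  · simp [hf.zero]
  · have hc : 0 < 4 * Real.pi * n := by positivity
    rw [← ofReal_integral_eq_lintegral_ofReal (integrableOn_pow_mul_exp k hc),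
      integral_pow_mul_exp k hc, ← ENNReal.ofReal_mul (by positivity)]
    exact (ae_restrict_iff' measurableSet_Ioi).mpr (Filter.Eventually.of_forall fun y hy => by
      have : 0 < y := hy
      simp only [Pi.zero_apply]; positivity)

/-- The Rankin–Selberg type integral of two Fourier expansions over the strip. -/
theorem HasExpansion.setIntegral_strip {f g : ℍ → ℂ} {a b : ℕ → ℂ} (hf : HasExpansion f a)
    (hg : HasExpansion g b) (k : ℕ)
    (hi : IntegrableOn (fun z : ℍ => (z.im : ℂ) ^ k * (conj (f z) * g z)) strip euclideanArea)
    (hs : Summable fun n : ℕ => ‖a n‖ * ‖b n‖ * (k.factorial / (4 * Real.pi * n) ^ (k + 1))) :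
    ∫ z in strip, (z.im : ℂ) ^ k * (conj (f z) * g z) ∂euclideanArea =
      ∑' n : ℕ, conj (a n) * b n * ((k.factorial / (4 * Real.pi * n) ^ (k + 1) : ℝ) : ℂ) := by
  rw [strip, setIntegral_reIn measurableSet_Ioc hi]
  have h1 : ∀ y ∈ Set.Ioi (0 : ℝ), ∫ x in Set.Ioc (0 : ℝ) 1,
      ((point x y).im : ℂ) ^ k * (conj (f (point x y)) * g (point x y)) =
      ∑' n : ℕ, conj (a n) * b n * ((y ^ k * Real.exp (-(4 * Real.pi * n * y)) : ℝ) : ℂ) := by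
    intro y hy
    have hy : 0 < y := hy
    simp only [im_point _ hy]
    rw [integral_const_mul, ← (hf.hasSum_parseval hg hy).tsum_eq, ← tsum_mul_left]
    refine tsum_congr fun n => ?_
    push_cast; ring
  rw [setIntegral_congr_fun measurableSet_Ioi h1]
  have hint : ∀ n : ℕ, IntegrableOn (fun y : ℝ => conj (a n) * b n *
      ((y ^ k * Real.exp (-(4 * Real.pi * n * y)) : ℝ) : ℂ)) (Set.Ioi 0) := by
    intro n
    rcases Nat.eq_zero_or_pos n with rfl | hn
    · simp [hf.zero]
    · exact (integrableOn_pow_mul_exp k (by positivity : 0 < 4 * Real.pi * n)).ofReal.const_mul _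
  have hval : ∀ n : ℕ, ‖a n‖ * ‖b n‖ * ∫ y in Set.Ioi (0 : ℝ), y ^ k * Real.exp (-(4 * Real.pi * n * y)) =
      ‖a n‖ * ‖b n‖ * (k.factorial / (4 * Real.pi * n) ^ (k + 1)) := by
    intro n
    rcases Nat.eq_zero_or_pos n with rfl | hn
    · simp [hf.zero]
    · rw [integral_pow_mul_exp k (by positivity : 0 < 4 * Real.pi * n)]
  rw [← integral_tsum_of_summable_integral_norm hint]
  · refine tsum_congr fun n => ?_
    rw [integral_const_mul, integral_complex_ofReal]
    rcases Nat.eq_zero_or_pos n with rfl | hn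
    · simp [hf.zero]
    · rw [integral_pow_mul_exp k (by positivity : 0 < 4 * Real.pi * n)]
  · refine hs.congr fun n => ?_
    rw [← hval, ← integral_const_mul]
    refine setIntegral_congr_fun measurableSet_Ioi fun y hy => ?_
    have hy : 0 < y := hy
    rw [norm_mul, norm_mul, Complex.norm_conj, Complex.norm_real, Real.norm_of_nonneg (by positivity)]

/-! ### The Fourier expansion of a quadratic differential at a cusp -/

/-- Cauchy's theorem for a rectangle of width one, whose vertical sides cancel by periodicity. -/
theorem intervalIntegral_eq_of_periodic {G : ℂ → ℂ} (hG : DifferentiableOn ℂ G {z | 0 < z.im})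
    (hper : ∀ w : ℂ, 0 < w.im → G (w + 1) = G w) {y₁ y₂ : ℝ} (h₁ : 0 < y₁) (h : y₁ ≤ y₂) :
    ∫ x in (0 : ℝ)..1, G (x + y₁ * Complex.I) = ∫ x in (0 : ℝ)..1, G (x + y₂ * Complex.I) := by
  have key := Complex.integral_boundary_rect_eq_zero_of_differentiableOn G (y₁ * Complex.I)
    (1 + y₂ * Complex.I) (hG.mono fun w hw => by
      have := hw.2
      simp only [Complex.mul_im, Complex.add_im, Complex.ofReal_re, Complex.I_im, mul_one,
        Complex.ofReal_im, Complex.I_re, mul_zero, add_zero, Complex.one_im, zero_add,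
        Set.mem_preimage, Set.uIcc_of_le h] at this
      exact h₁.trans_le this.1)
  simp only [Complex.mul_im, Complex.add_im, Complex.ofReal_re, Complex.I_im, mul_one,
    Complex.ofReal_im, Complex.I_re, mul_zero, add_zero, Complex.one_im, zero_add, Complex.mul_re,
    Complex.add_re, Complex.one_re, sub_self, Complex.ofReal_zero, Complex.ofReal_one] at key
  have hside : ∫ y in y₁..y₂, G (1 + y * Complex.I) = ∫ y in y₁..y₂, G (y * Complex.I) := by
    refine intervalIntegral.integral_congr fun y hy => ?_
    rw [Set.uIcc_of_le h] at hy
    rw [add_comm, hper]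
    simpa using h₁.trans_le hy.1
  rw [hside, add_sub_cancel_right] at key
  exact sub_eq_zero.mp key

theorem translation_one_smul_point (x : ℝ) {y : ℝ} (hy : 0 < y) :
    translation ((1 : ℤ) : ℝ) • point x y = point (x + 1) y := by
  ext
  rw [coe_translation_smul, coe_point _ hy, coe_point _ hy]
  push_cast; ring

namespace IsCuspidal

variable {f : ℍ → ℂ}

theorem periodic_point (h : IsCuspidal f) {y : ℝ} (hy : 0 < y) :
    Function.Periodic (fun x => f (point x y)) 1 := fun x => by
  simp only
  rw [← translation_one_smul_point x hy, h.periodic]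

theorem continuous_point (h : IsCuspidal f) {y : ℝ} (hy : 0 < y) :
    Continuous fun x => f (point x y) := by
  refine h.continuous.comp ?_
  rw [← isOpenEmbedding_coe.isEmbedding.continuous_iff.symm]
  · simp only [Function.comp_def, coe_point _ hy]
    fun_prop

/-- The `n`-th Fourier coefficient of `f` on the line at height `y`. -/
def coeffAt (f : ℍ → ℂ) (n : ℤ) (y : ℝ) : ℂ :=
  ∫ x in Set.Ioc (0 : ℝ) 1, Complex.exp (2 * Real.pi * Complex.I * (-n : ℤ) * x) * f (point x y)

/-- The `n`-th Fourier coefficient of `f`, normalized so as not to depend on the height. -/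
def coeff (f : ℍ → ℂ) (n : ℤ) : ℂ := coeffAt f n 1 * (Real.exp (2 * Real.pi * n) : ℂ)

theorem coeffAt_mul_exp (n : ℤ) (y : ℝ) : coeffAt f n y * (Real.exp (2 * Real.pi * n * y) : ℂ) =
    ∫ x in (0 : ℝ)..1, f (ofComplex (x + y * Complex.I)) *
      Complex.exp (-(2 * Real.pi * Complex.I * n * (x + y * Complex.I))) := by
  rw [intervalIntegral.integral_of_le zero_le_one, coeffAt, ← integral_mul_const]
  refine setIntegral_congr_fun measurableSet_Ioc fun x _ => ?_
  rw [mul_comm (Complex.exp _), mul_assoc, Complex.ofReal_exp, ← Complex.exp_add, point]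
  congr 2
  push_cast
  linear_combination (2 * Real.pi * n * y : ℂ) * Complex.I_mul_I

theorem coeffAt_eq (h : IsCuspidal f) (n : ℤ) {y : ℝ} (hy : 0 < y) :
    coeffAt f n y = coeff f n * (Real.exp (-(2 * Real.pi * n * y)) : ℂ) := by
  have hG : DifferentiableOn ℂ (fun w : ℂ => f (ofComplex w) *
      Complex.exp (-(2 * Real.pi * Complex.I * n * w))) {z | 0 < z.im} :=
    h.differentiableOn.mul (by fun_prop)
  have hper : ∀ w : ℂ, 0 < w.im → f (ofComplex (w + 1)) *
      Complex.exp (-(2 * Real.pi * Complex.I * n * (w + 1))) =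
      f (ofComplex w) * Complex.exp (-(2 * Real.pi * Complex.I * n * w)) := by
    intro w hw
    have h1 : Complex.exp (-(2 * Real.pi * Complex.I * n * (w + 1))) =
        Complex.exp (-(2 * Real.pi * Complex.I * n * w)) := by
      rw [show -(2 * Real.pi * Complex.I * n * (w + 1)) = -(2 * Real.pi * Complex.I * n * w) +
        (-n : ℤ) * (2 * Real.pi * Complex.I) by push_cast; ring, Complex.exp_add,
        Complex.exp_int_mul_two_pi_mul_I, mul_one]
    rw [h1, ← h.periodic 1 (ofComplex w)]
    congr 2
    ext
    rw [coe_translation_smul, ofComplex_apply_of_im_pos hw, ofComplex_apply_of_im_pos (by simpa using hw)]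
    simp
  have key : coeffAt f n y * (Real.exp (2 * Real.pi * n * y) : ℂ) =
      coeffAt f n 1 * (Real.exp (2 * Real.pi * n * 1) : ℂ) := by
    rw [coeffAt_mul_exp, coeffAt_mul_exp]
    rcases le_total y 1 with hy1 | hy1
    · exact intervalIntegral_eq_of_periodic hG hper hy hy1
    · exact (intervalIntegral_eq_of_periodic hG hper zero_lt_one hy1).symm
  rw [mul_one] at key
  rw [coeff, ← key, mul_assoc, ← Complex.ofReal_mul, ← Real.exp_add, add_neg_cancel, Real.exp_zero,
    Complex.ofReal_one, mul_one]

theorem norm_coeff_mul (h : IsCuspidal f) (n : ℤ) {y : ℝ} (hy : 0 < y) :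
    ‖coeff f n‖ * Real.exp (-(2 * Real.pi * n * y)) = ‖coeffAt f n y‖ := by
  rw [h.coeffAt_eq n hy, norm_mul, Complex.norm_real, Real.norm_of_nonneg (Real.exp_pos _).le]

theorem norm_coeffAt_le (f : ℍ → ℂ) (n : ℤ) (y : ℝ) :
    ‖coeffAt f n y‖ ≤ ∫ x in Set.Ioc (0 : ℝ) 1, ‖f (point x y)‖ := by
  refine (norm_integral_le_integral_norm _).trans_eq ?_
  refine setIntegral_congr_fun measurableSet_Ioc fun x _ => ?_
  rw [norm_mul, norm_exp_two_pi, one_mul]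

/-- The Cauchy–Schwarz inequality on the unit interval, obtained from the nonnegativity of the variance
of `|f|`. -/
theorem norm_coeffAt_sq_le (h : IsCuspidal f) (n : ℤ) {y : ℝ} (hy : 0 < y) :
    ‖coeffAt f n y‖ ^ 2 ≤ ∫ x in Set.Ioc (0 : ℝ) 1, ‖f (point x y)‖ ^ 2 := by
  have hc := (h.continuous_point hy).norm
  have hi : IntegrableOn (fun x => ‖f (point x y)‖) (Set.Ioc (0 : ℝ) 1) :=
    hc.integrableOn_Icc.mono_set Set.Ioc_subset_Icc_self
  have hi2 : IntegrableOn (fun x => ‖f (point x y)‖ ^ 2) (Set.Ioc (0 : ℝ) 1) :=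
    (hc.pow 2).integrableOn_Icc.mono_set Set.Ioc_subset_Icc_self
  set m := ∫ x in Set.Ioc (0 : ℝ) 1, ‖f (point x y)‖ with hm
  have h0 : 0 ≤ ∫ x in Set.Ioc (0 : ℝ) 1, (‖f (point x y)‖ - m) ^ 2 :=
    integral_nonneg fun x => sq_nonneg _
  have h1 : ∫ x in Set.Ioc (0 : ℝ) 1, (‖f (point x y)‖ - m) ^ 2 =
      (∫ x in Set.Ioc (0 : ℝ) 1, ‖f (point x y)‖ ^ 2) - m ^ 2 := by
    have e : ∀ x : ℝ, (‖f (point x y)‖ - m) ^ 2 =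
        ‖f (point x y)‖ ^ 2 - (2 * m * ‖f (point x y)‖ - m ^ 2) := fun x => by ring
    have hi3 : IntegrableOn (fun x => 2 * m * ‖f (point x y)‖) (Set.Ioc (0 : ℝ) 1) := hi.const_mul _
    have hi4 : IntegrableOn (fun _ : ℝ => m ^ 2) (Set.Ioc (0 : ℝ) 1) := integrableOn_const (by simp)
    have hi5 : IntegrableOn (fun x => 2 * m * ‖f (point x y)‖ - m ^ 2) (Set.Ioc (0 : ℝ) 1) :=
      hi3.sub hi4
    simp only [e]
    rw [integral_sub hi2 hi5, integral_sub hi3 hi4, integral_const_mul, ← hm]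
    simp
    ring
  calc ‖coeffAt f n y‖ ^ 2 ≤ m ^ 2 := by gcongr; exact norm_coeffAt_le f n y
    _ ≤ _ := by linarith

/-- The coefficients of nonpositive index vanish: otherwise `|f|² y²` would not be integrable over
the part of the strip above height one. -/
theorem coeff_eq_zero (h : IsCuspidal f) {n : ℤ} (hn : n ≤ 0) : coeff f n = 0 := by
  by_contra hne
  have him : Measurable fun z : ℍ => z.im := UpperHalfPlane.continuous_im.measurable
  have hm : Measurable fun z : ℍ => if z.im ≤ 1 then 0 else ENNReal.ofReal (‖f z‖ ^ 2 * z.im ^ 2) :=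
    measurable_const.ite (measurableSet_le him measurable_const)
      ((h.continuous.measurable.norm.pow_const 2).mul (him.pow_const 2)).ennreal_ofReal
  have hfin := h.lintegral_high
  rw [strip, setLIntegral_reIn measurableSet_Ioc hm] at hfin
  refine hfin.ne (top_unique ?_)
  have hc : ENNReal.ofReal (‖coeff f n‖ ^ 2) ≠ 0 := by
    simpa using hne
  calc (⊤ : ENNReal) = ∫⁻ y in Set.Ioi (1 : ℝ), ENNReal.ofReal (‖coeff f n‖ ^ 2) := by
        simp [ENNReal.mul_top, hne]
    _ ≤ ∫⁻ y in Set.Ioi (1 : ℝ), ∫⁻ x in Set.Ioc (0 : ℝ) 1, (if (point x y).im ≤ 1 then 0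
          else ENNReal.ofReal (‖f (point x y)‖ ^ 2 * (point x y).im ^ 2)) := by
        refine setLIntegral_mono' measurableSet_Ioi fun y hy => ?_
        have hy1 : 1 < y := hy
        have hy0 : 0 < y := zero_lt_one.trans hy1
        have hint : IntegrableOn (fun x => ‖f (point x y)‖ ^ 2) (Set.Ioc (0 : ℝ) 1) :=
          ((h.continuous_point hy0).norm.pow 2).integrableOn_Icc.mono_set Set.Ioc_subset_Icc_self
        calc ENNReal.ofReal (‖coeff f n‖ ^ 2)
            ≤ ENNReal.ofReal (∫ x in Set.Ioc (0 : ℝ) 1, ‖f (point x y)‖ ^ 2) := by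
              refine ENNReal.ofReal_le_ofReal (le_trans ?_ (h.norm_coeffAt_sq_le n hy0))
              rw [← h.norm_coeff_mul n hy0]
              gcongr
              refine le_mul_of_one_le_right (norm_nonneg _) (Real.one_le_exp ?_)
              have : (n : ℝ) ≤ 0 := by exact_mod_cast hn
              have : 2 * Real.pi * n * y ≤ 0 :=
                mul_nonpos_of_nonpos_of_nonneg
                  (mul_nonpos_of_nonneg_of_nonpos (by positivity) this) hy0.le
              linarith
          _ = ∫⁻ x in Set.Ioc (0 : ℝ) 1, ENNReal.ofReal (‖f (point x y)‖ ^ 2) :=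
              ofReal_integral_eq_lintegral_ofReal hint
                (Filter.Eventually.of_forall fun x => by positivity)
          _ ≤ _ := by
              refine lintegral_mono fun x => ?_
              rw [im_point x hy0, if_neg (not_le.mpr hy1)]
              refine ENNReal.ofReal_le_ofReal (le_mul_of_one_le_right (by positivity) ?_)
              exact one_le_pow₀ hy1.le
    _ ≤ _ := lintegral_mono_set (Set.Ioi_subset_Ioi zero_le_one)

theorem summable_coeff (h : IsCuspidal f) {y : ℝ} (hy : 0 < y) :
    Summable fun n : ℕ => ‖coeff f n‖ * Real.exp (-(2 * Real.pi * n * y)) := by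
  have hy2 : 0 < y / 2 := by positivity
  set M := ∫ x in Set.Ioc (0 : ℝ) 1, ‖f (point x (y / 2))‖
  have hgeo : Summable fun n : ℕ => M * Real.exp (-(Real.pi * y)) ^ n :=
    (summable_geometric_of_lt_one (Real.exp_pos _).le (by
      rw [Real.exp_lt_one_iff]; have := mul_pos Real.pi_pos hy; linarith)).mul_left M
  refine Summable.of_nonneg_of_le (fun n => by positivity) (fun n => ?_) hgeo
  have h1 := (h.norm_coeff_mul n hy2).le.trans (norm_coeffAt_le f n (y / 2))
  rw [← Real.exp_nat_mul]
  calc ‖coeff f n‖ * Real.exp (-(2 * Real.pi * n * y))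
      = (‖coeff f n‖ * Real.exp (-(2 * Real.pi * (n : ℤ) * (y / 2)))) * Real.exp (n * -(Real.pi * y)) := by
        rw [mul_assoc ‖_‖, ← Real.exp_add]
        congr 2
        push_cast; ring
    _ ≤ _ := by gcongr

theorem hasExpansion (h : IsCuspidal f) : HasExpansion f fun n => coeff f n := by
  refine ⟨h.coeff_eq_zero le_rfl, fun y hy => h.summable_coeff hy, fun z => ?_⟩
  obtain ⟨x, y, hy, rfl⟩ : ∃ x y : ℝ, 0 < y ∧ z = point x y := ⟨z.re, z.im, z.im_pos, (point_re_im z).symm⟩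
  let F : C(AddCircle (1 : ℝ), ℂ) :=
    ⟨(h.periodic_point hy).lift, continuous_coinduced_dom.mpr (h.continuous_point hy)⟩
  have hF : ∀ t : ℝ, F t = f (point t y) := fun t => Function.Periodic.lift_coe (h.periodic_point hy) t
  have hcoeff : ∀ n : ℤ, fourierCoeff F n = coeff f n * (Real.exp (-(2 * Real.pi * n * y)) : ℂ) := by
    intro n
    rw [fourierCoeff_eq_intervalIntegral _ n 0, ← h.coeffAt_eq n hy, coeffAt,
      zero_add, intervalIntegral.integral_of_le zero_le_one]
    simp only [fourier_coe_apply, hF, smul_eq_mul, div_one, one_smul, Complex.ofReal_one]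
  have hzero : ∀ n : ℤ, n ∉ Set.range ((↑) : ℕ → ℤ) → fourierCoeff F n = 0 := by
    intro n hn
    have : n ≤ 0 := by
      by_contra! hpos
      exact hn ⟨n.toNat, Int.toNat_of_nonneg hpos.le⟩
    rw [hcoeff, h.coeff_eq_zero this, zero_mul]
  have hs : Summable (fourierCoeff F) := by
    rw [← Function.Injective.summable_iff Nat.cast_injective hzero]
    refine Summable.of_norm ?_
    refine (h.summable_coeff hy).congr fun n => ?_
    simp only [Function.comp]
    rw [hcoeff, norm_mul, Complex.norm_real, Real.norm_of_nonneg (Real.exp_pos _).le]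
    simp
  have hsum := has_pointwise_sum_fourier_series_of_summable hs (x : AddCircle (1 : ℝ))
  rw [hF, ← Function.Injective.hasSum_iff Nat.cast_injective (fun n hn => by
    rw [hzero n hn, zero_smul])] at hsum
  convert hsum using 1
  funext n
  simp only [Function.comp]
  rw [hcoeff, fourier_coe_apply, exp_point n x hy, smul_eq_mul, ← mul_assoc]
  simp

/-- The bound on the Fourier coefficients which makes all the integrals over the strip converge. -/
theorem summable_sq_div (h : IsCuspidal f) : Summable fun n : ℕ => ‖coeff f n‖ ^ 2 / (n : ℝ) ^ 5 := by
  have him : Measurable fun z : ℍ => z.im := UpperHalfPlane.continuous_im.measurable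
  have hm : Measurable fun z : ℍ => if z.im ≤ 1 then ENNReal.ofReal (‖f z‖ ^ 2 * z.im ^ 4) else 0 :=
    Measurable.ite (measurableSet_le him measurable_const)
      ((h.continuous.measurable.norm.pow_const 2).mul (him.pow_const 4)).ennreal_ofReal measurable_const
  have hfin := h.lintegral_low
  rw [strip, setLIntegral_reIn measurableSet_Ioc hm] at hfin
  have hlow : ∑' n : ℕ, ENNReal.ofReal (Real.exp (-(4 * Real.pi)) / 32 * (‖coeff f n‖ ^ 2 / (n : ℝ) ^ 5)) ≠ ⊤ := by
    refine ne_top_of_le_ne_top hfin.ne ?_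
    calc ∑' n : ℕ, ENNReal.ofReal (Real.exp (-(4 * Real.pi)) / 32 * (‖coeff f n‖ ^ 2 / (n : ℝ) ^ 5))
        ≤ ∑' n : ℕ, ∫⁻ y in Set.Ioc (0 : ℝ) 1,
            ENNReal.ofReal (‖coeff f n‖ ^ 2 * Real.exp (-(4 * Real.pi * n * y)) * y ^ 4) := by
          refine ENNReal.tsum_le_tsum fun n => ?_
          rcases Nat.eq_zero_or_pos n with rfl | hn
          · simp
          have hn0 : (0 : ℝ) < n := by exact_mod_cast hn
          have hn1 : (1 : ℝ) ≤ n := by exact_mod_cast hn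
          -- only the heights between `1 / 2n` and `1 / n` are used
          calc ENNReal.ofReal (Real.exp (-(4 * Real.pi)) / 32 * (‖coeff f n‖ ^ 2 / (n : ℝ) ^ 5))
              = ∫⁻ y in Set.Ioc (1 / (2 * n) : ℝ) (1 / n), ENNReal.ofReal
                  (‖coeff f n‖ ^ 2 * Real.exp (-(4 * Real.pi)) * (1 / (2 * n)) ^ 4) := by
                rw [setLIntegral_const, Real.volume_Ioc, ← ENNReal.ofReal_mul (by positivity)]
                congr 1
                field_simp
                ring
            _ ≤ ∫⁻ y in Set.Ioc (1 / (2 * n) : ℝ) (1 / n), ENNReal.ofReal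
                  (‖coeff f n‖ ^ 2 * Real.exp (-(4 * Real.pi * n * y)) * y ^ 4) := by
                refine setLIntegral_mono' measurableSet_Ioc fun y hy => ?_
                refine ENNReal.ofReal_le_ofReal ?_
                have h1 := hy.1
                have h2 := hy.2
                have h3 : 0 < 1 / (2 * n : ℝ) := by positivity
                have h4 : n * y ≤ 1 := by rw [le_div_iff₀ hn0] at h2; linarith
                gcongr ?_ * Real.exp (-?_) * ?_ ^ 4
                nlinarith [Real.pi_pos]
            _ ≤ _ := by
                refine lintegral_mono_set fun y hy => ⟨lt_trans (by positivity) hy.1, hy.2.trans ?_⟩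
                rw [div_le_one hn0]
                exact hn1
      _ = ∫⁻ y in Set.Ioc (0 : ℝ) 1, ∑' n : ℕ,
            ENNReal.ofReal (‖coeff f n‖ ^ 2 * Real.exp (-(4 * Real.pi * n * y)) * y ^ 4) :=
          (lintegral_tsum fun n => by fun_prop).symm
      _ = ∫⁻ y in Set.Ioc (0 : ℝ) 1, ∫⁻ x in Set.Ioc (0 : ℝ) 1, (if (point x y).im ≤ 1 then
            ENNReal.ofReal (‖f (point x y)‖ ^ 2 * (point x y).im ^ 4) else 0) := by
          refine setLIntegral_congr_fun measurableSet_Ioc fun y hy => ?_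
          simp only [im_point _ hy.1, if_pos hy.2]
          simp_rw [ENNReal.ofReal_mul' (pow_nonneg hy.1.le 4)]
          rw [lintegral_mul_const' _ _ ENNReal.ofReal_ne_top, h.hasExpansion.lintegral_norm_sq hy.1,
            ENNReal.tsum_mul_right]
      _ ≤ _ := lintegral_mono_set fun y hy => hy.1
  have h1 := ENNReal.summable_toReal hlow
  have h2 : Summable fun n : ℕ => Real.exp (-(4 * Real.pi)) / 32 * (‖coeff f n‖ ^ 2 / (n : ℝ) ^ 5) :=
    h1.congr fun n => ENNReal.toReal_ofReal (by positivity)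
  exact (summable_mul_left_iff (by positivity)).mp h2

end IsCuspidal

/-! ### Periodization of the kernel -/

theorem add_int_ne_zero {τ : ℂ} (hτ : 0 < τ.im) (m : ℤ) : τ + m ≠ 0 := by
  intro h
  have := congrArg Complex.im h
  simp at this
  exact hτ.ne' this

theorem add_int_add_int_ne_zero {τ : ℂ} (hτ : 0 < τ.im) (m l : ℤ) : τ + m + l ≠ 0 := by
  have := add_int_ne_zero hτ (m + l)
  push_cast at this
  rwa [← add_assoc] at this

theorem summable_inv_norm_pow (τ : ℂ) {k : ℕ} (hk : 2 ≤ k) :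
    Summable fun m : ℤ => (‖τ + m‖ ^ k)⁻¹ := by
  have := (EisensteinSeries.linear_right_summable τ 1 (k := k) (by exact_mod_cast hk)).norm
  refine this.congr fun m => ?_
  simp [norm_inv, norm_pow]

theorem summable_inv_sub_inv {τ : ℂ} (hτ : 0 < τ.im) (l : ℤ) :
    Summable fun m : ℤ => 1 / (τ + m) - 1 / (τ + m + l) := by
  have h1 := summable_inv_norm_pow τ le_rfl
  have h2 : Summable fun m : ℤ => (‖τ + m + l‖ ^ 2)⁻¹ := by
    refine ((Equiv.addRight l).summable_iff.mpr h1).congr fun m => ?_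
    simp [add_assoc]
  refine Summable.of_norm_bounded ((h1.add h2).mul_left ‖(l : ℂ)‖) fun m => ?_
  have hm := add_int_ne_zero hτ m
  have hml := add_int_add_int_ne_zero hτ m l
  have e : 1 / (τ + m) - 1 / (τ + m + l) = l * ((τ + m)⁻¹ * (τ + m + l)⁻¹) := by
    field_simp; ring
  rw [e, norm_mul, norm_mul, norm_inv, norm_inv, ← inv_pow, ← inv_pow]
  gcongr
  nlinarith [sq_nonneg (‖τ + m‖⁻¹ - ‖τ + m + l‖⁻¹), sq_nonneg ‖τ + m‖⁻¹, sq_nonneg ‖τ + m + l‖⁻¹]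

theorem hasSum_inv_sub_inv_one {τ : ℂ} (hτ : 0 < τ.im) :
    HasSum (fun m : ℤ => 1 / (τ + m) - 1 / (τ + (m + 1 : ℤ))) 0 := by
  have hs : Summable fun m : ℤ => 1 / (τ + m) - 1 / (τ + (m + 1 : ℤ)) := by
    refine (summable_inv_sub_inv hτ 1).congr fun m => ?_
    push_cast; ring_nf
  have hlim : Filter.Tendsto (fun n : ℕ => 1 / (τ + (n : ℤ))) Filter.atTop (nhds 0) := by
    have := (summable_inv_norm_pow τ le_rfl).comp_injective (Nat.cast_injective (R := ℤ))
    have h0 := this.tendsto_atTop_zero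
    rw [tendsto_zero_iff_norm_tendsto_zero]
    have h1 := h0.sqrt
    simpa [Real.sqrt_inv, Real.sqrt_sq] using h1
  have hlim' : Filter.Tendsto (fun n : ℕ => 1 / (τ + (-n : ℤ))) Filter.atTop (nhds 0) := by
    have := (summable_inv_norm_pow τ le_rfl).comp_injective
      (i := fun n : ℕ => (-n : ℤ)) (fun a b h => by simpa using h)
    have h0 := this.tendsto_atTop_zero
    rw [tendsto_zero_iff_norm_tendsto_zero]
    have h1 := h0.sqrt
    simpa [Real.sqrt_inv, Real.sqrt_sq] using h1
  have hpos : HasSum (fun n : ℕ => 1 / (τ + (n : ℤ)) - 1 / (τ + ((n : ℤ) + 1 : ℤ))) (1 / τ) := by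
    have hsn : Summable fun n : ℕ => 1 / (τ + (n : ℤ)) - 1 / (τ + ((n : ℤ) + 1 : ℤ)) :=
      hs.comp_injective (Nat.cast_injective (R := ℤ))
    rw [hsn.hasSum_iff_tendsto_nat]
    have : ∀ N : ℕ, ∑ i ∈ Finset.range N, (1 / (τ + (i : ℤ)) - 1 / (τ + ((i : ℤ) + 1 : ℤ))) =
        1 / τ - 1 / (τ + (N : ℤ)) := fun N => by
      have := Finset.sum_range_sub' (fun i : ℕ => 1 / (τ + (i : ℤ))) N
      simpa using this
    rw [funext this]
    simpa using hlim.const_sub (1 / τ)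
  have hneg : HasSum (fun n : ℕ => 1 / (τ + (-(n + 1) : ℤ)) - 1 / (τ + (-(n + 1) + 1 : ℤ)))
      (-(1 / τ)) := by
    have hsn : Summable fun n : ℕ => 1 / (τ + (-(n + 1) : ℤ)) - 1 / (τ + (-(n + 1) + 1 : ℤ)) :=
      hs.comp_injective (i := fun n : ℕ => (-(n + 1) : ℤ)) (fun a b h => by simpa using h)
    rw [hsn.hasSum_iff_tendsto_nat]
    have : ∀ N : ℕ, ∑ i ∈ Finset.range N, (1 / (τ + (-(i + 1) : ℤ)) - 1 / (τ + (-(i + 1) + 1 : ℤ))) =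
        1 / (τ + (-N : ℤ)) - 1 / τ := fun N => by
      have := Finset.sum_range_sub (fun i : ℕ => 1 / (τ + (-i : ℤ))) N
      simpa using this
    rw [funext this]
    simpa using hlim'.sub_const (1 / τ)
  simpa using HasSum.of_nat_of_neg_add_one (f := fun m : ℤ => 1 / (τ + m) - 1 / (τ + (m + 1 : ℤ)))
    hpos hneg

theorem tsum_inv_sub_inv {τ : ℂ} (hτ : 0 < τ.im) (l : ℤ) :
    ∑' m : ℤ, (1 / (τ + m) - 1 / (τ + m + l)) = 0 := by
  have key : ∀ k : ℕ, ∑' m : ℤ, (1 / (τ + m) - 1 / (τ + m + (k : ℤ))) = 0 := by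
    intro k
    induction k with
    | zero => simp
    | succ k ih =>
      have h1 := (Equiv.addRight (k : ℤ)).hasSum_iff.mpr (hasSum_inv_sub_inv_one hτ)
      have h2 := (summable_inv_sub_inv hτ k).hasSum.add h1
      rw [ih, add_zero] at h2
      rw [← h2.tsum_eq]
      refine tsum_congr fun m => ?_
      simp only [Function.comp, Equiv.coe_addRight]
      push_cast; ring
  rcases Int.eq_nat_or_neg l with ⟨k, rfl | rfl⟩
  · exact key k
  · have h := (Equiv.addRight (-(k : ℤ))).tsum_eq fun m : ℤ => (1 / (τ + m) - 1 / (τ + m + (k : ℤ)))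
    rw [key] at h
    rw [← neg_eq_zero, ← tsum_neg, ← h]
    refine tsum_congr fun m => ?_
    simp only [Equiv.coe_addRight]
    push_cast; ring_nf

/-- The periodization of `1 / (τ² (τ + l)²)`: after expansion in partial fractions the simple poles
telescope to zero, and the double poles are evaluated by the Lipschitz formula. -/
theorem tsum_kernel {τ : ℂ} (hτ : 0 < τ.im) {l : ℤ} (hl : l ≠ 0) :
    ∑' m : ℤ, 1 / ((τ + m) ^ 2 * (τ + m + l) ^ 2) =
      -(8 * Real.pi ^ 2 / l ^ 2) * ∑' n : ℕ, (n : ℂ) * Complex.exp (2 * Real.pi * Complex.I * n * τ) := by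
  have hl0 : (l : ℂ) ≠ 0 := by exact_mod_cast hl
  have hlip := EisensteinSeries.qExpansion_identity (k := 1) le_rfl ⟨τ, hτ⟩
  simp only [Nat.reduceAdd, Nat.factorial_one, Nat.cast_one, div_one, pow_one] at hlip
  have hs : Summable fun m : ℤ => 1 / (τ + m) ^ 2 := by
    have := summable_inv_norm_pow τ le_rfl
    refine Summable.of_norm (this.congr fun m => by simp)
  have hsl : Summable fun m : ℤ => 1 / (τ + m + l) ^ 2 := by
    refine ((Equiv.addRight l).summable_iff.mpr hs).congr fun m => ?_
    simp [add_assoc]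
  have hshift : ∑' m : ℤ, 1 / (τ + m + l) ^ 2 = ∑' m : ℤ, 1 / (τ + m) ^ 2 := by
    rw [← (Equiv.addRight l).tsum_eq fun m : ℤ => 1 / (τ + m) ^ 2]
    simp [add_assoc]
  have e : ∀ m : ℤ, 1 / ((τ + m) ^ 2 * (τ + m + l) ^ 2) = 1 / (l : ℂ) ^ 2 *
      ((1 / (τ + m) ^ 2 + 1 / (τ + m + l) ^ 2) - 2 / (l : ℂ) * (1 / (τ + m) - 1 / (τ + m + l))) := by
    intro m
    have hm := add_int_ne_zero hτ m
    have hml := add_int_add_int_ne_zero hτ m l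
    field_simp
    ring
  rw [tsum_congr e, tsum_mul_left, ((hs.add hsl)).tsum_sub ((summable_inv_sub_inv hτ l).mul_left _),
    hs.tsum_add hsl, tsum_mul_left, tsum_inv_sub_inv hτ, hshift, hlip]
  have e2 : ∀ n : ℕ, (n : ℂ) * Complex.exp (2 * Real.pi * Complex.I * τ) ^ n =
      (n : ℂ) * Complex.exp (2 * Real.pi * Complex.I * n * τ) := fun n => by
    rw [← Complex.exp_nat_mul]
    congr 2; ring
  rw [tsum_congr e2]
  have hI : (-2 * Real.pi * Complex.I : ℂ) ^ 2 = -(4 * Real.pi ^ 2) := by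
    rw [mul_pow, Complex.I_sq]; ring
  rw [hI]
  generalize ∑' n : ℕ, (n : ℂ) * Complex.exp (2 * Real.pi * Complex.I * n * τ) = S
  field_simp
  ring

/-! ### Integration of an expansion against the kernel along horizontal lines -/

theorem norm_sub_real_sq (τ : ℂ) (u : ℝ) : ‖τ - u‖ ^ 2 = (u - τ.re) ^ 2 + τ.im ^ 2 := by
  rw [← Complex.normSq_eq_norm_sq, Complex.normSq_apply]
  simp
  ring

theorem integrable_inv_norm_sub_real {τ : ℂ} (hτ : 0 < τ.im) :
    Integrable fun u : ℝ => (‖τ - u‖ ^ 4)⁻¹ := by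
  have h1 : Integrable fun u : ℝ => (τ.im ^ 4)⁻¹ * (1 + ((u - τ.re) / τ.im) ^ 2)⁻¹ :=
    ((integrable_inv_one_add_sq.comp_div hτ.ne').comp_sub_right τ.re).const_mul _
  refine h1.mono' ?_ (Filter.Eventually.of_forall fun u => ?_)
  · have : Measurable fun u : ℝ => (‖τ - u‖ ^ 4)⁻¹ := by fun_prop
    exact this.aestronglyMeasurable
  · rw [Real.norm_of_nonneg (by positivity), ← mul_inv, show 4 = 2 * 2 from rfl, pow_mul ‖_‖,
      norm_sub_real_sq]
    refine inv_anti₀ (by positivity) ?_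
    have : τ.im ^ (2 * 2) * (1 + ((u - τ.re) / τ.im) ^ 2) =
        τ.im ^ 2 * ((u - τ.re) ^ 2 + τ.im ^ 2) := by
      field_simp; ring
    rw [this, pow_two (_ + _)]
    gcongr
    nlinarith [sq_nonneg (u - τ.re)]

theorem norm_kernel_le {a b : ℂ} : ‖1 / (a ^ 2 * b ^ 2)‖ ≤ (‖a‖ ^ 4)⁻¹ + (‖b‖ ^ 4)⁻¹ := by
  rw [norm_div, norm_one, norm_mul, norm_pow, norm_pow, one_div, mul_inv]
  have ha : (‖a‖ ^ 4)⁻¹ = (‖a‖ ^ 2)⁻¹ ^ 2 := by rw [← inv_pow, ← inv_pow, ← pow_mul]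
  have hb : (‖b‖ ^ 4)⁻¹ = (‖b‖ ^ 2)⁻¹ ^ 2 := by rw [← inv_pow, ← inv_pow, ← pow_mul]
  rw [ha, hb]
  nlinarith [sq_nonneg ((‖a‖ ^ 2)⁻¹ - (‖b‖ ^ 2)⁻¹), sq_nonneg (‖a‖ ^ 2)⁻¹, sq_nonneg (‖b‖ ^ 2)⁻¹]

theorem integrable_kernel_real {τ : ℂ} (hτ : 0 < τ.im) (l : ℤ) :
    Integrable fun u : ℝ => 1 / ((τ - u) ^ 2 * (τ + l - u) ^ 2) := by
  have hτl : 0 < (τ + l).im := by simpa using hτ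
  refine ((integrable_inv_norm_sub_real hτ).add (integrable_inv_norm_sub_real hτl)).mono' ?_
    (Filter.Eventually.of_forall fun u => norm_kernel_le)
  have : Measurable fun u : ℝ => 1 / ((τ - u) ^ 2 * (τ + l - u) ^ 2) := by fun_prop
  exact this.aestronglyMeasurable

theorem summable_nat_mul_norm_exp {τ : ℂ} (hτ : 0 < τ.im) :
    Summable fun n : ℕ => ‖(n : ℂ) * Complex.exp (2 * Real.pi * Complex.I * n * τ)‖ := by
  have h := Real.summable_pow_mul_exp_neg_nat_mul 1 (r := 2 * Real.pi * τ.im) (by positivity)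
  refine h.congr fun n => ?_
  rw [norm_mul, Complex.norm_natCast, pow_one, Complex.norm_exp]
  congr 2
  simp
  ring

theorem HasExpansion.periodic_point {f : ℍ → ℂ} {b : ℕ → ℂ} (hf : HasExpansion f b) {v : ℝ}
    (hv : 0 < v) (u : ℝ) (m : ℤ) : f (point (u + m) v) = f (point u v) := by
  rw [hf.apply_point _ hv, hf.apply_point _ hv]
  refine tsum_congr fun n => ?_
  congr 1
  rw [show (2 * Real.pi * Complex.I * (n : ℤ) * ((u + m : ℝ) : ℂ) : ℂ) =
    2 * Real.pi * Complex.I * (n : ℤ) * u + (n * m : ℤ) * (2 * Real.pi * Complex.I) by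
      push_cast; ring, Complex.exp_add, Complex.exp_int_mul_two_pi_mul_I, mul_one]

/-- Folding the line onto the unit interval replaces the kernel by its periodization, whose Fourier
series is known; the integral is then evaluated by Parseval's identity. -/
theorem HasExpansion.integral_mul_kernel {f : ℍ → ℂ} {b : ℕ → ℂ} (hf : HasExpansion f b) {v : ℝ}
    (hv : 0 < v) {τ : ℂ} (hτ : 0 < τ.im) {l : ℤ} (hl : l ≠ 0) :
    ∫ u : ℝ, f (point u v) * (1 / ((τ - u) ^ 2 * (τ + l - u) ^ 2)) =
      -(8 * Real.pi ^ 2 / l ^ 2) * ∑' n : ℕ, b n * (Real.exp (-(2 * Real.pi * n * v)) : ℂ) *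
        (n * Complex.exp (2 * Real.pi * Complex.I * n * τ)) := by
  set k : ℝ → ℂ := fun u => 1 / ((τ - u) ^ 2 * (τ + l - u) ^ 2) with hk
  have hbound : ∀ u : ℝ, ‖f (point u v)‖ ≤
      ∑' n, ‖b n * (Real.exp (-(2 * Real.pi * n * v)) : ℂ)‖ := fun u => by
    rw [hf.apply_point _ hv]
    exact tsum_of_norm_bounded (hf.summable_norm hv).hasSum fun n => by
      rw [norm_mul _ (Complex.exp _), norm_exp_two_pi, mul_one]
  have hint : Integrable fun u : ℝ => f (point u v) * k u :=
    (integrable_kernel_real hτ l).bdd_mul (hf.continuous_point hv).aestronglyMeasurable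
      (Filter.Eventually.of_forall hbound)
  have h1 := hint.hasSum_intervalIntegral_comp_add_int
  have h2 := hint.norm.hasSum_intervalIntegral_comp_add_int
  simp only [intervalIntegral.integral_of_le zero_le_one] at h1 h2
  have hi : ∀ m : ℤ, IntegrableOn (fun u : ℝ => f (point (u + m) v) * k (u + m)) (Set.Ioc 0 1) :=
    fun m => (hint.comp_add_right (m : ℝ)).integrableOn
  rw [← h1.tsum_eq, integral_tsum_of_summable_integral_norm hi h2.summable]
  -- the periodized kernel, as the conjugate of an absolutely convergent Fourier series in `u`
  have hker : ∀ u : ℝ, ∑' m : ℤ, f (point (u + m) v) * k (u + m) =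
      -(8 * Real.pi ^ 2 / l ^ 2) * (conj (∑' n : ℕ,
        conj (n * Complex.exp (2 * Real.pi * Complex.I * n * τ)) *
          Complex.exp (2 * Real.pi * Complex.I * (n : ℤ) * u)) * f (point u v)) := by
    intro u
    simp only [hf.periodic_point hv]
    rw [tsum_mul_left]
    have hτu : 0 < (τ - u).im := by simpa using hτ
    have h3 : ∑' m : ℤ, k (u + m) = ∑' m : ℤ, 1 / ((τ - u + m) ^ 2 * (τ - u + m + l) ^ 2) := by
      rw [← (Equiv.neg ℤ).tsum_eq]
      refine tsum_congr fun m => ?_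
      simp only [hk, Equiv.neg_apply]
      push_cast; ring_nf
    rw [h3, tsum_kernel hτu hl, Complex.conj_tsum]
    have h4 : ∀ n : ℕ, conj (conj (n * Complex.exp (2 * Real.pi * Complex.I * n * τ)) *
        Complex.exp (2 * Real.pi * Complex.I * (n : ℤ) * u)) =
        (n : ℂ) * Complex.exp (2 * Real.pi * Complex.I * n * (τ - u)) := by
      intro n
      rw [map_mul, Complex.conj_conj, ← Complex.exp_conj, mul_assoc, ← Complex.exp_add]
      congr 2
      simp [map_ofNat]
      ring
    rw [tsum_congr h4]
    ring
  simp only [hker]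
  rw [integral_const_mul]
  congr 1
  simp only [hf.apply_point _ hv]
  rw [← (TZ.hasSum_parseval (a := fun n : ℕ => conj (n * Complex.exp (2 * Real.pi * Complex.I * n * τ)))
    (by simpa only [Complex.norm_conj] using summable_nat_mul_norm_exp hτ)
    (hf.summable_norm hv)).tsum_eq]
  refine tsum_congr fun n => ?_
  rw [Complex.conj_conj, mul_comm]

/-! ### The inner integral for a translation -/

/-- For `w` in the strip, `|z + k - conj w|` is bounded below by a multiple of `|z + k|` which does not
depend on `w`, nor on `k`. -/
theorem norm_add_int_le (z : ℍ) {w : ℍ} (hw : w ∈ strip) (k : ℤ) :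
    ‖(z : ℂ) + k‖ ≤ (1 + 1 / z.im) * ‖(z : ℂ) + k - conj (w : ℂ)‖ := by
  have hz := z.im_pos
  have him : z.im ≤ ‖(z : ℂ) + k - conj (w : ℂ)‖ := by
    refine le_trans ?_ (Complex.abs_im_le_norm _)
    simp only [Complex.sub_im, Complex.add_im, Complex.intCast_im, Complex.conj_im, coe_im]
    rw [abs_of_pos] <;> linarith [w.im_pos]
  have hre : ‖(z : ℂ) + k - w.re‖ ≤ ‖(z : ℂ) + k - conj (w : ℂ)‖ := by
    rw [Complex.norm_eq_sqrt_sq_add_sq, Complex.norm_eq_sqrt_sq_add_sq]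
    refine Real.sqrt_le_sqrt ?_
    simp only [Complex.sub_re, Complex.add_re, Complex.intCast_re, Complex.ofReal_re, Complex.sub_im,
      Complex.add_im, Complex.intCast_im, Complex.conj_im, Complex.conj_re, Complex.ofReal_im, coe_im,
      coe_re]
    nlinarith [w.im_pos]
  have hw1 : ‖(w.re : ℂ)‖ ≤ 1 := by
    have h1 : 0 < w.re := hw.1
    rw [Complex.norm_real, Real.norm_of_nonneg h1.le]
    exact hw.2
  calc ‖(z : ℂ) + k‖ = ‖((z : ℂ) + k - w.re) + w.re‖ := by rw [sub_add_cancel]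
    _ ≤ ‖(z : ℂ) + k - conj (w : ℂ)‖ + 1 := (norm_add_le _ _).trans (add_le_add hre hw1)
    _ ≤ ‖(z : ℂ) + k - conj (w : ℂ)‖ + 1 / z.im * ‖(z : ℂ) + k - conj (w : ℂ)‖ := by
        gcongr
        rw [one_div, ← div_eq_inv_mul, le_div_iff₀ hz, one_mul]
        exact him
    _ = _ := by ring

/-- Integrals over the upper half plane of a periodic function against `|z - conj w|⁻⁴` are bounded
by integrals over the strip. -/
theorem exists_lintegral_mul_le (z : ℍ) : ∃ C : ENNReal, C ≠ ⊤ ∧ ∀ f : ℍ → ENNReal, Measurable f →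
    (∀ (n : ℤ) (w : ℍ), f (translation n • w) = f w) →
    ∫⁻ w, f w * ENNReal.ofReal ((‖(z : ℂ) - conj (w : ℂ)‖ ^ 4)⁻¹) ≤ C * ∫⁻ w in strip, f w := by
  have hsum : Summable fun k : ℤ => (1 + 1 / z.im) ^ 4 * (‖(z : ℂ) + k‖ ^ 4)⁻¹ :=
    (summable_inv_norm_pow (z : ℂ) (by norm_num : 2 ≤ 4)).mul_left _
  refine ⟨∑' k : ℤ, ENNReal.ofReal ((1 + 1 / z.im) ^ 4 * (‖(z : ℂ) + k‖ ^ 4)⁻¹), ?_, ?_⟩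
  · have hz := z.im_pos
    rw [← ENNReal.ofReal_tsum_of_nonneg (fun k => by positivity) hsum]
    exact ENNReal.ofReal_ne_top
  intro f hf hT
  set A : ℍ → ENNReal := fun w => ENNReal.ofReal ((‖(z : ℂ) - conj (w : ℂ)‖ ^ 4)⁻¹) with hA
  have hAm : Measurable A := (((measurable_norm_sub_conj z).pow_const 4).inv).ennreal_ofReal
  have hone : ∀ w : ℍ, ∑' k : ℤ, strip.indicator (fun _ => (1 : ENNReal)) (translation (k : ℝ) • w) = 1 := by
    intro w
    have := tsum_indicator_strip (ε := 1) (Or.inl rfl) (f := fun _ : ℍ => (1 : ENNReal))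
      (fun _ _ => rfl) w
    simpa using this
  have hm : ∀ k : ℤ, Measurable fun w : ℍ =>
      strip.indicator (fun _ => (1 : ENNReal)) w * (f w * A (translation ((-k : ℤ) : ℝ) • w)) := fun k =>
    (measurable_const.indicator measurableSet_strip).mul (hf.mul (hAm.comp (measurable_const_smul _)))
  have hback : ∀ (k : ℤ) (w : ℍ), translation ((-k : ℤ) : ℝ) • translation (k : ℝ) • w = w := by
    intro k w
    rw [smul_smul, ← translation_add]
    push_cast
    rw [neg_add_cancel, translation_zero, one_smul]
  calc ∫⁻ w, f w * A w
      = ∫⁻ w, ∑' k : ℤ, strip.indicator (fun _ => (1 : ENNReal)) (translation (k : ℝ) • w) *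
          (f (translation (k : ℝ) • w) * A (translation ((-k : ℤ) : ℝ) • translation (k : ℝ) • w)) := by
        refine lintegral_congr fun w => ?_
        simp only [hT, hback]
        rw [ENNReal.tsum_mul_right, hone, one_mul]
    _ = ∑' k : ℤ, ∫⁻ w, strip.indicator (fun _ => (1 : ENNReal)) w *
          (f w * A (translation ((-k : ℤ) : ℝ) • w)) := by
        have hm2 : ∀ k : ℤ, AEMeasurable (fun w : ℍ =>
            strip.indicator (fun _ => (1 : ENNReal)) (translation (k : ℝ) • w) *
            (f (translation (k : ℝ) • w) * A (translation ((-k : ℤ) : ℝ) • translation (k : ℝ) • w)))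
            volume := fun k =>
          ((hm k).comp (measurable_const_smul (translation (k : ℝ)))).aemeasurable
        rw [lintegral_tsum hm2]
        refine tsum_congr fun k => ?_
        exact (measurePreserving_smul (translation (k : ℝ)) (volume : Measure ℍ)).lintegral_comp (hm k)
    _ = ∫⁻ w, ∑' k : ℤ, strip.indicator (fun _ => (1 : ENNReal)) w *
          (f w * A (translation ((-k : ℤ) : ℝ) • w)) :=
        (lintegral_tsum fun k => (hm k).aemeasurable).symm
    _ ≤ ∫⁻ w, strip.indicator (fun w => (∑' k : ℤ,
          ENNReal.ofReal ((1 + 1 / z.im) ^ 4 * (‖(z : ℂ) + k‖ ^ 4)⁻¹)) * f w) w := by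
        refine lintegral_mono fun w => ?_
        by_cases hw : w ∈ strip
        · simp only [Set.indicator_of_mem hw, one_mul]
          rw [ENNReal.tsum_mul_left, mul_comm]
          gcongr with k
          refine ENNReal.ofReal_le_ofReal ?_
          have h1 : (z : ℂ) - conj ((translation ((-k : ℤ) : ℝ) • w : ℍ) : ℂ) =
              (z : ℂ) + k - conj (w : ℂ) := by
            rw [coe_translation_smul]
            simp
            ring
          rw [h1]
          have h2 := norm_add_int_le z hw k
          have h3 : 0 < ‖(z : ℂ) + k‖ := norm_pos_iff.mpr (add_int_ne_zero z.im_pos k)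
          have hz := z.im_pos
          have h4 : 0 < ‖(z : ℂ) + k - conj (w : ℂ)‖ :=
            pos_of_mul_pos_right (h3.trans_le h2) (by positivity)
          rw [← div_eq_mul_inv, ← div_pow, ← inv_pow]
          gcongr
          rw [inv_eq_one_div, div_le_div_iff₀ h4 h3, one_mul]
          exact h2
        · simp [Set.indicator_of_notMem hw]
    _ = _ := by
        rw [lintegral_indicator measurableSet_strip, lintegral_const_mul _ hf]

namespace IsCuspidal

variable {ψ : ℍ → ℂ}

theorem summable_gamma (h : IsCuspidal ψ) :
    Summable fun n : ℕ => ‖coeff ψ n‖ ^ 2 * ((4 : ℕ).factorial / (4 * Real.pi * n) ^ (4 + 1)) := by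
  refine (h.summable_sq_div.mul_left (24 / (4 * Real.pi) ^ 5)).congr fun n => ?_
  rw [show (4 : ℕ).factorial = 24 from rfl, mul_pow _ (n : ℝ)]
  push_cast
  ring

theorem setLIntegral_lt_top (h : IsCuspidal ψ) :
    ∫⁻ z in strip, ENNReal.ofReal (‖ψ z‖ ^ 2 * z.im ^ 4) ∂euclideanArea < ⊤ := by
  rw [h.hasExpansion.setLIntegral_strip h.continuous.measurable,
    ← ENNReal.ofReal_tsum_of_nonneg (fun n => by positivity) h.summable_gamma]
  exact ENNReal.ofReal_lt_top

theorem measurable_weight {f : ℍ → ℂ} (hf : Measurable f) (k : ℕ) :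
    Measurable fun z : ℍ => ‖f z‖ ^ 2 * z.im ^ k :=
  (hf.norm.pow_const 2).mul (UpperHalfPlane.continuous_im.measurable.pow_const k)

theorem integrable_mul_inv_norm (h : IsCuspidal ψ) (z : ℍ) :
    Integrable (fun w : ℍ => ‖ψ w‖ ^ 2 * w.im ^ 4 * (‖(z : ℂ) - conj (w : ℂ)‖ ^ 4)⁻¹)
      euclideanArea := by
  obtain ⟨C, hC, hle⟩ := exists_lintegral_mul_le z
  have hm := (measurable_weight h.continuous.measurable 4).ennreal_ofReal
  have hA : Measurable fun w : ℍ => (‖(z : ℂ) - conj (w : ℂ)‖ ^ 4)⁻¹ :=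
    ((measurable_norm_sub_conj z).pow_const 4).inv
  have him : Measurable fun w : ℍ => ENNReal.ofReal (w.im ^ 2) :=
    (UpperHalfPlane.continuous_im.measurable.pow_const 2).ennreal_ofReal
  refine ⟨((measurable_weight h.continuous.measurable 4).mul hA).aestronglyMeasurable, ?_⟩
  rw [hasFiniteIntegral_iff_ofReal (Filter.Eventually.of_forall fun w => by positivity)]
  have h1 := hle _ (hm.mul him) (fun n w => by
    simp only [Pi.mul_apply, translation_smul, vadd_im]
    simp only [← translation_smul, h.periodic])
  simp only [Pi.mul_apply] at h1
  rw [setLIntegral_volume strip hm] at h1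
  have h2 := setLIntegral_volume Set.univ (hm.mul hA.ennreal_ofReal)
  simp only [Measure.restrict_univ, Pi.mul_apply] at h2
  have h3 : ∫⁻ w : ℍ, ENNReal.ofReal (‖ψ w‖ ^ 2 * w.im ^ 4 * (‖(z : ℂ) - conj (w : ℂ)‖ ^ 4)⁻¹)
      ∂euclideanArea = ∫⁻ w : ℍ, ENNReal.ofReal (‖ψ w‖ ^ 2 * w.im ^ 4) * ENNReal.ofReal (w.im ^ 2) *
        ENNReal.ofReal ((‖(z : ℂ) - conj (w : ℂ)‖ ^ 4)⁻¹) := by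
    simp_rw [mul_right_comm _ (ENNReal.ofReal (_ ^ 2)) _]
    rw [h2]
    refine lintegral_congr fun w => ?_
    rw [ENNReal.ofReal_mul (by positivity)]
  rw [h3]
  exact h1.trans_lt (ENNReal.mul_lt_top hC.lt_top h.setLIntegral_lt_top)

/-- The integrand of the inner integral attached to the translation by `l`. -/
def innerKernel (ψ : ℍ → ℂ) (l : ℤ) (z w : ℍ) : ℂ :=
  (w.im : ℂ) ^ 2 * ψ w * (1 / (((z : ℂ) - conj (w : ℂ)) ^ 2 * ((z : ℂ) + l - conj (w : ℂ)) ^ 2))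

theorem integrable_innerKernel (h : IsCuspidal ψ) (l : ℤ) (z : ℍ) :
    Integrable (innerKernel ψ l z) euclideanArea := by
  have hcoe : (z : ℂ) + l = ((translation (l : ℝ) • z : ℍ) : ℂ) := by
    rw [coe_translation_smul]; simp
  have h1 := h.integrable_mul_inv_norm z
  have h2 := h.integrable_mul_inv_norm (translation (l : ℝ) • z)
  have h3 := integrable_inv_norm_sub_conj z
  have h4 := integrable_inv_norm_sub_conj (translation (l : ℝ) • z)
  rw [← hcoe] at h2 h4
  have hconj : Measurable fun w : ℍ => conj (w : ℂ) :=
    Complex.continuous_conj.measurable.comp measurable_coe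
  have him : Measurable fun w : ℍ => (w.im : ℂ) :=
    Complex.measurable_ofReal.comp UpperHalfPlane.continuous_im.measurable
  have hm : Measurable (innerKernel ψ l z) :=
    ((him.pow_const 2).mul h.continuous.measurable).mul (measurable_const.div
      (((hconj.const_sub _).pow_const 2).mul ((hconj.const_sub _).pow_const 2)))
  refine ((h1.add h3).add (h2.add h4)).mono' hm.aestronglyMeasurable
    (Filter.Eventually.of_forall fun w => ?_)
  rw [innerKernel, norm_mul]
  refine (mul_le_mul_of_nonneg_left norm_kernel_le (norm_nonneg _)).trans ?_
  rw [norm_mul, norm_pow, Complex.norm_real, Real.norm_of_nonneg w.im_pos.le]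
  simp only [Pi.add_apply]
  have hx : w.im ^ 2 * ‖ψ w‖ ≤ ‖ψ w‖ ^ 2 * w.im ^ 4 + 1 := by
    nlinarith [sq_nonneg (w.im ^ 2 * ‖ψ w‖ - 1), sq_nonneg (w.im ^ 2 * ‖ψ w‖)]
  have hA : 0 ≤ (‖(z : ℂ) - conj (w : ℂ)‖ ^ 4)⁻¹ := by positivity
  have hB : 0 ≤ (‖(z : ℂ) + l - conj (w : ℂ)‖ ^ 4)⁻¹ := by positivity
  have h5 := mul_le_mul_of_nonneg_right hx hA
  have h6 := mul_le_mul_of_nonneg_right hx hB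
  linarith

/-- The twofold primitive `∑ bₙ n⁻² e^{2πinz}` of `ψ = ∑ bₙ e^{2πinz}`, up to a constant factor.
The term `n = 0` vanishes, its coefficient being a quotient by zero. -/
def primitive (ψ : ℍ → ℂ) (z : ℍ) : ℂ :=
  ∑' n : ℕ, coeff ψ n / (n : ℂ) ^ 2 * Complex.exp (2 * Real.pi * Complex.I * n * z)

theorem norm_coeff_div_le (ψ : ℍ → ℂ) (n : ℕ) : ‖coeff ψ n / (n : ℂ) ^ 2‖ ≤ ‖coeff ψ n‖ := by
  rcases Nat.eq_zero_or_pos n with rfl | hn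
  · simp
  · rw [norm_div, norm_pow, Complex.norm_natCast]
    refine div_le_self (norm_nonneg _) (one_le_pow₀ ?_)
    exact_mod_cast hn

theorem hasExpansion_primitive (h : IsCuspidal ψ) :
    HasExpansion (primitive ψ) fun n => coeff ψ n / (n : ℂ) ^ 2 := by
  have hs : ∀ y : ℝ, 0 < y → Summable fun n : ℕ =>
      ‖coeff ψ n / (n : ℂ) ^ 2‖ * Real.exp (-(2 * Real.pi * n * y)) := fun y hy =>
    Summable.of_nonneg_of_le (fun n => by positivity)
      (fun n => mul_le_mul_of_nonneg_right (norm_coeff_div_le ψ n) (Real.exp_pos _).le)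
      (h.summable_coeff hy)
  refine ⟨by simp, hs, fun z => Summable.hasSum (Summable.of_norm ((hs z.im z.im_pos).congr fun n => ?_))⟩
  rw [norm_mul, Complex.norm_exp]
  congr 2
  simp

/-- The inner integral for a translation: after integration along horizontal lines, the `n`-th term is a
Gamma integral in the height, which contributes the factor `2 / (4πn)³`. -/
theorem integral_innerKernel (h : IsCuspidal ψ) {l : ℤ} (hl : l ≠ 0) (z : ℍ) :
    ∫ w, innerKernel ψ l z w ∂euclideanArea =
      -(1 / (4 * Real.pi * (l : ℂ) ^ 2)) * primitive ψ z := by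
  rw [integral_euclideanArea (h.integrable_innerKernel l z)]
  have hE : ∀ (n : ℕ) (v : ℝ), Complex.exp (2 * Real.pi * Complex.I * n * ((z : ℂ) + v * Complex.I)) =
      Complex.exp (2 * Real.pi * Complex.I * n * z) * (Real.exp (-(2 * Real.pi * n * v)) : ℂ) := by
    intro n v
    rw [Complex.ofReal_exp, ← Complex.exp_add]
    congr 1
    push_cast
    linear_combination (2 * Real.pi * n * v : ℂ) * Complex.I_mul_I
  have hline : ∀ v ∈ Set.Ioi (0 : ℝ), ∫ u : ℝ, innerKernel ψ l z (point u v) =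
      -(8 * Real.pi ^ 2 / (l : ℂ) ^ 2) * ∑' n : ℕ, coeff ψ n * n *
        Complex.exp (2 * Real.pi * Complex.I * n * z) *
          ((v ^ 2 * Real.exp (-(4 * Real.pi * n * v)) : ℝ) : ℂ) := by
    intro v hv
    have hv : 0 < v := hv
    have hτ : 0 < ((z : ℂ) + v * Complex.I).im := by
      simpa using add_pos z.im_pos hv
    have h1 : ∀ u : ℝ, innerKernel ψ l z (point u v) = (v : ℂ) ^ 2 * (ψ (point u v) *
        (1 / (((z : ℂ) + v * Complex.I - u) ^ 2 * ((z : ℂ) + v * Complex.I + l - u) ^ 2))) := by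
      intro u
      have hc : conj (point u v : ℂ) = u - v * Complex.I := by
        rw [coe_point _ hv]; simp [sub_eq_add_neg]
      rw [innerKernel, im_point _ hv, hc, mul_assoc]
      congr 4 <;> ring
    simp only [h1]
    rw [integral_const_mul, h.hasExpansion.integral_mul_kernel hv hτ hl, mul_left_comm,
      ← tsum_mul_left]
    congr 1
    refine tsum_congr fun n => ?_
    rw [hE, show -(4 * Real.pi * n * v) = -(2 * Real.pi * n * v) + -(2 * Real.pi * n * v) by ring,
      Real.exp_add]
    push_cast; ring
  rw [setIntegral_congr_fun measurableSet_Ioi hline, integral_const_mul]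
  have hval : ∀ n : ℕ, 0 < n → ∫ v in Set.Ioi (0 : ℝ), v ^ 2 * Real.exp (-(4 * Real.pi * n * v)) =
      2 / (4 * Real.pi * n) ^ 3 := by
    intro n hn
    rw [integral_pow_mul_exp 2 (by positivity : 0 < 4 * Real.pi * n)]
    norm_num
  have hint : ∀ n : ℕ, IntegrableOn (fun v : ℝ => coeff ψ n * n *
        Complex.exp (2 * Real.pi * Complex.I * n * z) *
          ((v ^ 2 * Real.exp (-(4 * Real.pi * n * v)) : ℝ) : ℂ)) (Set.Ioi 0) := by
    intro n
    rcases Nat.eq_zero_or_pos n with rfl | hn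
    · simp
    · exact (integrableOn_pow_mul_exp 2 (by positivity : 0 < 4 * Real.pi * n)).ofReal.const_mul _
  rw [← integral_tsum_of_summable_integral_norm hint]
  · rw [primitive, ← tsum_mul_left, ← tsum_mul_left]
    refine tsum_congr fun n => ?_
    rw [integral_const_mul, integral_complex_ofReal]
    rcases Nat.eq_zero_or_pos n with rfl | hn
    · simp
    · rw [hval n hn]
      have hn0 : (n : ℂ) ≠ 0 := by exact_mod_cast hn.ne'
      have hl0 : (l : ℂ) ≠ 0 := by exact_mod_cast hl
      have hpi : (Real.pi : ℂ) ≠ 0 := by exact_mod_cast Real.pi_ne_zero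
      push_cast
      generalize Complex.exp (2 * Real.pi * Complex.I * n * z) = E
      field_simp
      ring
  · have hs := (h.summable_coeff z.im_pos).mul_left (2 / (4 * Real.pi) ^ 3)
    refine Summable.of_nonneg_of_le (fun n => integral_nonneg fun v => norm_nonneg _) (fun n => ?_) hs
    rcases Nat.eq_zero_or_pos n with rfl | hn
    · simp
      positivity
    have hnorm : ∫ v in Set.Ioi (0 : ℝ), ‖coeff ψ n * n *
        Complex.exp (2 * Real.pi * Complex.I * n * z) *
          ((v ^ 2 * Real.exp (-(4 * Real.pi * n * v)) : ℝ) : ℂ)‖ =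
        ‖coeff ψ n * n * Complex.exp (2 * Real.pi * Complex.I * n * z)‖ * (2 / (4 * Real.pi * n) ^ 3) := by
      rw [← hval n hn, ← integral_const_mul]
      refine setIntegral_congr_fun measurableSet_Ioi fun v hv => ?_
      have hv : 0 < v := hv
      rw [norm_mul, Complex.norm_real, Real.norm_of_nonneg (by positivity)]
    rw [hnorm, norm_mul, norm_mul, Complex.norm_natCast, Complex.norm_exp]
    have hre : (2 * Real.pi * Complex.I * n * z : ℂ).re = -(2 * Real.pi * n * z.im) := by simp
    rw [hre]
    have hn1 : (1 : ℝ) ≤ n := by exact_mod_cast hn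
    have hpi := Real.pi_pos
    calc ‖coeff ψ n‖ * n * Real.exp (-(2 * Real.pi * n * z.im)) * (2 / (4 * Real.pi * n) ^ 3)
        = 2 / (4 * Real.pi) ^ 3 * (‖coeff ψ n‖ * Real.exp (-(2 * Real.pi * n * z.im))) * (1 / n ^ 2) := by
          field_simp
      _ ≤ 2 / (4 * Real.pi) ^ 3 * (‖coeff ψ n‖ * Real.exp (-(2 * Real.pi * n * z.im))) * 1 := by
          gcongr
          rw [div_le_one (by positivity)]
          exact one_le_pow₀ hn1
      _ = _ := mul_one _

end IsCuspidal

/-! ### The integrals over the strip -/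

theorem integrableOn_strip_mul {f g : ℍ → ℂ} (hf : Measurable f) (hg : Measurable g) {p q k : ℕ}
    (hpq : p + q = 2 * k)
    (hfi : ∫⁻ z in strip, ENNReal.ofReal (‖f z‖ ^ 2 * z.im ^ p) ∂euclideanArea < ⊤)
    (hgi : ∫⁻ z in strip, ENNReal.ofReal (‖g z‖ ^ 2 * z.im ^ q) ∂euclideanArea < ⊤) :
    IntegrableOn (fun z : ℍ => (z.im : ℂ) ^ k * (conj (f z) * g z)) strip euclideanArea := by
  have hint : ∀ {h : ℍ → ℂ} {j : ℕ}, Measurable h →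
      ∫⁻ z in strip, ENNReal.ofReal (‖h z‖ ^ 2 * z.im ^ j) ∂euclideanArea < ⊤ →
      IntegrableOn (fun z : ℍ => ‖h z‖ ^ 2 * z.im ^ j) strip euclideanArea := fun hm hi =>
    ⟨(IsCuspidal.measurable_weight hm _).aestronglyMeasurable,
      (hasFiniteIntegral_iff_ofReal (Filter.Eventually.of_forall fun z => by positivity)).mpr hi⟩
  have him : Measurable fun w : ℍ => (w.im : ℂ) :=
    Complex.measurable_ofReal.comp UpperHalfPlane.continuous_im.measurable
  have hm : Measurable fun z : ℍ => (z.im : ℂ) ^ k * (conj (f z) * g z) :=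
    (him.pow_const k).mul ((Complex.continuous_conj.measurable.comp hf).mul hg)
  refine ((hint hf hfi).add (hint hg hgi)).mono' hm.aestronglyMeasurable
    (Filter.Eventually.of_forall fun z => ?_)
  have hy := z.im_pos
  have h1 : ‖(z.im : ℂ) ^ k * (conj (f z) * g z)‖ = z.im ^ k * (‖f z‖ * ‖g z‖) := by
    rw [norm_mul, norm_mul, norm_pow, Complex.norm_real, Real.norm_of_nonneg hy.le, Complex.norm_conj]
  have h2 : z.im ^ p * z.im ^ q = (z.im ^ k) ^ 2 := by rw [← pow_add, hpq, mul_comm, pow_mul]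
  rw [h1]
  simp only [Pi.add_apply]
  refine (sq_le_sq₀ (by positivity) (by positivity)).mp ?_
  have h3 : (z.im ^ k * (‖f z‖ * ‖g z‖)) ^ 2 = (‖f z‖ ^ 2 * z.im ^ p) * (‖g z‖ ^ 2 * z.im ^ q) := by
    rw [mul_pow, ← h2]; ring
  rw [h3]
  have h4 : 0 ≤ ‖f z‖ ^ 2 * z.im ^ p := by positivity
  have h5 : 0 ≤ ‖g z‖ ^ 2 * z.im ^ q := by positivity
  nlinarith

namespace IsCuspidal

variable {f ψ : ℍ → ℂ}

theorem measurable_primitive (ψ : ℍ → ℂ) : Measurable (primitive ψ) := by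
  have h : Continuous fun z : ℍ => (z : ℂ) := UpperHalfPlane.continuous_coe
  have : ∀ n : ℕ, Measurable fun z : ℍ =>
      coeff ψ n / (n : ℂ) ^ 2 * Complex.exp (2 * Real.pi * Complex.I * n * z) := fun n =>
    Continuous.measurable (by fun_prop)
  exact Measurable.tsum this

theorem primitive_translation_smul (ψ : ℍ → ℂ) (m : ℤ) (z : ℍ) :
    primitive ψ (translation m • z) = primitive ψ z := by
  refine tsum_congr fun n => ?_
  rw [coe_translation_smul]
  congr 1
  have h := Complex.exp_int_mul_two_pi_mul_I (n * m)
  rw [mul_add, Complex.exp_add]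
  convert mul_one _
  rw [← h]
  congr 1
  push_cast; ring

theorem summable_mul_div (hf : IsCuspidal f) (hψ : IsCuspidal ψ) :
    Summable fun n : ℕ => ‖coeff f n‖ * ‖coeff ψ n‖ / (n : ℝ) ^ 5 := by
  refine Summable.of_nonneg_of_le (fun n => by positivity) (fun n => ?_)
    (hf.summable_sq_div.add hψ.summable_sq_div)
  rw [← add_div]
  gcongr
  nlinarith [sq_nonneg (‖coeff f n‖ - ‖coeff ψ n‖), sq_nonneg ‖coeff f n‖, sq_nonneg ‖coeff ψ n‖]

theorem setLIntegral_primitive_lt_top (h : IsCuspidal ψ) :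
    ∫⁻ z in strip, ENNReal.ofReal (‖primitive ψ z‖ ^ 2 * z.im ^ 0) ∂euclideanArea < ⊤ := by
  rw [h.hasExpansion_primitive.setLIntegral_strip (measurable_primitive ψ),
    ← ENNReal.ofReal_tsum_of_nonneg (fun n => by positivity)]
  · exact ENNReal.ofReal_lt_top
  refine (h.summable_sq_div.mul_left (1 / (4 * Real.pi))).congr fun n => ?_
  rw [norm_div, norm_pow, Complex.norm_natCast]
  rcases Nat.eq_zero_or_pos n with rfl | hn
  · simp
  · simp only [Nat.factorial_zero, Nat.cast_one, zero_add, pow_one]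
    field_simp

theorem integrableOn_mul (hf : IsCuspidal f) (hψ : IsCuspidal ψ) :
    IntegrableOn (fun z : ℍ => (z.im : ℂ) ^ 4 * (conj (f z) * ψ z)) strip euclideanArea :=
  integrableOn_strip_mul hf.continuous.measurable hψ.continuous.measurable (by norm_num)
    hf.setLIntegral_lt_top hψ.setLIntegral_lt_top

theorem integrableOn_mul_primitive (hf : IsCuspidal f) (hψ : IsCuspidal ψ) :
    IntegrableOn (fun z : ℍ => (z.im : ℂ) ^ 2 * (conj (f z) * primitive ψ z)) strip euclideanArea :=
  integrableOn_strip_mul hf.continuous.measurable (measurable_primitive ψ) (by norm_num)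
    hf.setLIntegral_lt_top hψ.setLIntegral_primitive_lt_top

/-- Replacing `ψ` by its twofold primitive and dropping the weight `(Im z)²` changes the integral
over the strip by a constant factor only: both sides are multiples of `∑ conj aₙ bₙ n⁻⁵`. -/
theorem setIntegral_mul_eq (hf : IsCuspidal f) (hψ : IsCuspidal ψ) :
    ∫ z in strip, (z.im : ℂ) ^ 4 * (conj (f z) * ψ z) ∂euclideanArea =
      3 / (4 * (Real.pi : ℂ) ^ 2) *
        ∫ z in strip, (z.im : ℂ) ^ 2 * (conj (f z) * primitive ψ z) ∂euclideanArea := by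
  have hs := hf.summable_mul_div hψ
  rw [hf.hasExpansion.setIntegral_strip hψ.hasExpansion 4 (hf.integrableOn_mul hψ),
    hf.hasExpansion.setIntegral_strip hψ.hasExpansion_primitive 2 (hf.integrableOn_mul_primitive hψ),
    ← tsum_mul_left]
  · refine tsum_congr fun n => ?_
    rcases Nat.eq_zero_or_pos n with rfl | hn
    · simp
    · have hn0 : (n : ℂ) ≠ 0 := by exact_mod_cast hn.ne'
      have hpi : (Real.pi : ℂ) ≠ 0 := by exact_mod_cast Real.pi_ne_zero
      rw [show (4 : ℕ).factorial = 24 from rfl, show (2 : ℕ).factorial = 2 from rfl]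
      push_cast
      field_simp
      ring
  · refine (hs.mul_left (2 / (4 * Real.pi) ^ 3)).congr fun n => ?_
    rw [norm_div, norm_pow, Complex.norm_natCast]
    rcases Nat.eq_zero_or_pos n with rfl | hn
    · simp
    · rw [show (2 : ℕ).factorial = 2 from rfl]
      push_cast
      field_simp
  · refine (hs.mul_left (24 / (4 * Real.pi) ^ 5)).congr fun n => ?_
    rw [show (4 : ℕ).factorial = 24 from rfl]
    push_cast
    rcases Nat.eq_zero_or_pos n with rfl | hn
    · simp
    · field_simp

end IsCuspidal

/-! ### The kernel of a conjugate of a translation -/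

/-- The function `y² conj(φ(z))` attached to `φ`. -/
def beltrami (φ : ℍ → ℂ) (z : ℍ) : ℂ := (z.im : ℂ) ^ 2 * conj (φ z)

theorem im_smul_pow_four (B : PSL(2, ℝ)) (z : ℍ) : ((B • z).im : ℂ) ^ 4 =
    (mobDeriv B z) ^ 2 * conj (mobDeriv B z) ^ 2 * (z.im : ℂ) ^ 4 := by
  rw [im_smul, ← mul_pow, Complex.mul_conj, Complex.normSq_eq_norm_sq]
  push_cast
  ring

/-- In the coordinate in which `γ` is a translation, the kernel splits into a function of `ζ` and the
kernel of the translation. -/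
theorem kernel_smul_smul (φ ψ : ℍ → ℂ) {γ B : PSL(2, ℝ)} {m : ℤ}
    (hγ : γ * B = B * translation m) (ζ ω : ℍ) :
    ((B • ζ).im : ℂ) ^ 2 * (((B • ω).im : ℂ) ^ 2 *
        kernel (beltrami φ) (beltrami ψ) γ (B • ζ) (B • ω)) =
      (ζ.im : ℂ) ^ 4 * conj (pullback φ B ζ) *
        ((ω.im : ℂ) ^ 2 * IsCuspidal.innerKernel (pullback ψ B) m ζ ω) := by
  have hp := mobDeriv_ne_zero B ζ
  have hq := mobDeriv_ne_zero B (translation m • ζ)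
  have hr := mobDeriv_ne_zero B ω
  have hr' : conj (mobDeriv B ω) ≠ 0 := (map_ne_zero _).mpr hr
  have hder : mobDeriv γ (B • ζ) = mobDeriv B (translation m • ζ) / mobDeriv B ζ := by
    rw [eq_div_iff hp, ← mobDeriv_mul, hγ, mobDeriv_mul, mobDeriv_translation, mul_one]
  have hpt : γ • B • ζ = B • translation m • ζ := by rw [smul_smul, hγ, mul_smul]
  have h1 := sub_conj_ne_zero ζ ω
  have h2 := sub_conj_ne_zero (translation m • ζ) ω
  have e1 := smul_sub_conj_smul_sq B ζ ω
  have e2 := smul_sub_conj_smul_sq B (translation m • ζ) ω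
  have i1 := im_smul_pow_four B ζ
  have i2 := im_smul_pow_four B ω
  rw [coe_translation_smul, Complex.ofReal_intCast] at h2 e2
  rw [kernel, hder, hpt, e1, e2, IsCuspidal.innerKernel, pullback, pullback, beltrami, beltrami]
  simp only [map_mul, map_pow, Complex.conj_ofReal, Complex.conj_conj]
  calc _ = ((B • ζ).im : ℂ) ^ 4 * (((B • ω).im : ℂ) ^ 4) * (conj (φ (B • ζ)) * ψ (B • ω) /
      (((ζ : ℂ) - conj (ω : ℂ)) ^ 2 * (mobDeriv B ζ * conj (mobDeriv B ω)) *
      (((ζ : ℂ) + m - conj (ω : ℂ)) ^ 2 * (mobDeriv B (translation m • ζ) * conj (mobDeriv B ω)))) *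
        (mobDeriv B (translation m • ζ) / mobDeriv B ζ)) := by ring
    _ = _ := by
      rw [i1, i2]
      field_simp

/-- The outer integrand, against the hyperbolic area and up to a factor depending on the translation,
in the coordinate of the cusp. -/
def outerIntegrand (f ψ : ℍ → ℂ) (ζ : ℍ) : ℂ :=
  (ζ.im : ℂ) ^ 2 * ((ζ.im : ℂ) ^ 2 * (conj (f ζ) * IsCuspidal.primitive ψ ζ))

section Kernel

variable {φ ψ : ℍ → ℂ} {γ B : PSL(2, ℝ)} {m : ℤ}

theorem im_sq_mul_kernel (φ ψ : ℍ → ℂ) (hγ : γ * B = B * translation m) (z ω : ℍ) :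
    ((B • ω).im : ℂ) ^ 2 * kernel (beltrami φ) (beltrami ψ) γ z (B • ω) =
      ((z.im : ℂ) ^ 2)⁻¹ * (((B⁻¹ • z).im : ℂ) ^ 4 * conj (pullback φ B (B⁻¹ • z))) *
        ((ω.im : ℂ) ^ 2 * IsCuspidal.innerKernel (pullback ψ B) m (B⁻¹ • z) ω) := by
  have h := kernel_smul_smul φ ψ hγ (B⁻¹ • z) ω
  have hz : (z.im : ℂ) ≠ 0 := by exact_mod_cast z.im_ne_zero
  rw [smul_inv_smul] at h
  rw [mul_assoc, ← h, inv_mul_cancel_left₀ (pow_ne_zero 2 hz)]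

theorem integrable_kernel (φ : ℍ → ℂ) (hψ : IsCuspidal (pullback ψ B))
    (hγ : γ * B = B * translation m) (z : ℍ) :
    Integrable (fun w => kernel (beltrami φ) (beltrami ψ) γ z w) euclideanArea := by
  have h := (integrableOn_volume_iff Set.univ).mpr
    (integrableOn_univ.mpr (hψ.integrable_innerKernel m (B⁻¹ • z)))
  rw [integrableOn_univ] at h
  refine integrableOn_univ.mp ((integrableOn_volume_iff Set.univ).mp (integrableOn_univ.mpr ?_))
  rw [← (measurePreserving_smul B (volume : Measure ℍ)).integrable_comp_emb
    (measurableEmbedding_const_smul B)]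
  refine (h.const_mul (((z.im : ℂ) ^ 2)⁻¹ *
    (((B⁻¹ • z).im : ℂ) ^ 4 * conj (pullback φ B (B⁻¹ • z))))).congr
    (Filter.Eventually.of_forall fun ω => ?_)
  exact (im_sq_mul_kernel φ ψ hγ z ω).symm

theorem im_sq_mul_integral_kernel (φ : ℍ → ℂ) (hψ : IsCuspidal (pullback ψ B))
    (hγ : γ * B = B * translation m) (hm : m ≠ 0) (z : ℍ) :
    (z.im : ℂ) ^ 2 * ∫ w, kernel (beltrami φ) (beltrami ψ) γ z w ∂euclideanArea =
      -(1 / (4 * Real.pi * (m : ℂ) ^ 2)) *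
        outerIntegrand (pullback φ B) (pullback ψ B) (B⁻¹ • z) := by
  have hz : (z.im : ℂ) ≠ 0 := by exact_mod_cast z.im_ne_zero
  rw [← integral_volume, ← (measurePreserving_smul B (volume : Measure ℍ)).integral_comp
    (measurableEmbedding_const_smul B)]
  simp only [im_sq_mul_kernel φ ψ hγ z]
  rw [integral_const_mul, integral_volume, hψ.integral_innerKernel hm, outerIntegrand]
  field_simp

end Kernel

/-! ### Both sides as integrals over the strip -/

theorem hasSum_int_ne_zero_inv_sq :
    HasSum (fun l : {l : ℤ // l ≠ 0} => 1 / ((l : ℤ) : ℝ) ^ 2) (Real.pi ^ 2 / 3) := by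
  have h : HasSum (fun l : ℤ => 1 / (l : ℝ) ^ 2) (Real.pi ^ 2 / 3) := by
    have h1 := HasSum.of_nat_of_neg (f := fun l : ℤ => 1 / (l : ℝ) ^ 2)
      (by simpa using hasSum_zeta_two) (by simpa using hasSum_zeta_two)
    have h2 : Real.pi ^ 2 / 6 + Real.pi ^ 2 / 6 - 1 / ((0 : ℤ) : ℝ) ^ 2 = Real.pi ^ 2 / 3 := by
      rw [Int.cast_zero, zero_pow two_ne_zero, div_zero]
      ring
    rwa [h2] at h1
  refine (hasSum_subtype_iff_of_support_subset (s := {l : ℤ | l ≠ 0}) ?_).mpr h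
  rintro l hl rfl
  simp at hl

section Cusp

variable {Γ : Subgroup PSL(2, ℝ)} {κ : Γ} {σ : PSL(2, ℝ)} {F : Set ℍ} {φ ψ : ℍ → ℂ}

theorem measurable_outerIntegrand {f : ℍ → ℂ} (hf : Measurable f) (ψ : ℍ → ℂ) :
    Measurable (outerIntegrand f ψ) := by
  have him : Measurable fun w : ℍ => (w.im : ℂ) :=
    Complex.measurable_ofReal.comp UpperHalfPlane.continuous_im.measurable
  exact (him.pow_const 2).mul ((him.pow_const 2).mul
    ((Complex.continuous_conj.measurable.comp hf).mul (IsCuspidal.measurable_primitive ψ)))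

theorem im_translation_smul (t : ℝ) (z : ℍ) : (translation t • z).im = z.im := by
  rw [translation_smul, vadd_im]

theorem outerIntegrand_translation_smul {f : ℍ → ℂ} (hf : IsCuspidal f) (ψ : ℍ → ℂ) (n : ℤ) (z : ℍ) :
    outerIntegrand f ψ (translation n • z) = outerIntegrand f ψ z := by
  simp only [outerIntegrand, im_translation_smul, hf.periodic, IsCuspidal.primitive_translation_smul]

theorem cosetMap_inv (c : Cosets κ) : (cosetMap κ σ c)⁻¹ = (c.out : PSL(2, ℝ))⁻¹ * σ := by
  rw [cosetMap, mul_inv_rev, inv_inv]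

theorem pullback_cosetMap_inv (hφ : IsQuadraticDifferential Γ F φ) (c : Cosets κ) :
    pullback φ (cosetMap κ σ c)⁻¹ = pullback φ σ := by
  rw [cosetMap_inv]
  exact pullback_mul hφ.automorphic (Γ.inv_mem c.out.2) σ

/-- The product `y⁴ conj(φ) ψ` is invariant under `Γ`, so that a term of the Takhtajan–Zograf integrand
depends on the coset only through the point `σ⁻¹ γ z`. -/
theorem mul_conj_mul_im_sq (hφ : IsQuadraticDifferential Γ F φ) (hψ : IsQuadraticDifferential Γ F ψ)
    (c : Cosets κ) (z : ℍ) :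
    beltrami φ z * conj (beltrami ψ z) * ((cosetMap κ σ c • z).im : ℂ) ^ 2 =
      ((cosetMap κ σ c • z).im : ℂ) ^ 2 * (((cosetMap κ σ c • z).im : ℂ) ^ 4 *
        (conj (pullback φ σ (cosetMap κ σ c • z)) * pullback ψ σ (cosetMap κ σ c • z))) := by
  have h := im_smul_pow_four (cosetMap κ σ c)⁻¹ (cosetMap κ σ c • z)
  rw [inv_smul_smul] at h
  rw [← pullback_cosetMap_inv hφ c, ← pullback_cosetMap_inv hψ c, pullback, pullback, inv_smul_smul,
    beltrami, beltrami]
  simp only [map_mul, map_pow, Complex.conj_ofReal, Complex.conj_conj]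
  linear_combination conj (φ z) * ψ z * ((cosetMap κ σ c • z).im : ℂ) ^ 2 * h

variable [DiscreteTopology Γ]

/-- The conjugate attached to a coset and an exponent `l` is a conjugate of the translation by `m = ±l`,
the sign being that of the scaling element. -/
theorem exists_equiv_conjPowers (hσ : IsScaling κ σ) :
    ∃ e : Cosets κ × {l : ℤ // l ≠ 0} ≃ conjPowers κ, ∀ p, ∃ m : ℤ, m ≠ 0 ∧ m ^ 2 = (p.2 : ℤ) ^ 2 ∧
      ((e p : Γ) : PSL(2, ℝ)) * (cosetMap κ σ p.1)⁻¹ = (cosetMap κ σ p.1)⁻¹ * translation m := by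
  obtain ⟨ε, hε, h⟩ := hσ.exists_sign
  refine ⟨Equiv.ofBijective _ (bijective_conjPowers hσ), fun p => ⟨ε * p.2, ?_, ?_, ?_⟩⟩
  · have := p.2.2
    rcases hε with rfl | rfl <;> simpa using this
  · rcases hε with rfl | rfl <;> ring
  · rw [Equiv.ofBijective_apply, Subgroup.coe_mul, Subgroup.coe_mul, h, cosetMap_inv,
      Subgroup.coe_inv]
    group

/-- The Takhtajan–Zograf integrand is the sum over the cosets of one translation-invariant function,
evaluated at the points `σ⁻¹ γ z`. -/
theorem hasSum_mul_eisenstein (hσ : IsScaling κ σ) (hφ : IsQuadraticDifferential Γ F φ)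
    (hψ : IsQuadraticDifferential Γ F ψ) (z : ℍ) :
    HasSum (fun c : Cosets κ => ((cosetMap κ σ c • z).im : ℂ) ^ 2 *
      (((cosetMap κ σ c • z).im : ℂ) ^ 4 * (conj (pullback φ σ (cosetMap κ σ c • z)) *
        pullback ψ σ (cosetMap κ σ c • z))))
      (beltrami φ z * conj (beltrami ψ z) * eisenstein κ σ z 2) := by
  have h := (summable_eisensteinTerm hσ z).hasSum.mul_left (beltrami φ z * conj (beltrami ψ z))
  simpa only [eisenstein, eisensteinTerm_two, Complex.ofReal_pow, mul_conj_mul_im_sq hφ hψ] using h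

/-- The unfolded form of the Takhtajan–Zograf metric. -/
theorem integrableOn_and_cuspMetric_eq (hF : IsFundamentalDomain Γ F (volume : Measure ℍ))
    (hκ : IsParabolicGenerator κ) (hσ : IsScaling κ σ) (hφ : IsQuadraticDifferential Γ F φ)
    (hψ : IsQuadraticDifferential Γ F ψ) :
    IntegrableOn (fun z => beltrami φ z * conj (beltrami ψ z) * eisenstein κ σ z 2) F ∧
    cuspMetric κ σ F (beltrami φ) (beltrami ψ) = ∫ z in strip,
      (z.im : ℂ) ^ 4 * (conj (pullback φ σ z) * pullback ψ σ z) ∂euclideanArea := by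
  have := countable_cosets κ
  have hf := hφ.isCuspidal hF hκ hσ
  have hg := hψ.isCuspidal hF hκ hσ
  have him : Measurable fun w : ℍ => (w.im : ℂ) :=
    Complex.measurable_ofReal.comp UpperHalfPlane.continuous_im.measurable
  set G : ℍ → ℂ := fun z => (z.im : ℂ) ^ 2 *
    ((z.im : ℂ) ^ 4 * (conj (pullback φ σ z) * pullback ψ σ z)) with hG
  have hGm : Measurable G := (him.pow_const 2).mul ((him.pow_const 4).mul
    ((Complex.continuous_conj.measurable.comp hf.continuous.measurable).mul hg.continuous.measurable))
  have hT : ∀ (n : ℤ) (z : ℍ), G (translation n • z) = G z := fun n z => by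
    simp only [hG, im_translation_smul, hf.periodic, hg.periodic]
  have hGi : IntegrableOn G strip := (integrableOn_volume_iff strip).mpr (hf.integrableOn_mul hg)
  have hfin := tsum_setLIntegral_enorm_lt_top hF hκ hσ hGm hT hGi
  have hsum : ∀ z, HasSum (fun c : Cosets κ => G (cosetMap κ σ c • z))
      (beltrami φ z * conj (beltrami ψ z) * eisenstein κ σ z 2) := hasSum_mul_eisenstein hσ hφ hψ
  have hcm : ∀ c : Cosets κ, Measurable fun z => G (cosetMap κ σ c • z) :=
    fun c => hGm.comp (measurable_const_smul _)
  have heq : (fun z => beltrami φ z * conj (beltrami ψ z) * eisenstein κ σ z 2) =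
      fun z => ∑' c : Cosets κ, G (cosetMap κ σ c • z) := funext fun z => (hsum z).tsum_eq.symm
  refine ⟨?_, ?_⟩
  · rw [heq]
    refine ⟨(Measurable.tsum hcm).aestronglyMeasurable, ?_⟩
    have hem : ∀ c : Cosets κ, AEMeasurable (fun z => ‖G (cosetMap κ σ c • z)‖ₑ)
        (volume.restrict F) := fun c => (hcm c).enorm.aemeasurable
    rw [← lintegral_tsum hem] at hfin
    refine lt_of_le_of_lt (lintegral_mono fun z => ?_) hfin
    exact enorm_tsum_le_tsum_enorm
  · rw [cuspMetric, heq, integral_tsum (fun c => (hcm c).aestronglyMeasurable) hfin.ne,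
      tsum_setIntegral_cosetMap hF hκ hσ hGm hT hGi, hG, setIntegral_volume]

/-- The unfolded form of the sum over the conjugates of the powers of `κ`. The term of a coset and an
exponent `l` is the product of `-1 / (4πl²)` and of a factor depending on the coset only, so that the
sum over the exponents contributes `-(1 / 4π) (π² / 3) = -π / 12`. -/
theorem integrable_and_hasSum_conjPowers (hF : IsFundamentalDomain Γ F (volume : Measure ℍ))
    (hκ : IsParabolicGenerator κ) (hσ : IsScaling κ σ) (hφ : IsQuadraticDifferential Γ F φ)
    (hψ : IsQuadraticDifferential Γ F ψ) :
    (∀ γ ∈ conjPowers κ, ∀ z : ℍ,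
      Integrable (fun w : ℍ => kernel (beltrami φ) (beltrami ψ) γ z w) euclideanArea) ∧
    (∀ γ ∈ conjPowers κ, IntegrableOn
      (fun z : ℍ => ∫ w : ℍ, kernel (beltrami φ) (beltrami ψ) γ z w ∂euclideanArea) F
      euclideanArea) ∧
    HasSum (fun γ : conjPowers κ => ∫ z in F, ∫ w : ℍ,
        kernel (beltrami φ) (beltrami ψ) (γ : Γ) z w ∂euclideanArea ∂euclideanArea)
      (-(Real.pi / 12) * ∫ z in strip, (z.im : ℂ) ^ 2 *
        (conj (pullback φ σ z) * IsCuspidal.primitive (pullback ψ σ) z) ∂euclideanArea) := by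
  have hf := hφ.isCuspidal hF hκ hσ
  have hg := hψ.isCuspidal hF hκ hσ
  have hgc : ∀ c : Cosets κ, IsCuspidal (pullback ψ (cosetMap κ σ c)⁻¹) := fun c => by
    rwa [pullback_cosetMap_inv hψ]
  obtain ⟨e, he⟩ := exists_equiv_conjPowers (κ := κ) hσ
  set G : ℍ → ℂ := outerIntegrand (pullback φ σ) (pullback ψ σ) with hG
  have hGm : Measurable G := measurable_outerIntegrand hf.continuous.measurable _
  have hT : ∀ (n : ℤ) (z : ℍ), G (translation n • z) = G z := outerIntegrand_translation_smul hf _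
  have hGi : IntegrableOn G strip :=
    (integrableOn_volume_iff strip).mpr (hf.integrableOn_mul_primitive hg)
  have hfin := tsum_setLIntegral_enorm_lt_top hF hκ hσ hGm hT hGi
  have hker : ∀ p z, (z.im : ℂ) ^ 2 *
      ∫ w, kernel (beltrami φ) (beltrami ψ) ((e p : Γ) : PSL(2, ℝ)) z w ∂euclideanArea =
      -(1 / (4 * Real.pi * ((p.2 : ℤ) : ℂ) ^ 2)) * G (cosetMap κ σ p.1 • z) := by
    intro p z
    obtain ⟨m, hm, hml, hγ⟩ := he p
    rw [im_sq_mul_integral_kernel φ (hgc p.1) hγ hm, inv_inv, pullback_cosetMap_inv hφ,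
      pullback_cosetMap_inv hψ]
    have : (m : ℂ) ^ 2 = ((p.2 : ℤ) : ℂ) ^ 2 := by exact_mod_cast hml
    rw [this]
  refine ⟨fun γ hγ z => ?_, fun γ hγ => ?_, ?_⟩
  · obtain ⟨p, hp⟩ := e.surjective ⟨γ, hγ⟩
    obtain ⟨m, -, -, hm⟩ := he p
    rw [hp] at hm
    exact integrable_kernel φ (hgc p.1) hm z
  · obtain ⟨p, hp⟩ := e.surjective ⟨γ, hγ⟩
    have h1 := hker p
    rw [hp] at h1
    rw [← integrableOn_volume_iff]
    simp only [h1]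
    exact (integrableOn_cosetMap hF hκ hσ hGm hT hGi p.1).const_mul _
  have hval : ∀ p, ∫ z in F, ∫ w : ℍ,
      kernel (beltrami φ) (beltrami ψ) ((e p : Γ) : PSL(2, ℝ)) z w ∂euclideanArea ∂euclideanArea =
      (∫ z in F, G (cosetMap κ σ p.1 • z)) * -(1 / (4 * Real.pi * ((p.2 : ℤ) : ℂ) ^ 2)) := by
    intro p
    rw [← setIntegral_volume]
    simp only [hker p]
    rw [integral_const_mul, mul_comm]
  have hc : Summable fun c : Cosets κ => ‖∫ z in F, G (cosetMap κ σ c • z)‖ := by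
    have h2 : ∑' c : Cosets κ, ‖∫ z in F, G (cosetMap κ σ c • z)‖ₑ ≠ ⊤ :=
      ne_top_of_le_ne_top hfin.ne (ENNReal.tsum_le_tsum fun c => enorm_integral_le_lintegral_enorm _)
    simpa only [toReal_enorm] using ENNReal.summable_toReal h2
  have hl : HasSum (fun l : {l : ℤ // l ≠ 0} => -(1 / (4 * (Real.pi : ℂ) * ((l : ℤ) : ℂ) ^ 2)))
      (-((Real.pi : ℂ) / 12)) := by
    have h1 := (Complex.hasSum_ofReal.mpr hasSum_int_ne_zero_inv_sq).mul_left
      (-(1 / (4 * (Real.pi : ℂ))))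
    have hpi : (Real.pi : ℂ) ≠ 0 := by exact_mod_cast Real.pi_ne_zero
    have hv : -(1 / (4 * (Real.pi : ℂ))) * ((Real.pi ^ 2 / 3 : ℝ) : ℂ) = -((Real.pi : ℂ) / 12) := by
      push_cast
      field_simp
      norm_num
    rw [hv] at h1
    refine h1.congr_fun fun l => ?_
    have := l.2
    push_cast
    field_simp
  have hln : Summable fun l : {l : ℤ // l ≠ 0} => ‖-(1 / (4 * Real.pi * ((l : ℤ) : ℂ) ^ 2))‖ :=
    hl.summable.norm
  rw [← e.hasSum_iff]
  have h3 := (summable_mul_of_summable_norm hc hln).hasSum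
  rw [← tsum_mul_tsum_of_summable_norm hc hln, hl.tsum_eq,
    tsum_setIntegral_cosetMap hF hκ hσ hGm hT hGi] at h3
  have h4 : ∫ z in strip, G z = ∫ z in strip, (z.im : ℂ) ^ 2 *
      (conj (pullback φ σ z) * IsCuspidal.primitive (pullback ψ σ) z) ∂euclideanArea :=
    setIntegral_volume strip _
  rw [h4] at h3
  rw [mul_comm]
  exact h3.congr_fun hval

end Cusp

end TZ

end

theorem mainTheorem9 (Γ : Subgroup PSL(2, ℝ)) [DiscreteTopology Γ]
    (F : Set ℍ) (hF : IsFundamentalDomain Γ F (volume : Measure ℍ))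
    (hcofinite : (volume : Measure ℍ) F < ⊤)
    (κ : Γ) (hκ : TZ.IsParabolicGenerator κ)
    (σ : PSL(2, ℝ)) (hσ : TZ.IsScaling κ σ)
    (μ ν : ℍ → ℂ) (hμ : TZ.IsHarmonicBeltrami Γ F μ) (hν : TZ.IsHarmonicBeltrami Γ F ν) :
    (∀ z : ℍ, Summable (TZ.eisensteinTerm κ σ 2 z)) ∧
    IntegrableOn (fun z : ℍ => μ z * conj (ν z) * TZ.eisenstein κ σ z 2) F volume ∧
    (∀ γ ∈ TZ.conjPowers κ, ∀ z : ℍ,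
      Integrable (fun w : ℍ => TZ.kernel μ ν γ z w) TZ.euclideanArea) ∧
    (∀ γ ∈ TZ.conjPowers κ,
      IntegrableOn (fun z : ℍ => ∫ w : ℍ, TZ.kernel μ ν γ z w ∂TZ.euclideanArea) F
        TZ.euclideanArea) ∧
    Summable (fun γ : TZ.conjPowers κ =>
      ∫ z in F, ∫ w : ℍ, TZ.kernel μ ν (γ : Γ) z w ∂TZ.euclideanArea ∂TZ.euclideanArea) ∧
    TZ.cuspMetric κ σ F μ ν = ((-(9 / Real.pi ^ 3) : ℝ) : ℂ) *
      ∑' γ : TZ.conjPowers κ,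
        ∫ z in F, ∫ w : ℍ, TZ.kernel μ ν (γ : Γ) z w ∂TZ.euclideanArea ∂TZ.euclideanArea := by
  obtain ⟨φ, hφ, hμφ⟩ := hμ
  obtain ⟨ψ, hψ, hνψ⟩ := hν
  obtain rfl : μ = TZ.beltrami φ := funext hμφ
  obtain rfl : ν = TZ.beltrami ψ := funext hνψ
  obtain ⟨h1, h2⟩ := TZ.integrableOn_and_cuspMetric_eq hF hκ hσ hφ hψ
  obtain ⟨h3, h4, h5⟩ := TZ.integrable_and_hasSum_conjPowers hF hκ hσ hφ hψ
  refine ⟨TZ.summable_eisensteinTerm hσ, h1, h3, h4, h5.summable, ?_⟩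
  rw [h2, h5.tsum_eq, (hφ.isCuspidal hF hκ hσ).setIntegral_mul_eq (hψ.isCuspidal hF hκ hσ), ← mul_assoc]
  -- the constants: `3 / (4π²) = (9 / π³) (π / 12)`
  congr 1
  have hpi : (Real.pi : ℂ) ≠ 0 := by exact_mod_cast Real.pi_ne_zero
  push_cast
  field_simp
  norm_num
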